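/- **Setting.** Let $\mathbb H$ be the quaternions with inner product $p\cdot p'=\mathrm{Re}(p'p^*)$, $\mathbb H_1$ the unit quaternions (a 3-sphere) with surface measure $\mathrm dq$, and $\nabla_q$, $\nabla_q\cdot$, $\Delta_q$ the gradient, divergence and Laplacian of $\mathbb H_1$. Vectors of $\mathbb R^3$ are identified with purely imaginary quaternions. Let $\nu,D>0$, $d=D/\nu$, $T>0$, let $\mathbf e_1\in\mathbb R^3$ be a unit vector, and put $\mathbf e_1(q)=\mathrm{Im}(q\,\mathbf e_1q^*)$. For $\bar q\in\mathbb H_1$ let $$M_{\bar q}(q)=\frac1Z\exp\Big(\frac2d\big((\bar q\cdot q)^2-\tfrac14\big)\Big),\qquad \int_{\mathbb H_1}M_{\bar q}\,\mathrm dq=1 .$$ For $g\ge 0$ on $\mathbb H_1$ let $Q_g=\int_{\mathbb H_1}g(q)\,(q\otimes q-\frac14\mathrm{Id})\,\mathrm dq$, let $\bar q_g$ be a maximiser of $q\mapsto q\cdot Q_gq$ over $\mathbb H_1$ (a unit eigenvector of the maximal eigenvalue, unique up to sign if that eigenvalue is simple), and $$\Gamma(g)=-\nu\,\nabla_q\cdot\big(P_{q^\perp}((\bar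 q_g\otimes\bar q_g)q)\,g\big)+\frac D4\Delta_qg ,$$ where $P_{q^\perp}$ is the orthogonal projection onto $q^\perp$. For $0<\varepsilon<\varepsilon_0$ let $f^\varepsilon=f^\varepsilon(t,x,q)\ge0$ be classical solutions ($C^1$ in $(t,x,q)$, $C^2$ in $q$) on $(0,T)\times\mathbb R^3\times\mathbb H_1$ of $$\partial_tf^\varepsilon+\nabla_x\cdot(\mathbf e_1(q)f^\varepsilon)=\frac1\varepsilon\Gamma(f^\varepsilon)+\mathcal O(\varepsilon),$$ for some choice of the maximisers $\bar q_{f^\varepsilon}$, where the remainder is $\mathcal O(\varepsilon)$ in $L^1(\mathrm dq)$ at every $(t,x)$. All limits are for $\varepsilon\to0^+$. **Constants.** There is a function $h\in C^2(-1,1)$, unique, that satisfies $$(1-r^2)^{3/2}e^{2r^2/d}\Big(-\frac4dr^2-3\Big)h(r)+\frac{\mathrm d}{\mathrm dr}\Big[(1-r^2)^{5/2}e^{2r^2/d}h'(r)\Big]=r(1-r^2)^{3/2}e^{2r^2/d}\quad\text{on }(-1,1),$$ $\int_{-1}^1(1-r^2)^{3/2}h^2\,\mathrm dr<\infty$ and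 $\int_{-1}^1(1-r^2)^{5/2}(h')^2\,\mathrm dr<\infty$. Let $m(\theta)=\exp(d^{-1}(\frac12+\cos\theta))$ and $\langle g\rangle_w=\int_0^\pi g\,w\,\mathrm d\theta\big/\int_0^\pi w\,\mathrm d\theta$. The weight $m\sin^4(\theta/2)h(\cos(\theta/2))\cos(\theta/2)$ is integrable on $(0,\pi)$ with non-zero integral, and one sets $$c_1=\tfrac23\big\langle\tfrac12+\cos\theta\big\rangle_{m\sin^2(\theta/2)},\qquad c_2=\tfrac15\big\langle1+4\cos\theta\big\rangle_{m\sin^4(\theta/2)h(\cos(\theta/2))\cos(\theta/2)},$$ $$c_3=\tfrac d2,\qquad c_4=\tfrac15\big\langle1-\cos\theta\big\rangle_{m\sin^4(\theta/2)h(\cos(\theta/2))\cos(\theta/2)} .$$ **Theorem (macroscopic limit).** (i) Suppose that at every $(t,x)\in(0,T)\times\mathbb R^3$, in $L^1(\mathrm dq)$, $f^\varepsilon(t,x,\cdot)\to f(t,x,\cdot)$ and the first derivatives of $f^\varepsilon$ in $(t,x)$ are $o(1/\varepsilon)$. Then there are $\rho=\rho(t,x)\ge0$ and $\bar q=\bar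 q(t,x)\in\mathbb H_1$ such that $f(t,x,\cdot)=\rho(t,x)M_{\bar q(t,x)}$ for every $(t,x)$ (almost everywhere in $q$). (ii) Suppose moreover that the limit is $\rho M_{\bar q}$ with differentiable functions $\rho\ge0$ and $\bar q\in\mathbb H_1$ of $(t,x)\in(0,T)\times\mathbb R^3$, and that at every $(t,x)$ the functions $f^\varepsilon,\partial_tf^\varepsilon,\partial_{x_i}f^\varepsilon$ $(i=1,2,3)$ converge in $L^1(\mathrm dq)$ to $\rho M_{\bar q},\partial_t(\rho M_{\bar q}),\partial_{x_i}(\rho M_{\bar q})$. Then at every point of $(0,T)\times\mathbb R^3$ $$\partial_t\rho+\nabla_x\cdot(c_1\mathbf e_1(\bar q)\rho)=0,$$ $$\rho\big(\partial_t\bar q+c_2(\mathbf e_1(\bar q)\cdot\nabla_x)\bar q\big)+c_3\big[\mathbf e_1(\bar q)\times\nabla_x\rho\big]\bar q+c_4\,\rho\,\big[\nabla_{x,\mathrm{rel}}\bar q\;\mathbf e_1(\bar q)+(\nabla_{x,\mathrm{rel}}\cdot\bar q)\,\mathbf e_1(\bar q)\big]\bar q=0,$$ where $\partial_{x_i,\mathrm{rel}}\bar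 q=(\partial_{x_i}\bar q)\bar q^*$, $\nabla_{x,\mathrm{rel}}\bar q\;\mathbf e_1(\bar q)=\big((\partial_{x_i,\mathrm{rel}}\bar q)\cdot\mathbf e_1(\bar q)\big)_{i=1,2,3}$ and $\nabla_{x,\mathrm{rel}}\cdot\bar q=\sum_{i=1}^3(\partial_{x_i,\mathrm{rel}}\bar q)_i$. -/

import Mathlib

open MeasureTheory Filter Topology Set Asymptotics

noncomputable section

namespace SOHQ

/-! ## Quaternions, unit quaternions, and vectors of three-dimensional space -/

/-- The quaternions, with Mathlib's Euclidean inner product `p · p' = Re (p' p*)`. -/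
abbrev Quat : Type := Quaternion ℝ

/-- Three-dimensional Euclidean space. -/
abbrev E3 : Type := EuclideanSpace ℝ (Fin 3)

/-- The unit quaternions, as the unit sphere of the quaternions. -/
abbrev H1 : Type := Metric.sphere (0 : Quat) 1

instance quatMeasurableSpace : MeasurableSpace Quat := borel Quat

instance quatBorelSpace : BorelSpace Quat := ⟨rfl⟩

/-- The Lebesgue (surface) measure `dq` on the unit quaternions. -/
def dq : Measure H1 := (volume : Measure Quat).toSphere

/-- A vector, seen as a purely imaginary quaternion. -/
def ofVec (v : E3) : Quat := ⟨0, v 0, v 1, v 2⟩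

/-- The imaginary part of a quaternion, seen as a vector. -/
def imVec (p : Quat) : E3 := !₂[p.imI, p.imJ, p.imK]

/-- The rotation of the vector `v` by the quaternion `q`: `Im (q v q*)`. -/
def rotate (v : E3) (q : Quat) : E3 := imVec (q * ofVec v * star q)

/-- The vector product. -/
def cross (v w : E3) : E3 :=
  !₂[v 1 * w 2 - v 2 * w 1, v 2 * w 0 - v 0 * w 2, v 0 * w 1 - v 1 * w 0]

/-! ## Differential operators in space -/

/-- The partial derivative `∂_{x_i} g` at `x`. -/
def partialX {F : Type} [NormedAddCommGroup F] [NormedSpace ℝ F]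
    (i : Fin 3) (g : E3 → F) (x : E3) : F :=
  fderiv ℝ g x (EuclideanSpace.single i 1)

/-- The gradient `∇_x g` at `x`. -/
def gradX (g : E3 → ℝ) (x : E3) : E3 := WithLp.toLp 2 (fun i => partialX i g x)

/-- The divergence `∇_x · V` at `x`. -/
def divX (V : E3 → E3) (x : E3) : ℝ := ∑ i : Fin 3, partialX i (fun y => V y i) x

/-- The directional derivative `(v · ∇_x) g` at `x`, for a quaternion-valued `g`. -/
def advect (v : E3) (g : E3 → Quat) (x : E3) : Quat := ∑ i : Fin 3, v i • partialX i g x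

/-- The right relative derivative `∂_{x_i,rel} g = (∂_{x_i} g) g*` at `x`. -/
def relPartial (i : Fin 3) (g : E3 → Quat) (x : E3) : Quat := partialX i g x * star (g x)

/-- The product `∇_{x,rel} g v = ((∂_{x_i,rel} g) · v)_i`, with the inner product of quaternions. -/
def relGradMul (g : E3 → Quat) (v : E3) (x : E3) : E3 :=
  WithLp.toLp 2 (fun i => inner ℝ (relPartial i g x) (ofVec v))

/-- The relative divergence `∇_{x,rel} · g = ∑ i, (∂_{x_i,rel} g)_i`. -/
def relDiv (g : E3 → Quat) (x : E3) : ℝ := ∑ i : Fin 3, imVec (relPartial i g x) i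

/-! ## Differential operators on the unit quaternions -/

/-- The radial projection onto the unit quaternions of a nonzero quaternion. -/
def radial (p : Quat) (hp : p ≠ 0) : H1 :=
  ⟨‖p‖⁻¹ • p, by simp [norm_smul, hp]⟩

open Classical in
/-- The extension `p ↦ g (p / |p|)` of a function on the unit quaternions to all nonzero
quaternions (with the value `0` at `p = 0`). -/
def homExt {F : Type} [Zero F] (g : H1 → F) (p : Quat) : F :=
  if hp : p ≠ 0 then g (radial p hp) else 0

/-- The gradient `∇_q g` on the unit quaternions; since the extension is constant along rays, the
Euclidean gradient is the tangential one. -/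
def gradQ (g : H1 → ℝ) (q : H1) : Quat := gradient (homExt g) (q : Quat)

/-- The divergence `∇_q · V` on the unit quaternions of a tangent vector field; since the extension
is constant along rays, the Euclidean divergence (the trace of the derivative) is the intrinsic one.
-/
def divQ (V : H1 → Quat) (q : H1) : ℝ :=
  LinearMap.trace ℝ Quat (fderiv ℝ (homExt V) (q : Quat)).toLinearMap

/-- The Laplace-Beltrami operator on the unit quaternions. -/
def lapQ (g : H1 → ℝ) (q : H1) : ℝ := divQ (gradQ g) q

/-- The orthogonal projection of `p` onto the orthogonal space of the unit quaternion `q`. -/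
def projPerp (q : H1) (p : Quat) : Quat := p - inner ℝ (q : Quat) p • (q : Quat)

/-! ## The kinetic equation -/

/-- The tensor `Q_g = ∫ g(q) (q ⊗ q - Id / 4) dq`, applied to `p`. -/
def qTensor (g : H1 → ℝ) (p : Quat) : Quat :=
  ∫ q : H1, g q • (inner ℝ (q : Quat) p • (q : Quat) - (1 / 4 : ℝ) • p) ∂dq

/-- `qbar` maximises `q ↦ q · Q_g q` over the unit quaternions, i.e. it is a unit eigenvector of the
maximal eigenvalue of `Q_g`. It is unique up to its sign when that eigenvalue is simple. -/
def IsMeanQuat (g : H1 → ℝ) (qbar : H1) : Prop :=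
  ∀ p : H1, inner ℝ (p : Quat) (qTensor g p) ≤ inner ℝ (qbar : Quat) (qTensor g qbar)

/-- The collision operator
`Γ(g) = -ν ∇_q · (P_{q^⊥} ((qbar ⊗ qbar) q) g) + (D / 4) Δ_q g`, where `qbar` is to be a mean
quaternion of `g`. -/
def collision (ν D : ℝ) (qbar : H1) (g : H1 → ℝ) (q : H1) : ℝ :=
  -ν * divQ (fun p => g p • projPerp p (inner ℝ (qbar : Quat) (p : Quat) • (qbar : Quat))) q
    + D / 4 * lapQ g q

/-- The transport term `∂_t f + ∇_x · (e₁(q) f)`. -/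
def transport (e₁ : E3) (f : ℝ → E3 → H1 → ℝ) (t : ℝ) (x : E3) (q : H1) : ℝ :=
  deriv (fun s => f s x q) t + divX (fun y => f t y q • rotate e₁ q) x

/-- `(f ε)`, for `0 < ε < ε₀`, is a family of nonnegative classical solutions on
`(0, T) × ℝ³ × ℍ₁` of the rescaled kinetic equation
`∂_t f + ∇_x · (e₁(q) f) = Γ(f) / ε + O(ε)`. The remainder is `O(ε)` in `L¹(dq)` at every `(t, x)`. -/
structure IsKineticFamily (ν D : ℝ) (e₁ : E3) (T ε₀ : ℝ) (f : ℝ → ℝ → E3 → H1 → ℝ) : Prop where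
  nonneg : ∀ ε ∈ Ioo 0 ε₀, ∀ t ∈ Ioo 0 T, ∀ x q, 0 ≤ f ε t x q
  contDiff_one : ∀ ε ∈ Ioo 0 ε₀,
    ContDiffOn ℝ 1 (fun z : ℝ × E3 × Quat => homExt (f ε z.1 z.2.1) z.2.2)
      (Ioo 0 T ×ˢ (univ ×ˢ {0}ᶜ))
  contDiff_two : ∀ ε ∈ Ioo 0 ε₀, ∀ t ∈ Ioo 0 T, ∀ x, ContDiffOn ℝ 2 (homExt (f ε t x)) {0}ᶜ
  equation : ∃ qbar : ℝ → ℝ → E3 → H1,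
    (∀ ε ∈ Ioo 0 ε₀, ∀ t ∈ Ioo 0 T, ∀ x, IsMeanQuat (f ε t x) (qbar ε t x)) ∧
    ∀ t ∈ Ioo 0 T, ∀ x,
      (fun ε => ∫ q, |transport e₁ (f ε) t x q
          - 1 / ε * collision ν D (qbar ε t x) (f ε t x) q| ∂dq)
        =O[𝓝[>] (0 : ℝ)] (fun ε => ε)

/-- Convergence `u ε → v` in `L¹(dq)` as `ε → 0`, `ε > 0`. -/
def TendstoL1 (u : ℝ → H1 → ℝ) (v : H1 → ℝ) : Prop :=
  Integrable v dq ∧ (∀ᶠ ε in 𝓝[>] (0 : ℝ), Integrable (u ε) dq) ∧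
    Tendsto (fun ε => ∫ q, |u ε q - v q| ∂dq) (𝓝[>] (0 : ℝ)) (𝓝 0)

/-- The formal convergence `f ε → F`: at every `(t, x)`, `f ε` converges to `F` in `L¹(dq)` and the
first derivatives of `f ε` in `(t, x)` do not blow up as fast as `1 / ε`. -/
def FormalLimit (T : ℝ) (f : ℝ → ℝ → E3 → H1 → ℝ) (F : ℝ → E3 → H1 → ℝ) : Prop :=
  ∀ t ∈ Ioo 0 T, ∀ x,
    TendstoL1 (fun ε => f ε t x) (F t x) ∧
    TendstoL1 (fun ε q => ε * deriv (fun s => f ε s x q) t) 0 ∧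
    ∀ i, TendstoL1 (fun ε q => ε * partialX i (fun y => f ε t y q) x) 0

/-- The strong convergence `f ε → F`: at every `(t, x)`, `f ε` and its first derivatives in `(t, x)`
converge to those of `F` in `L¹(dq)`. -/
def StrongLimit (T : ℝ) (f : ℝ → ℝ → E3 → H1 → ℝ) (F : ℝ → E3 → H1 → ℝ) : Prop :=
  ∀ t ∈ Ioo 0 T, ∀ x,
    TendstoL1 (fun ε => f ε t x) (F t x) ∧
    TendstoL1 (fun ε q => deriv (fun s => f ε s x q) t) (fun q => deriv (fun s => F s x q) t) ∧
    ∀ i, TendstoL1 (fun ε q => partialX i (fun y => f ε t y q) x)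
      (fun q => partialX i (fun y => F t y q) x)

/-! ## The equilibria, the collision invariant and the constants -/

/-- The unnormalised equilibrium `exp ((2 / d) ((qbar · q)² - 1 / 4))`. -/
def gibbs (d : ℝ) (qbar q : H1) : ℝ :=
  Real.exp (2 / d * ((inner ℝ (qbar : Quat) (q : Quat)) ^ 2 - 1 / 4))

/-- The von Mises equilibrium `M_{qbar}(q)`. -/
def vonMises (d : ℝ) (qbar q : H1) : ℝ := gibbs d qbar q / ∫ p, gibbs d qbar p ∂dq

/-- `h` is a solution, twice continuously differentiable on `(-1, 1)`, of
`(1-r²)^{3/2} e^{2r²/d} (-4r²/d - 3) h + ((1-r²)^{5/2} e^{2r²/d} h')' = r (1-r²)^{3/2} e^{2r²/d}`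
in the space of the functions with `∫ (1-r²)^{3/2} h² < ∞` and `∫ (1-r²)^{5/2} h'² < ∞`. -/
structure IsGCIProfile (d : ℝ) (h : ℝ → ℝ) : Prop where
  contDiff : ContDiffOn ℝ 2 h (Ioo (-1) 1)
  integrable_sq : IntegrableOn (fun r => (1 - r ^ 2) ^ (3 / 2 : ℝ) * h r ^ 2) (Ioo (-1) 1)
  integrable_deriv_sq :
    IntegrableOn (fun r => (1 - r ^ 2) ^ (5 / 2 : ℝ) * deriv h r ^ 2) (Ioo (-1) 1)
  ode : ∀ r ∈ Ioo (-1 : ℝ) 1,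
    (1 - r ^ 2) ^ (3 / 2 : ℝ) * Real.exp (2 * r ^ 2 / d) * (-4 / d * r ^ 2 - 3) * h r
      + deriv (fun s => (1 - s ^ 2) ^ (5 / 2 : ℝ) * Real.exp (2 * s ^ 2 / d) * deriv h s) r
      = r * (1 - r ^ 2) ^ (3 / 2 : ℝ) * Real.exp (2 * r ^ 2 / d)

/-- The angular average `⟨g⟩_w = ∫_0^π g w / ∫_0^π w`. -/
def angAvg (g w : ℝ → ℝ) : ℝ :=
  ∫ θ in (0 : ℝ)..Real.pi, g θ * (w θ / ∫ θ' in (0 : ℝ)..Real.pi, w θ')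

/-- `m(θ) = exp ((1 / 2 + cos θ) / d)`. -/
def mFun (d θ : ℝ) : ℝ := Real.exp (d⁻¹ * (1 / 2 + Real.cos θ))

/-- The weight `m sin²(θ/2)`. -/
def weightOne (d θ : ℝ) : ℝ := mFun d θ * Real.sin (θ / 2) ^ 2

/-- The weight `m sin⁴(θ/2) h(cos(θ/2)) cos(θ/2)`. -/
def weightTwo (d : ℝ) (h : ℝ → ℝ) (θ : ℝ) : ℝ :=
  mFun d θ * Real.sin (θ / 2) ^ 4 * h (Real.cos (θ / 2)) * Real.cos (θ / 2)

def c1 (d : ℝ) : ℝ := 2 / 3 * angAvg (fun θ => 1 / 2 + Real.cos θ) (weightOne d)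

def c2 (d : ℝ) (h : ℝ → ℝ) : ℝ := 1 / 5 * angAvg (fun θ => 1 + 4 * Real.cos θ) (weightTwo d h)

def c3 (d : ℝ) : ℝ := d / 2

def c4 (d : ℝ) (h : ℝ → ℝ) : ℝ := 1 / 5 * angAvg (fun θ => 1 - Real.cos θ) (weightTwo d h)

/-! ## The macroscopic system -/

/-- The continuity equation `∂_t ρ + ∇_x · (c₁ e₁(qbar) ρ) = 0` at `(t, x)`. -/
def ContinuityEq (d : ℝ) (e₁ : E3) (ρ : ℝ → E3 → ℝ) (qbar : ℝ → E3 → H1) (t : ℝ) (x : E3) :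
    Prop :=
  deriv (fun s => ρ s x) t + divX (fun y => (c1 d * ρ t y) • rotate e₁ (qbar t y)) x = 0

/-- The equation
`ρ (∂_t qbar + c₂ (e₁(qbar) · ∇_x) qbar) + c₃ [e₁(qbar) × ∇_x ρ] qbar
  + c₄ ρ [∇_{x,rel} qbar e₁(qbar) + (∇_{x,rel} · qbar) e₁(qbar)] qbar = 0` at `(t, x)`. -/
def OrientationEq (d : ℝ) (h : ℝ → ℝ) (e₁ : E3) (ρ : ℝ → E3 → ℝ) (qbar : ℝ → E3 → H1)
    (t : ℝ) (x : E3) : Prop :=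
  ρ t x • (deriv (fun s => (qbar s x : Quat)) t
      + c2 d h • advect (rotate e₁ (qbar t x)) (fun y => (qbar t y : Quat)) x)
    + c3 d • (ofVec (cross (rotate e₁ (qbar t x)) (gradX (ρ t) x)) * (qbar t x : Quat))
    + (c4 d h * ρ t x) •
      (ofVec (relGradMul (fun y => (qbar t y : Quat)) (rotate e₁ (qbar t x)) x
          + relDiv (fun y => (qbar t y : Quat)) x • rotate e₁ (qbar t x)) * (qbar t x : Quat))
    = 0

end SOHQ

end

/-!
# The macroscopic limit of the kinetic equation on the unit quaternions

A unit quaternion `q` is described relative to a mean quaternion `qbar` by the real part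
`r = rcoord qbar q` and the imaginary part `pcoord qbar · q` of `q qbar*`. Left multiplication by the
circles `rotor ξ s` gives flows on the sphere that preserve its measure, so derivatives along them
integrate to zero (`integral_flowDeriv_eq_zero`); along the flows of `i`, `j`, `k` the collision
operator is a divergence in an orthonormal frame (`collision_eq_of_contDiffOn`), and all integrations
by parts below are instances of this.

*The limit is an equilibrium.* If the derivatives in `(t, x)` are `o(1 / ε)`, the collision term tends
to zero in `L¹`. Testing it with a bounded function of the quotient of `f` by the equilibrium, the
arctangent, controls the gradient of that arctangent, and a Poincaré inequality in `L¹`, obtained by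
averaging over the group, shows that the quotient becomes constant. The mean quaternions need not
converge, but they do along an ultrafilter (`exists_eq_vonMises_of_tendsto`).

*The profile.* The equation of `h` degenerates at `±1`. `exists_isRegularProfile` constructs an odd
solution that is continuous with a bounded derivative up to the boundary. Uniqueness
(`IsGCIProfile.eqOn`) and the non-vanishing of the normalisation of the weight
(`IsRegularProfile.integral_weightTwo_ne_zero`) are energy arguments, where the integrability
conditions remove the boundary terms.

*The collision invariants.* Two integrations by parts turn `∫ Γ(f) h(r) pcoord qbar k` into a multiple
of `∫ f r pcoord qbar k`, exactly by the equation of the profile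
(`integral_sum_fluxDeriv_mul_gci`). This is a component of the gradient of `p ↦ p · Q_f p` at `qbar`, so
it vanishes when `qbar` is a maximiser. The function `1` and these three functions therefore remove
the collision term without any expansion in `ε`, and the weak form of the limit equation is exact
(`IsKineticFamily.integral_limit_eq_zero`). The maximisers accumulate only at `±qbar`, since the
maximal eigenvalue is simple for the equilibrium (`eq_or_eq_neg_of_integral_le`), and the oddness of
`h` makes the sign irrelevant.

*The equations.* After the substitution `q = y qbar` every integral is one of a function of `Re y`
against a polynomial of degree at most four in `Im y`. Invariance under rotations evaluates these
moments (`integral_two_moment`, `integral_four_moment`), and the distribution of `Re y`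
(`exists_integral_comp_re_eq`) turns the remaining integrals into the angular averages in the
constants (`c1_eq`, `IsRegularProfile.c2_c4_eq`).
-/

noncomputable section

namespace SOHQ

/-! ### The unit quaternions as a group with an invariant measure -/

instance : IsFiniteMeasure dq := inferInstanceAs (IsFiniteMeasure (volume : Measure Quat).toSphere)

instance : dq.IsOpenPosMeasure :=
  inferInstanceAs (Measure.IsOpenPosMeasure (volume : Measure Quat).toSphere)

lemma dq_ne_zero : dq ≠ 0 := Measure.toSphere_ne_zero _

lemma norm_coe_H1 (q : H1) : ‖(q : Quat)‖ = 1 := by simp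

lemma coe_H1_ne_zero (q : H1) : (q : Quat) ≠ 0 := by
  intro h
  have := norm_coe_H1 q
  simp [h] at this

/-- The action on the unit quaternions of a linear isometry of the quaternions. -/
def sphereMap (L : Quat ≃ₗᵢ[ℝ] Quat) (q : H1) : H1 := ⟨L q, by simp⟩

@[simp] lemma coe_sphereMap (L : Quat ≃ₗᵢ[ℝ] Quat) (q : H1) : (sphereMap L q : Quat) = L q := rfl

lemma continuous_sphereMap (L : Quat ≃ₗᵢ[ℝ] Quat) : Continuous (sphereMap L) :=
  (L.continuous.comp continuous_subtype_val).subtype_mk _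

open scoped Pointwise in
lemma measurePreserving_sphereMap (L : Quat ≃ₗᵢ[ℝ] Quat) :
    MeasurePreserving (sphereMap L) dq dq := by
  refine ⟨(continuous_sphereMap L).measurable, ?_⟩
  ext s hs
  rw [Measure.map_apply (continuous_sphereMap L).measurable hs, dq,
    Measure.toSphere_apply' _ hs,
    Measure.toSphere_apply' _ ((continuous_sphereMap L).measurable hs)]
  congr 1
  have hL : L ⁻¹' (Ioo (0 : ℝ) 1 • ((↑) '' s : Set Quat))
      = Ioo (0 : ℝ) 1 • ((↑) '' (sphereMap L ⁻¹' s) : Set Quat) := by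
    ext p
    simp only [mem_preimage, Set.mem_smul, mem_image]
    constructor
    · rintro ⟨r, hr, _, ⟨q, hq, rfl⟩, h⟩
      refine ⟨r, hr, _, ⟨sphereMap L.symm q, ?_, rfl⟩, ?_⟩
      · have : sphereMap L (sphereMap L.symm q) = q := Subtype.ext (by simp)
        rwa [this]
      · apply L.injective
        rw [← h]
        simp
    · rintro ⟨r, hr, _, ⟨q, hq, rfl⟩, h⟩
      exact ⟨r, hr, _, ⟨_, hq, rfl⟩, by simp [← h]⟩
  rw [← hL]
  exact L.measurePreserving.measure_preimage_emb L.toHomeomorph.measurableEmbedding _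

lemma integral_comp_sphereMap (L : Quat ≃ₗᵢ[ℝ] Quat) (f : H1 → ℝ) :
    ∫ q, f (sphereMap L q) ∂dq = ∫ q, f q ∂dq := by
  have h := measurePreserving_sphereMap L
  let e : H1 ≃ₜ H1 :=
    { toFun := sphereMap L
      invFun := sphereMap L.symm
      left_inv := fun q => by ext1; simp
      right_inv := fun q => by ext1; simp
      continuous_toFun := continuous_sphereMap L
      continuous_invFun := continuous_sphereMap L.symm }
  exact h.integral_comp e.measurableEmbedding f

/-- Left multiplication by a unit quaternion, as a linear isometry. -/
def mulLeftIso (p : H1) : Quat ≃ₗᵢ[ℝ] Quat where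
  toFun x := p * x
  invFun x := (p⁻¹ : H1) * x
  map_add' x y := mul_add _ _ _
  map_smul' c x := by simp
  left_inv x := by simp [coe_H1_ne_zero]
  right_inv x := by simp [coe_H1_ne_zero]
  norm_map' x := by simp

/-- Right multiplication by a unit quaternion, as a linear isometry. -/
def mulRightIso (p : H1) : Quat ≃ₗᵢ[ℝ] Quat where
  toFun x := x * p
  invFun x := x * (p⁻¹ : H1)
  map_add' x y := add_mul _ _ _
  map_smul' c x := by simp
  left_inv x := by simp [coe_H1_ne_zero]
  right_inv x := by simp [coe_H1_ne_zero]
  norm_map' x := by simp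

/-- Quaternionic conjugation, as a linear isometry. -/
def starIso : Quat ≃ₗᵢ[ℝ] Quat where
  toFun x := star x
  invFun x := star x
  map_add' x y := star_add _ _
  map_smul' c x := by simp
  left_inv x := star_star x
  right_inv x := star_star x
  norm_map' x := Quaternion.norm_star x

instance : dq.IsMulLeftInvariant := by
  refine ⟨fun p => ?_⟩
  have : (fun q => p * q) = sphereMap (mulLeftIso p) := by
    ext q : 2
    rfl
  rw [this]
  exact (measurePreserving_sphereMap _).map_eq

instance : dq.IsMulRightInvariant := by
  refine ⟨fun p => ?_⟩
  have : (fun q => q * p) = sphereMap (mulRightIso p) := by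
    ext q : 2
    rfl
  rw [this]
  exact (measurePreserving_sphereMap _).map_eq

/-- A continuous function on the compact space of the unit quaternions is integrable. -/
lemma integrable_of_continuous {f : H1 → ℝ} (hf : Continuous f) : Integrable f dq := by
  refine hf.integrable_of_hasCompactSupport ?_
  exact HasCompactSupport.of_compactSpace f

/-! ### One-parameter flows and integration by parts -/

@[simp] lemma re_ofVec (v : E3) : (ofVec v).re = 0 := rfl
@[simp] lemma imI_ofVec (v : E3) : (ofVec v).imI = v 0 := rfl
@[simp] lemma imJ_ofVec (v : E3) : (ofVec v).imJ = v 1 := rfl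
@[simp] lemma imK_ofVec (v : E3) : (ofVec v).imK = v 2 := rfl
@[simp] lemma imVec_zero (p : Quat) : imVec p 0 = p.imI := rfl
@[simp] lemma imVec_one (p : Quat) : imVec p 1 = p.imJ := rfl
@[simp] lemma imVec_two (p : Quat) : imVec p 2 = p.imK := rfl
@[simp] lemma re_one_quat : (1 : Quat).re = 1 := rfl
@[simp] lemma imI_one_quat : (1 : Quat).imI = 0 := rfl
@[simp] lemma imJ_one_quat : (1 : Quat).imJ = 0 := rfl
@[simp] lemma imK_one_quat : (1 : Quat).imK = 0 := rfl

/-- The unit purely imaginary quaternions. -/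
structure ImUnit where
  /-- The underlying quaternion. -/
  val : Quat
  re_val : val.re = 0
  norm_val : ‖val‖ = 1

lemma sq_sum_eq_norm_sq (p : Quat) :
    p.re ^ 2 + p.imI ^ 2 + p.imJ ^ 2 + p.imK ^ 2 = ‖p‖ ^ 2 := by
  rw [sq ‖p‖, ← Quaternion.normSq_eq_norm_mul_self, Quaternion.normSq_def']

lemma ImUnit.sq_sum (ξ : ImUnit) : ξ.1.imI ^ 2 + ξ.1.imJ ^ 2 + ξ.1.imK ^ 2 = 1 := by
  have := sq_sum_eq_norm_sq ξ.1
  rw [ξ.re_val, ξ.norm_val] at this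
  linarith

lemma ImUnit.mul_self (ξ : ImUnit) : ξ.1 * ξ.1 = -1 := by
  have := ξ.sq_sum
  have h0 := ξ.re_val
  ext <;> simp [h0] <;> linarith

/-- The one-parameter subgroup `exp (s ξ) = cos s + sin s ξ` generated by `ξ`. -/
def rotor (ξ : ImUnit) (s : ℝ) : H1 :=
  ⟨Real.cos s • (1 : Quat) + Real.sin s • ξ.1, by
    have h := sq_sum_eq_norm_sq (Real.cos s • (1 : Quat) + Real.sin s • ξ.1)
    have h1 := ξ.sq_sum
    have h0 := ξ.re_val
    simp [h0, mul_pow] at h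
    have h2 := Real.sin_sq_add_cos_sq s
    have : ‖Real.cos s • (1 : Quat) + Real.sin s • ξ.1‖ ^ 2 = 1 := by
      rw [← h]; linear_combination Real.sin s ^ 2 * h1 + h2
    simpa using (pow_eq_one_iff_of_nonneg (norm_nonneg _) two_ne_zero).1 this⟩

lemma coe_rotor (ξ : ImUnit) (s : ℝ) :
    (rotor ξ s : Quat) = Real.cos s • (1 : Quat) + Real.sin s • ξ.1 := rfl

lemma rotor_add (ξ : ImUnit) (s t : ℝ) : rotor ξ (s + t) = rotor ξ s * rotor ξ t := by
  ext1
  rw [Metric.unitSphere.coe_mul, coe_rotor, coe_rotor, coe_rotor, Real.cos_add, Real.sin_add]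
  simp only [add_mul, mul_add, smul_mul_smul_comm, ξ.mul_self, one_mul, mul_one]
  module

@[simp] lemma rotor_zero (ξ : ImUnit) : rotor ξ 0 = 1 := by
  ext1; simp [coe_rotor]

@[simp] lemma rotor_two_pi (ξ : ImUnit) : rotor ξ (2 * Real.pi) = 1 := by
  ext1; simp [coe_rotor]

lemma continuous_rotor (ξ : ImUnit) : Continuous (rotor ξ) := by
  refine Continuous.subtype_mk ?_ _
  fun_prop

/-- Every unit quaternion lies on a one-parameter subgroup. -/
lemma exists_rotor_eq (p : H1) : ∃ (ξ : ImUnit) (s : ℝ), s ∈ Icc 0 Real.pi ∧ rotor ξ s = p := by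
  have hp := sq_sum_eq_norm_sq (p : Quat)
  rw [norm_coe_H1] at hp
  have hre : -1 ≤ (p : Quat).re ∧ (p : Quat).re ≤ 1 := by
    constructor <;> nlinarith [sq_nonneg (p : Quat).imI, sq_nonneg (p : Quat).imJ,
      sq_nonneg (p : Quat).imK]
  set s := Real.arccos (p : Quat).re with hs
  have hcos : Real.cos s = (p : Quat).re := Real.cos_arccos hre.1 hre.2
  have hsin : Real.sin s ^ 2 = (p : Quat).imI ^ 2 + (p : Quat).imJ ^ 2 + (p : Quat).imK ^ 2 := by
    have := Real.sin_sq_add_cos_sq s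
    rw [hcos] at this
    linarith
  by_cases h : Real.sin s = 0
  · rw [h] at hsin
    refine ⟨⟨ofVec (EuclideanSpace.single 0 1), rfl, ?_⟩, s,
      ⟨Real.arccos_nonneg _, Real.arccos_le_pi _⟩, ?_⟩
    · have := sq_sum_eq_norm_sq (ofVec (EuclideanSpace.single 0 1))
      simp at this
      exact (pow_eq_one_iff_of_nonneg (norm_nonneg _) two_ne_zero).1 this.symm
    · ext1
      refine (coe_rotor _ s).trans ?_
      rw [h, hcos]
      have h1 : (p : Quat).imI = 0 := by nlinarith [sq_nonneg (p : Quat).imJ, sq_nonneg (p : Quat).imK]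
      have h2 : (p : Quat).imJ = 0 := by nlinarith [sq_nonneg (p : Quat).imI, sq_nonneg (p : Quat).imK]
      have h3 : (p : Quat).imK = 0 := by nlinarith [sq_nonneg (p : Quat).imI, sq_nonneg (p : Quat).imJ]
      ext <;> simp [h1, h2, h3]
  · refine ⟨⟨(Real.sin s)⁻¹ • ofVec (imVec p), by simp, ?_⟩,
      s, ⟨Real.arccos_nonneg _, Real.arccos_le_pi _⟩, ?_⟩
    · have := sq_sum_eq_norm_sq ((Real.sin s)⁻¹ • ofVec (imVec p))
      simp only [Quaternion.re_smul, Quaternion.imI_smul, Quaternion.imJ_smul,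
        Quaternion.imK_smul, smul_eq_mul, re_ofVec, imI_ofVec, imJ_ofVec, imK_ofVec, imVec_zero,
        imVec_one, imVec_two] at this
      refine (pow_eq_one_iff_of_nonneg (norm_nonneg _) two_ne_zero).1 ?_
      rw [← this]
      field_simp
      linarith [hsin]
    · ext1
      refine (coe_rotor _ s).trans ?_
      rw [hcos]
      ext <;> simp [h]

/-- The function `a` on the unit quaternions has the derivative `a'` at `q` along the flow
`s ↦ exp (s ξ) q`. -/
def HasFlowDeriv (ξ : ImUnit) (a : H1 → ℝ) (a' : ℝ) (q : H1) : Prop :=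
  HasDerivAt (fun s => a (rotor ξ s * q)) a' 0

lemma HasFlowDeriv.hasDerivAt {ξ : ImUnit} {a : H1 → ℝ} {a' : ℝ} {q : H1} {s : ℝ}
    (h : HasFlowDeriv ξ a a' (rotor ξ s * q)) :
    HasDerivAt (fun s => a (rotor ξ s * q)) a' s := by
  have h1 : HasDerivAt (fun t => a (rotor ξ t * (rotor ξ s * q))) a' (s - s) := by
    rw [sub_self]; exact h
  have := h1.comp_sub_const s s
  refine this.congr_of_eventuallyEq (Eventually.of_forall fun t => ?_)
  simp only
  rw [← mul_assoc, ← rotor_add, sub_add_cancel]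

namespace HasFlowDeriv

variable {ξ : ImUnit} {a b : H1 → ℝ} {a' b' c : ℝ} {q : H1}

lemma congr (h : HasFlowDeriv ξ a a' q) (hab : ∀ p, b p = a p) (hc : b' = a') :
    HasFlowDeriv ξ b b' q := by
  have : b = a := funext hab
  rw [this, hc]
  exact h

lemma mul (ha : HasFlowDeriv ξ a a' q) (hb : HasFlowDeriv ξ b b' q) :
    HasFlowDeriv ξ (fun p => a p * b p) (a' * b q + a q * b') q := by
  have := HasDerivAt.mul ha hb
  simp only [rotor_zero, one_mul] at this
  exact this

lemma add (ha : HasFlowDeriv ξ a a' q) (hb : HasFlowDeriv ξ b b' q) :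
    HasFlowDeriv ξ (fun p => a p + b p) (a' + b') q :=
  HasDerivAt.add ha hb

lemma const_mul (c : ℝ) (ha : HasFlowDeriv ξ a a' q) :
    HasFlowDeriv ξ (fun p => c * a p) (c * a') q :=
  HasDerivAt.const_mul c ha

lemma comp {φ : ℝ → ℝ} {φ' : ℝ} (hφ : HasDerivAt φ φ' (a q)) (ha : HasFlowDeriv ξ a a' q) :
    HasFlowDeriv ξ (fun p => φ (a p)) (φ' * a') q := by
  refine HasDerivAt.comp (h := fun s => a (rotor ξ s * q)) (h₂ := φ) 0 ?_ ha
  simpa using hφ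

end HasFlowDeriv

/-- Integration by parts: the derivative along a flow of a function has the integral zero. The
flow is periodic, so the integral of the derivative along almost every orbit vanishes; the exceptional
orbits are those through possible singularities of `a`. -/
theorem integral_flowDeriv_eq_zero {ξ : ImUnit} {a b : H1 → ℝ} (hb : Measurable b)
    (hint : Integrable b dq)
    (h : ∀ᵐ q ∂dq, ∀ s, HasFlowDeriv ξ a (b (rotor ξ s * q)) (rotor ξ s * q)) :
    ∫ q, b q ∂dq = 0 := by
  have hmeas : Measurable (fun z : H1 × ℝ => rotor ξ z.2 * z.1) :=
    (((continuous_rotor ξ).comp continuous_snd).mul continuous_fst).measurable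
  have hmeas' : Measurable (fun z : ℝ × H1 => rotor ξ z.1 * z.2) :=
    (((continuous_rotor ξ).comp continuous_fst).mul continuous_snd).measurable
  set ν : Measure ℝ := volume.restrict (Ioc 0 (2 * Real.pi)) with hν
  have hI : Integrable (fun z : ℝ × H1 => b (rotor ξ z.1 * z.2)) (ν.prod dq) := by
    have hbm : Measurable (fun z : ℝ × H1 => b (rotor ξ z.1 * z.2)) := hb.comp hmeas'
    rw [integrable_prod_iff hbm.aestronglyMeasurable]
    constructor
    · exact Eventually.of_forall fun s => hint.comp_mul_left (rotor ξ s)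
    · have : ∀ s, ∫ y, ‖b (rotor ξ s * y)‖ ∂dq = ∫ y, ‖b y‖ ∂dq := fun s =>
        integral_mul_left_eq_self (μ := dq) (fun y => ‖b y‖) (rotor ξ s)
      simp only [this]
      exact integrable_const _
  have h1 : ∫ s, ∫ q, b (rotor ξ s * q) ∂dq ∂ν = 2 * Real.pi * ∫ q, b q ∂dq := by
    have : ∀ s, ∫ y, b (rotor ξ s * y) ∂dq = ∫ y, b y ∂dq := fun s =>
      integral_mul_left_eq_self (μ := dq) b (rotor ξ s)
    simp only [this]
    simp [hν, Real.pi_pos.le]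
  have h2 : ∫ s, ∫ q, b (rotor ξ s * q) ∂dq ∂ν = ∫ q, ∫ s, b (rotor ξ s * q) ∂ν ∂dq :=
    integral_integral_swap hI
  have h3 : ∀ᵐ q ∂dq, ∫ s, b (rotor ξ s * q) ∂ν = 0 := by
    filter_upwards [h, hI.prod_left_ae] with q hq hqi
    have hle : (0 : ℝ) ≤ 2 * Real.pi := by positivity
    rw [hν, ← intervalIntegral.integral_of_le hle,
      intervalIntegral.integral_eq_sub_of_hasDerivAt (f := fun s => a (rotor ξ s * q))
        (fun s _ => (hq s).hasDerivAt)]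
    · simp
    · rw [intervalIntegrable_iff_integrableOn_Ioc_of_le hle]
      exact hqi
  rw [h2, integral_congr_ae h3, integral_zero] at h1
  have := Real.pi_pos
  have : 2 * Real.pi ≠ 0 := by positivity
  rcases mul_eq_zero.1 h1.symm with h | h
  · exact absurd h this
  · exact h

/-- Integration by parts for a function without singularities. -/
theorem integral_flowDeriv_eq_zero_of_continuous {ξ : ImUnit} {a b : H1 → ℝ} (hb : Continuous b)
    (h : ∀ q, HasFlowDeriv ξ a (b q) q) : ∫ q, b q ∂dq = 0 :=
  integral_flowDeriv_eq_zero hb.measurable (integrable_of_continuous hb)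
    (Eventually.of_forall fun _ _ => h _)

/-! ### The differential operators in terms of the flows of the imaginary units -/

/-- The imaginary units `i`, `j`, `k`. -/
def iu (k : Fin 3) : ImUnit where
  val := ofVec (EuclideanSpace.single k 1)
  re_val := rfl
  norm_val := by
    have := sq_sum_eq_norm_sq (ofVec (EuclideanSpace.single k 1))
    refine (pow_eq_one_iff_of_nonneg (norm_nonneg _) two_ne_zero).1 ?_
    rw [← this]
    fin_cases k <;> simp

lemma val_iu (k : Fin 3) : (iu k).val = ofVec (EuclideanSpace.single k 1) := rfl

lemma ImUnit.val_eq_sum (ξ : ImUnit) : ξ.val = ∑ k, imVec ξ.val k • (iu k).val := by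
  have h0 := ξ.re_val
  ext <;> simp [Fin.sum_univ_three, h0, val_iu]

lemma ImUnit.abs_imVec_le (ξ : ImUnit) (k : Fin 3) : |imVec ξ.val k| ≤ 1 := by
  have h := ξ.sq_sum
  rw [abs_le_one_iff_mul_self_le_one]
  fin_cases k <;> simp <;>
    nlinarith [sq_nonneg ξ.val.imI, sq_nonneg ξ.val.imJ, sq_nonneg ξ.val.imK]

lemma inner_quat (a b : Quat) :
    inner ℝ a b = a.re * b.re + a.imI * b.imI + a.imJ * b.imJ + a.imK * b.imK := by
  rw [Quaternion.inner_def]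
  simp

lemma inner_iu_mul_self (k : Fin 3) (p : Quat) : inner ℝ ((iu k).val * p) p = 0 := by
  rw [inner_quat, val_iu]
  fin_cases k <;> simp <;> ring

lemma iu_mul_iu_mul (ξ : ImUnit) (p : Quat) : ξ.val * (ξ.val * p) = -p := by
  rw [← mul_assoc, ξ.mul_self, neg_one_mul]

/-- The orthonormal basis `q, i q, j q, k q` of the quaternions. -/
def frame (q : H1) : OrthonormalBasis (Fin 4) ℝ Quat :=
  (EuclideanSpace.basisFun (Fin 4) ℝ).map
    (Quaternion.linearIsometryEquivTuple.symm.trans (mulRightIso q))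

lemma frame_zero (q : H1) : frame q 0 = q := by
  have h : Quaternion.linearIsometryEquivTuple.symm (EuclideanSpace.single 0 1) = (1 : Quat) := by
    ext <;> simp [Quaternion.linearIsometryEquivTuple_symm_apply]
  simp only [frame, OrthonormalBasis.map_apply, EuclideanSpace.basisFun_apply]
  change (Quaternion.linearIsometryEquivTuple.symm (EuclideanSpace.single 0 1) : Quat) * (q : Quat)
    = _
  rw [h, one_mul]

lemma frame_succ (q : H1) (k : Fin 3) : frame q k.succ = (iu k).val * q := by
  have h : Quaternion.linearIsometryEquivTuple.symm (EuclideanSpace.single k.succ 1)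
      = (iu k).val := by
    rw [val_iu]
    fin_cases k <;> ext <;> simp [Quaternion.linearIsometryEquivTuple_symm_apply]
  simp only [frame, OrthonormalBasis.map_apply, EuclideanSpace.basisFun_apply]
  change (Quaternion.linearIsometryEquivTuple.symm (EuclideanSpace.single k.succ 1) : Quat)
    * (q : Quat) = _
  rw [h]

lemma homExt_of_ne {F : Type} [Zero F] (g : H1 → F) {p : Quat} (hp : p ≠ 0) :
    homExt g p = g (radial p hp) := dif_pos hp

lemma radial_coe (q : H1) : radial q (coe_H1_ne_zero q) = q := by
  apply Subtype.ext
  simp [radial]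

@[simp] lemma homExt_coe {F : Type} [Zero F] (g : H1 → F) (q : H1) : homExt g q = g q := by
  rw [homExt_of_ne g (coe_H1_ne_zero q), radial_coe]

lemma homExt_smul {F : Type} [Zero F] (g : H1 → F) {c : ℝ} (hc : 0 < c) (p : Quat) :
    homExt g (c • p) = homExt g p := by
  by_cases hp : p = 0
  · simp [hp]
  · rw [homExt_of_ne g hp, homExt_of_ne g (smul_ne_zero hc.ne' hp)]
    congr 1
    apply Subtype.ext
    simp only [radial, norm_smul, Real.norm_eq_abs, abs_of_pos hc, smul_smul]
    congr 1
    field_simp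

lemma hasDerivAt_rotor_mul (ξ : ImUnit) (q : H1) :
    HasDerivAt (fun s => ((rotor ξ s * q : H1) : Quat)) (ξ.val * q) 0 := by
  have h1 : HasDerivAt (fun s : ℝ => (Real.cos s • (1 : Quat) + Real.sin s • ξ.val) * (q : Quat))
      ((-Real.sin 0 • (1 : Quat) + Real.cos 0 • ξ.val) * (q : Quat)) 0 :=
    (((Real.hasDerivAt_cos 0).smul_const (1 : Quat)).add
      ((Real.hasDerivAt_sin 0).smul_const ξ.val)).mul_const (q : Quat)
  simpa [coe_rotor] using h1

lemma hasDerivAt_comp_rotor {F : Type} [NormedAddCommGroup F] [NormedSpace ℝ F] (ξ : ImUnit)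
    {A : Quat → F} {q : H1} (hA : DifferentiableAt ℝ A q) :
    HasDerivAt (fun s => A (rotor ξ s * q : H1)) (fderiv ℝ A q (ξ.val * q)) 0 := by
  refine HasFDerivAt.comp_hasDerivAt (l := A) (0 : ℝ) ?_ (hasDerivAt_rotor_mul ξ q)
  simpa using hA.hasFDerivAt

lemma fderiv_homExt_self {F : Type} [NormedAddCommGroup F] [NormedSpace ℝ F] (V : H1 → F) {q : H1}
    (hV : DifferentiableAt ℝ (homExt V) q) : fderiv ℝ (homExt V) q q = 0 := by
  have h1 : HasDerivAt (fun s : ℝ => (1 + s) • (q : Quat)) ((1 : ℝ) • (q : Quat)) 0 :=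
    ((hasDerivAt_id 0).const_add 1).smul_const (q : Quat)
  have h2 : HasDerivAt (fun s : ℝ => homExt V ((1 + s) • (q : Quat)))
      (fderiv ℝ (homExt V) q ((1 : ℝ) • (q : Quat))) 0 := by
    refine HasFDerivAt.comp_hasDerivAt (l := homExt V) (0 : ℝ) ?_ h1
    simpa using hV.hasFDerivAt
  have h3 : HasDerivAt (fun s : ℝ => homExt V ((1 + s) • (q : Quat))) 0 0 := by
    refine (hasDerivAt_const (0 : ℝ) (homExt V q)).congr_of_eventuallyEq ?_
    filter_upwards [lt_mem_nhds (show (-1 : ℝ) < 0 by norm_num)] with s hs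
    exact homExt_smul V (by linarith) _
  rw [one_smul] at h2
  exact h2.unique h3

/-- The divergence of a tangent field is the sum of the derivatives of its components in the frame
`i q, j q, k q` along the flows of this frame, since the fields of the frame are free of
divergence. -/
lemma divQ_eq_sum {V : H1 → Quat} {q : H1} (hV : DifferentiableAt ℝ (homExt V) q)
    (htan : ∀ p : H1, inner ℝ (p : Quat) (V p) = 0) {c : Fin 3 → ℝ}
    (hc : ∀ k, HasFlowDeriv (iu k) (fun p => inner ℝ ((iu k).val * (p : Quat)) (V p)) (c k) q) :
    divQ V q = ∑ k, c k := by
  rw [divQ, LinearMap.trace_eq_sum_inner _ (frame q), Fin.sum_univ_succ]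
  simp only [frame_zero, frame_succ, ContinuousLinearMap.coe_coe]
  rw [fderiv_homExt_self V hV, inner_zero_right, zero_add]
  refine Finset.sum_congr rfl fun k _ => ?_
  have h1 := hasDerivAt_comp_rotor (iu k) hV
  simp only [homExt_coe] at h1
  have h2 : HasDerivAt (fun s => (iu k).val * ((rotor (iu k) s * q : H1) : Quat))
      ((iu k).val * ((iu k).val * q)) 0 := (hasDerivAt_rotor_mul (iu k) q).const_mul _
  have h3 := h2.inner ℝ h1
  have h4 := h3.unique (hc k)
  simp only [rotor_zero, one_mul, iu_mul_iu_mul, inner_neg_left, htan, neg_zero, add_zero] at h4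
  exact h4

/-- A function `f` on the unit quaternions that is twice continuously differentiable, with the first
derivatives `X k` along the flows of the imaginary units, and the repeated derivatives `Y k`. -/
structure HasFrameDerivs (f : H1 → ℝ) (X Y : Fin 3 → H1 → ℝ) : Prop where
  continuous : Continuous f
  continuous_fst : ∀ k, Continuous (X k)
  continuous_snd : ∀ k, Continuous (Y k)
  flow_fst : ∀ ξ q, HasFlowDeriv ξ f (∑ k, imVec ξ.val k * X k q) q
  flow_snd : ∀ k q, HasFlowDeriv (iu k) (X k) (Y k q) q

lemma HasFrameDerivs.flow_iu {f : H1 → ℝ} {X Y : Fin 3 → H1 → ℝ} (h : HasFrameDerivs f X Y)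
    (k : Fin 3) (q : H1) : HasFlowDeriv (iu k) f (X k q) q := by
  have := h.flow_fst (iu k) q
  convert this using 1
  fin_cases k <;> simp [Fin.sum_univ_three, val_iu]

/-- The component of `q` along `qbar`; its derivatives along the flows are the `-pcoord qbar k`. -/
def rcoord (qbar q : H1) : ℝ := inner ℝ (qbar : Quat) (q : Quat)

/-- The component of `q` along `iu k * qbar`, i.e. the `k`-th imaginary component of `q qbar*`. -/
def pcoord (qbar : H1) (k : Fin 3) (q : H1) : ℝ :=
  inner ℝ ((iu k).val * (qbar : Quat)) (q : Quat)

lemma continuous_rcoord (qbar : H1) : Continuous (rcoord qbar) := by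
  unfold rcoord; fun_prop

lemma continuous_pcoord (qbar : H1) (k : Fin 3) : Continuous (pcoord qbar k) := by
  unfold pcoord; fun_prop

lemma hasFlowDeriv_inner (ξ : ImUnit) (a : Quat) (q : H1) :
    HasFlowDeriv ξ (fun p => inner ℝ a (p : Quat)) (inner ℝ a (ξ.val * (q : Quat))) q := by
  have h := (hasDerivAt_const (0 : ℝ) a).inner ℝ (hasDerivAt_rotor_mul ξ q)
  simpa [HasFlowDeriv] using h

lemma inner_iu_mul_comm (k : Fin 3) (a b : Quat) :
    inner ℝ a ((iu k).val * b) = -inner ℝ ((iu k).val * a) b := by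
  simp only [inner_quat, val_iu]
  fin_cases k <;> simp <;> ring

lemma hasFlowDeriv_rcoord (qbar : H1) (k : Fin 3) (q : H1) :
    HasFlowDeriv (iu k) (rcoord qbar) (-pcoord qbar k q) q := by
  have := hasFlowDeriv_inner (iu k) qbar q
  rwa [inner_iu_mul_comm] at this

lemma hasFlowDeriv_pcoord (qbar : H1) (k : Fin 3) (q : H1) :
    HasFlowDeriv (iu k) (pcoord qbar k) (rcoord qbar q) q := by
  have := hasFlowDeriv_inner (iu k) ((iu k).val * qbar) q
  rwa [inner_iu_mul_comm, iu_mul_iu_mul, inner_neg_left, neg_neg] at this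

lemma sum_sq_coord (qbar q : H1) : rcoord qbar q ^ 2 + ∑ k, pcoord qbar k q ^ 2 = 1 := by
  have h := (frame qbar).sum_sq_inner_right (q : Quat)
  rw [Fin.sum_univ_succ, norm_coe_H1] at h
  simpa [frame_zero, frame_succ, rcoord, pcoord] using h

lemma collision_eq_of_contDiffOn {f : H1 → ℝ}
    (hf : ContDiffOn ℝ 2 (homExt f) {0}ᶜ) :
    ∃ X Y, HasFrameDerivs f X Y ∧ ∀ ν D qbar q, collision ν D qbar f q =
      ∑ k, (D / 4 * Y k q + ν * (X k q * rcoord qbar q * pcoord qbar k q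
        - f q * pcoord qbar k q ^ 2 + f q * rcoord qbar q ^ 2)) := by
  have ho : IsOpen ({0}ᶜ : Set Quat) := isOpen_compl_singleton
  have hq : ∀ q : H1, (q : Quat) ∈ ({0}ᶜ : Set Quat) := fun q => coe_H1_ne_zero q
  have hC1 : ContDiffOn ℝ 1 (fderiv ℝ (homExt f)) {0}ᶜ :=
    hf.fderiv_of_isOpen ho (by norm_num)
  have hd : ∀ q : H1, DifferentiableAt ℝ (homExt f) q := fun q =>
    (hf.differentiableOn (by norm_num)).differentiableAt (ho.mem_nhds (hq q))
  have hd1 : ∀ q : H1, DifferentiableAt ℝ (fderiv ℝ (homExt f)) q := fun q =>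
    (hC1.differentiableOn (by norm_num)).differentiableAt (ho.mem_nhds (hq q))
  have hcf : Continuous fun q : H1 => homExt f q :=
    hf.continuousOn.comp_continuous continuous_subtype_val hq
  have hcX : Continuous fun q : H1 => fderiv ℝ (homExt f) q :=
    hC1.continuousOn.comp_continuous continuous_subtype_val hq
  have hcY : Continuous fun q : H1 => fderiv ℝ (fderiv ℝ (homExt f)) q :=
    (hC1.fderiv_of_isOpen (m := 0) ho (by norm_num)).continuousOn.comp_continuous
      continuous_subtype_val hq
  set X : Fin 3 → H1 → ℝ := fun k q => fderiv ℝ (homExt f) q ((iu k).val * q) with hX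
  set Y : Fin 3 → H1 → ℝ := fun k q =>
    fderiv ℝ (fderiv ℝ (homExt f)) q ((iu k).val * q) ((iu k).val * q) with hY
  have hXY : HasFrameDerivs f X Y := by
    refine ⟨by simpa using hcf, fun k => ?_, fun k => ?_, fun ξ q => ?_, fun k q => ?_⟩
    · exact hcX.clm_apply (by fun_prop)
    · exact (hcY.clm_apply (by fun_prop)).clm_apply (by fun_prop)
    · have h := hasDerivAt_comp_rotor ξ (hd q)
      simp only [homExt_coe] at h
      unfold HasFlowDeriv
      have h2 : fderiv ℝ (homExt f) q (ξ.val * q) = ∑ k, imVec ξ.val k * X k q := by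
        conv_lhs => rw [ξ.val_eq_sum]
        simp [hX, Finset.sum_mul]
      rwa [← h2]
    · have h1 := hasDerivAt_comp_rotor (F := Quat →L[ℝ] ℝ) (A := fderiv ℝ (homExt f)) (iu k) (hd1 q)
      have h2 : HasDerivAt (fun s => (iu k).val * ((rotor (iu k) s * q : H1) : Quat))
        ((iu k).val * ((iu k).val * q)) 0 := (hasDerivAt_rotor_mul (iu k) q).const_mul _
      have h3 := h1.clm_apply h2
      simp only [rotor_zero, one_mul, iu_mul_iu_mul, map_neg, fderiv_homExt_self f (hd q),
        neg_zero, add_zero] at h3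
      exact h3
  refine ⟨X, Y, hXY, fun ν D qbar q => ?_⟩
  -- the differentiability of the radial projection transfers from `f` to the fields
  have hrad : DifferentiableAt ℝ (fun p : Quat => ‖p‖⁻¹ • p) (q : Quat) := by
    have hn : DifferentiableAt ℝ (fun p : Quat => ‖p‖) (q : Quat) :=
      differentiableAt_id.norm ℝ (coe_H1_ne_zero q)
    exact (hn.inv (by simp)).smul differentiableAt_id
  have hradq : ‖(q : Quat)‖⁻¹ • (q : Quat) = q := by simp
  have hlap : lapQ f q = ∑ k, Y k q := by
    refine divQ_eq_sum ?_ (fun p => ?_) (fun k => ?_)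
    · have h1 : DifferentiableAt ℝ (fun p : Quat => gradient (homExt f) (‖p‖⁻¹ • p)) (q : Quat) := by
        have h2 : DifferentiableAt ℝ (fun p : Quat => fderiv ℝ (homExt f) (‖p‖⁻¹ • p)) (q : Quat) := by
          refine DifferentiableAt.comp (g := fderiv ℝ (homExt f)) _ ?_ hrad
          rw [hradq]
          exact hd1 q
        exact (InnerProductSpace.toDual ℝ Quat).symm.differentiable.differentiableAt.comp _ h2
      refine h1.congr_of_eventuallyEq ?_
      filter_upwards [ho.mem_nhds (hq q)] with p hp
      rw [homExt_of_ne _ hp]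
      rfl
    · rw [gradQ, real_inner_comm, inner_gradient_left]
      exact fderiv_homExt_self f (hd p)
    · have := hXY.flow_snd k q
      refine this.congr_of_eventuallyEq (Eventually.of_forall fun s => ?_)
      simp only [hX, gradQ]
      rw [real_inner_comm, inner_gradient_left]
  have hdiv : divQ (fun p => f p • projPerp p (inner ℝ (qbar : Quat) (p : Quat) • (qbar : Quat))) q
      = ∑ k, (-(X k q * rcoord qbar q * pcoord qbar k q)
        + f q * pcoord qbar k q ^ 2 - f q * rcoord qbar q ^ 2) := by
    refine divQ_eq_sum ?_ (fun p => ?_) (fun k => ?_)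
    · have h0 : DifferentiableAt ℝ (fun p : Quat => ‖p‖⁻¹ • p) (q : Quat) := hrad
      have h1 : DifferentiableAt ℝ (fun p : Quat => homExt f p •
          (inner ℝ (qbar : Quat) (‖p‖⁻¹ • p) • (qbar : Quat)
            - inner ℝ (‖p‖⁻¹ • p) (inner ℝ (qbar : Quat) (‖p‖⁻¹ • p) • (qbar : Quat))
              • (‖p‖⁻¹ • p))) (q : Quat) := by
        have h2 := (differentiableAt_const (c := (qbar : Quat))).inner ℝ h0
        have h3 := h2.smul_const (qbar : Quat)
        exact (hd q).smul (h3.sub ((h0.inner ℝ h3).smul h0))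
      refine h1.congr_of_eventuallyEq ?_
      filter_upwards [ho.mem_nhds (hq q)] with p hp
      rw [homExt_of_ne _ hp, homExt_of_ne _ hp]
      rfl
    · simp only [projPerp, inner_smul_right, inner_sub_right, real_inner_self_eq_norm_sq,
        norm_coe_H1]
      ring
    · have h := (((hXY.flow_iu k q).mul (hasFlowDeriv_rcoord qbar k q)).mul
        (hasFlowDeriv_pcoord qbar k q)).const_mul (-1)
      refine h.congr (fun p => ?_) (by ring)
      have h1 : inner ℝ ((iu k).val * (p : Quat)) (qbar : Quat) = -pcoord qbar k p := by
        rw [real_inner_comm, inner_iu_mul_comm]; rfl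
      simp only [projPerp, inner_smul_right, inner_sub_right, inner_iu_mul_self, h1, rcoord]
      ring
  rw [collision, hlap, hdiv, Finset.mul_sum, Finset.mul_sum, ← Finset.sum_add_distrib]
  refine Finset.sum_congr rfl fun k _ => ?_
  ring

/-! ### Dissipation of the collision operator and the Poincaré inequality -/

/-- The flux `D / 4 ∇ f - ν f r ∇ r` of the collision operator, in the frame. -/
def flux (ν D : ℝ) (qbar : H1) (f : H1 → ℝ) (X : Fin 3 → H1 → ℝ) (k : Fin 3) (q : H1) : ℝ :=
  D / 4 * X k q + ν * (f q * rcoord qbar q * pcoord qbar k q)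

/-- The flow derivative of `flux`; the sum over `k` is the collision operator. -/
def fluxDeriv (ν D : ℝ) (qbar : H1) (f : H1 → ℝ) (X Y : Fin 3 → H1 → ℝ) (k : Fin 3) (q : H1) : ℝ :=
  D / 4 * Y k q + ν * (X k q * rcoord qbar q * pcoord qbar k q
    - f q * pcoord qbar k q ^ 2 + f q * rcoord qbar q ^ 2)

section frame

variable {f : H1 → ℝ} {X Y : Fin 3 → H1 → ℝ}

lemma HasFrameDerivs.continuous_flux (h : HasFrameDerivs f X Y) (ν D : ℝ) (qbar : H1) (k : Fin 3) :
    Continuous (flux ν D qbar f X k) := by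
  have h1 := h.continuous
  have h2 := h.continuous_fst k
  have h3 := continuous_rcoord qbar
  have h4 := continuous_pcoord qbar k
  unfold flux
  fun_prop

lemma HasFrameDerivs.continuous_fluxDeriv (h : HasFrameDerivs f X Y) (ν D : ℝ) (qbar : H1)
    (k : Fin 3) : Continuous (fluxDeriv ν D qbar f X Y k) := by
  have h1 := h.continuous
  have h2 := h.continuous_fst k
  have h5 := h.continuous_snd k
  have h3 := continuous_rcoord qbar
  have h4 := continuous_pcoord qbar k
  unfold fluxDeriv
  fun_prop

lemma HasFrameDerivs.hasFlowDeriv_flux (h : HasFrameDerivs f X Y) (ν D : ℝ) (qbar : H1) (k : Fin 3)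
    (q : H1) :
    HasFlowDeriv (iu k) (flux ν D qbar f X k) (fluxDeriv ν D qbar f X Y k q) q := by
  refine (((h.flow_snd k q).const_mul (D / 4)).add
    ((((h.flow_iu k q).mul (hasFlowDeriv_rcoord qbar k q)).mul
      (hasFlowDeriv_pcoord qbar k q)).const_mul ν)).congr (fun p => rfl) ?_
  simp only [fluxDeriv]
  ring

end frame

/-- Weak form of the collision operator against a continuously differentiable test function. -/
lemma integral_sum_fluxDeriv_mul {f φ : H1 → ℝ} {X Y Φ : Fin 3 → H1 → ℝ}
    (h : HasFrameDerivs f X Y) (ν D : ℝ) (qbar : H1) (hφ : Continuous φ)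
    (hΦ : ∀ k, Continuous (Φ k)) (hd : ∀ k q, HasFlowDeriv (iu k) φ (Φ k q) q) :
    ∫ q, (∑ k, fluxDeriv ν D qbar f X Y k q) * φ q ∂dq
      = -∫ q, ∑ k, flux ν D qbar f X k q * Φ k q ∂dq := by
  have hc := h.continuous_flux ν D qbar
  have hc' := h.continuous_fluxDeriv ν D qbar
  have h1 : ∀ k, ∫ q, (fluxDeriv ν D qbar f X Y k q * φ q + flux ν D qbar f X k q * Φ k q) ∂dq = 0 :=
    fun k => integral_flowDeriv_eq_zero_of_continuous (ξ := iu k)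
      (((hc' k).fun_mul hφ).add ((hc k).fun_mul (hΦ k)))
      (fun q => (h.hasFlowDeriv_flux ν D qbar k q).mul (hd k q))
  have h2 : ∀ k, ∫ q, fluxDeriv ν D qbar f X Y k q * φ q ∂dq
      = -∫ q, flux ν D qbar f X k q * Φ k q ∂dq := fun k => by
    have := h1 k
    rw [integral_add (integrable_of_continuous ((hc' k).fun_mul hφ))
      (integrable_of_continuous ((hc k).fun_mul (hΦ k)))] at this
    linarith
  simp only [Finset.sum_mul]
  rw [integral_finsetSum _ fun k _ => integrable_of_continuous ((hc' k).fun_mul hφ),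
    integral_finsetSum _ fun k _ => integrable_of_continuous ((hc k).fun_mul (hΦ k)),
    ← Finset.sum_neg_distrib]
  exact Finset.sum_congr rfl fun k _ => h2 k

lemma integral_abs_rotor_mul_sub_le {a : H1 → ℝ} {Z : Fin 3 → H1 → ℝ}
    (hZ : ∀ k, Continuous (Z k))
    (hd : ∀ ξ q, HasFlowDeriv ξ a (∑ k, imVec ξ.val k * Z k q) q) (ξ : ImUnit) {s : ℝ}
    (hs : 0 ≤ s) :
    ∫ q, |a (rotor ξ s * q) - a q| ∂dq ≤ s * ∫ q, ∑ k, |Z k q| ∂dq := by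
  have hZc : Continuous fun q => ∑ k, |Z k q| := by fun_prop
  have hrc : Continuous (fun z : ℝ × H1 => rotor ξ z.1 * z.2) :=
    ((continuous_rotor ξ).comp continuous_fst).mul continuous_snd
  have hbc : Continuous (fun z : ℝ × H1 => ∑ k, |Z k (rotor ξ z.1 * z.2)|) := hZc.comp hrc
  set ν : Measure ℝ := volume.restrict (Ioc 0 s) with hν
  have hI : Integrable (fun z : ℝ × H1 => ∑ k, |Z k (rotor ξ z.1 * z.2)|) (ν.prod dq) := by
    rw [integrable_prod_iff hbc.aestronglyMeasurable]
    constructor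
    · exact Eventually.of_forall fun t =>
        integrable_of_continuous (hbc.comp (Continuous.prodMk_right t))
    · have : ∀ t, ∫ y, ‖∑ k, |Z k (rotor ξ t * y)|‖ ∂dq = ∫ y, ‖∑ k, |Z k y|‖ ∂dq := fun t =>
        integral_mul_left_eq_self (μ := dq) (fun y => ‖∑ k, |Z k y|‖) (rotor ξ t)
      simp only [this]
      exact integrable_const _
  have h1 : ∫ t, ∫ q, ∑ k, |Z k (rotor ξ t * q)| ∂dq ∂ν = s * ∫ q, ∑ k, |Z k q| ∂dq := by
    have : ∀ t, ∫ y, ∑ k, |Z k (rotor ξ t * y)| ∂dq = ∫ y, ∑ k, |Z k y| ∂dq := fun t =>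
      integral_mul_left_eq_self (μ := dq) (fun y => ∑ k, |Z k y|) (rotor ξ t)
    simp only [this]
    simp [hν, hs]
  rw [← h1, integral_integral_swap hI]
  refine integral_mono_of_nonneg (Eventually.of_forall fun q => abs_nonneg _)
    hI.integral_prod_right (Eventually.of_forall fun q => ?_)
  have hcs : Continuous fun t => ∑ k, imVec ξ.val k * Z k (rotor ξ t * q) := by
    have := fun k => (hZ k).comp (hrc.comp (Continuous.prodMk_left q))
    exact continuous_finsetSum _ fun k _ => continuous_const.mul (this k)
  have h2 : a (rotor ξ s * q) - a q = ∫ t in (0 : ℝ)..s, ∑ k, imVec ξ.val k * Z k (rotor ξ t * q) := by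
    rw [intervalIntegral.integral_eq_sub_of_hasDerivAt (f := fun s => a (rotor ξ s * q))
      (fun t _ => (hd ξ (rotor ξ t * q)).hasDerivAt) (hcs.intervalIntegrable _ _)]
    simp
  simp only
  rw [h2, ← Real.norm_eq_abs, ← intervalIntegral.integral_of_le hs]
  refine intervalIntegral.norm_integral_le_of_norm_le hs ?_
    ((hbc.comp (Continuous.prodMk_left q)).intervalIntegrable _ _)
  refine Eventually.of_forall fun t _ => ?_
  refine (norm_sum_le _ _).trans (Finset.sum_le_sum fun k _ => ?_)
  rw [norm_mul, Real.norm_eq_abs, Real.norm_eq_abs]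
  exact mul_le_of_le_one_left (abs_nonneg _) (ξ.abs_imVec_le k)

/-- The total mass of the unit quaternions. -/
def vol : ℝ := dq.real univ

lemma vol_pos : 0 < vol := by
  refine ENNReal.toReal_pos ?_ (measure_ne_top _ _)
  simpa using dq_ne_zero

/-- Poincaré inequality in `L¹`. Two points of the group are joined by a one-parameter subgroup,
and translations preserve the measure. -/
lemma integral_abs_sub_average_le {a : H1 → ℝ} {Z : Fin 3 → H1 → ℝ} (ha : Continuous a)
    (hZ : ∀ k, Continuous (Z k))
    (hd : ∀ ξ q, HasFlowDeriv ξ a (∑ k, imVec ξ.val k * Z k q) q) :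
    ∫ q, |a q - vol⁻¹ * ∫ p, a p ∂dq| ∂dq ≤ Real.pi * ∫ q, ∑ k, |Z k q| ∂dq := by
  have hv := vol_pos
  have hS : 0 ≤ ∫ q, ∑ k, |Z k q| ∂dq := integral_nonneg fun q =>
    Finset.sum_nonneg fun k _ => abs_nonneg _
  have hc2 : Continuous (fun z : H1 × H1 => |a (z.2 * z.1) - a z.1|) := by fun_prop
  have hI : Integrable (fun z : H1 × H1 => |a (z.2 * z.1) - a z.1|) (dq.prod dq) :=
    hc2.integrable_of_hasCompactSupport (HasCompactSupport.of_compactSpace _)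
  have h1 : ∀ q, |a q - vol⁻¹ * ∫ p, a p ∂dq| ≤ vol⁻¹ * ∫ p, |a (p * q) - a q| ∂dq := by
    intro q
    have e1 : ∫ p, a p ∂dq = ∫ p, a (p * q) ∂dq := (integral_mul_right_eq_self a q).symm
    have e2 : ∫ p, (a (p * q) - a q) ∂dq = (∫ p, a (p * q) ∂dq) - vol * a q := by
      rw [integral_sub (integrable_of_continuous (by fun_prop)) (integrable_const _)]
      simp [vol]
    have e3 : a q - vol⁻¹ * ∫ p, a p ∂dq = -(vol⁻¹ * ∫ p, (a (p * q) - a q) ∂dq) := by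
      rw [e2, e1]
      field_simp
      ring
    rw [e3, abs_neg, abs_mul, abs_of_pos (inv_pos.2 hv)]
    gcongr
    exact abs_integral_le_integral_abs
  calc ∫ q, |a q - vol⁻¹ * ∫ p, a p ∂dq| ∂dq
      ≤ ∫ q, vol⁻¹ * ∫ p, |a (p * q) - a q| ∂dq ∂dq := by
        refine integral_mono (integrable_of_continuous (by fun_prop)) ?_ h1
        exact hI.integral_prod_left.const_mul _
    _ = vol⁻¹ * ∫ p, ∫ q, |a (p * q) - a q| ∂dq ∂dq := by
        rw [integral_const_mul, integral_integral_swap hI]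
    _ ≤ vol⁻¹ * ∫ p : H1, Real.pi * ∫ q, ∑ k, |Z k q| ∂dq ∂dq := by
        refine mul_le_mul_of_nonneg_left ?_ (inv_pos.2 hv).le
        refine integral_mono hI.integral_prod_right (integrable_const _) fun p => ?_
        obtain ⟨ξ, s, hs, rfl⟩ := exists_rotor_eq p
        refine (integral_abs_rotor_mul_sub_le hZ hd ξ hs.1).trans ?_
        exact mul_le_mul_of_nonneg_right hs.2 hS
    _ = Real.pi * ∫ q, ∑ k, |Z k q| ∂dq := by
        simp only [integral_const, smul_eq_mul, vol] at hv ⊢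
        field_simp

/-- The inverse of the Gibbs weight, `exp (-(2 / d) (qbar · q)²)`. -/
def invGibbs (d : ℝ) (qbar q : H1) : ℝ := Real.exp (-(2 / d) * rcoord qbar q ^ 2)

lemma continuous_invGibbs (d : ℝ) (qbar : H1) : Continuous (invGibbs d qbar) := by
  have := continuous_rcoord qbar
  unfold invGibbs
  fun_prop

lemma hasFlowDeriv_rcoord_im (qbar : H1) (ξ : ImUnit) (q : H1) :
    HasFlowDeriv ξ (rcoord qbar) (∑ k, imVec ξ.val k * -pcoord qbar k q) q := by
  refine (hasFlowDeriv_inner ξ qbar q).congr (fun p => rfl) ?_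
  conv_rhs => rw [ξ.val_eq_sum]
  simp only [Finset.sum_mul, inner_sum, smul_mul_assoc, inner_smul_right, inner_iu_mul_comm]
  rfl

lemma hasFlowDeriv_invGibbs (d : ℝ) (qbar : H1) (ξ : ImUnit) (q : H1) :
    HasFlowDeriv ξ (invGibbs d qbar) (∑ k, imVec ξ.val k *
      (4 / d * rcoord qbar q * pcoord qbar k q * invGibbs d qbar q)) q := by
  have h1 : HasDerivAt (fun r : ℝ => Real.exp (-(2 / d) * r ^ 2))
      (Real.exp (-(2 / d) * rcoord qbar q ^ 2) * (-(2 / d) * (2 * rcoord qbar q))) (rcoord qbar q) := by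
    simpa using ((hasDerivAt_pow 2 (rcoord qbar q)).const_mul (-(2 / d))).exp
  refine (HasFlowDeriv.comp h1 (hasFlowDeriv_rcoord_im qbar ξ q)).congr (fun p => rfl) ?_
  rw [Finset.mul_sum]
  refine Finset.sum_congr rfl fun k _ => ?_
  simp only [invGibbs]
  ring

/-- A function with a small collision term is close in `L¹`, after multiplication by the inverse of
the Gibbs weight and composition with `arctan`, to a constant. The composition with the bounded
function `arctan` is what makes an `L¹` bound of the collision term sufficient. -/
lemma integral_abs_arctan_sub_average_le {ν D : ℝ} (hν : 0 < ν) (hD : 0 < D) (qbar : H1)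
    {f : H1 → ℝ} {X Y : Fin 3 → H1 → ℝ} (h : HasFrameDerivs f X Y) {η : ℝ} (hη : 0 < η) :
    ∫ q, |Real.arctan (f q * invGibbs (D / ν) qbar q)
        - vol⁻¹ * ∫ p, Real.arctan (f p * invGibbs (D / ν) qbar p) ∂dq| ∂dq
      ≤ Real.pi * (3 * η * vol
        + Real.pi / (2 * D * η) * ∫ q, |∑ k, fluxDeriv ν D qbar f X Y k q| ∂dq) := by
  set w := invGibbs (D / ν) qbar with hw
  have hwc : Continuous w := continuous_invGibbs _ _
  have hfc := h.continuous
  have hJc := h.continuous_flux ν D qbar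
  have hGc := h.continuous_fluxDeriv ν D qbar
  set a : H1 → ℝ := fun q => Real.arctan (f q * w q) with ha
  set Z : Fin 3 → H1 → ℝ := fun k q =>
    (1 + (f q * w q) ^ 2)⁻¹ * (4 / D * w q * flux ν D qbar f X k q) with hZ
  have hac : Continuous a := Real.continuous_arctan.comp (by fun_prop)
  have hZc : ∀ k, Continuous (Z k) := fun k => by
    refine Continuous.mul (Continuous.inv₀ (by fun_prop) fun q => by positivity) ?_
    exact (continuous_const.mul hwc).mul (hJc k)
  have hZd : ∀ ξ q, HasFlowDeriv ξ a (∑ k, imVec ξ.val k * Z k q) q := fun ξ q => by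
    refine (HasFlowDeriv.comp (Real.hasDerivAt_arctan' (f q * w q))
      ((h.flow_fst ξ q).mul (hasFlowDeriv_invGibbs (D / ν) qbar ξ q))).congr (fun p => rfl) ?_
    simp only [Finset.mul_sum, Finset.sum_mul, ← Finset.sum_add_distrib, hZ, flux, ← hw]
    refine Finset.sum_congr rfl fun k _ => ?_
    field_simp
  have hZi : ∀ k q, HasFlowDeriv (iu k) a (Z k q) q := fun k q => by
    refine (hZd (iu k) q).congr (fun p => rfl) ?_
    fin_cases k <;> simp [Fin.sum_univ_three, val_iu]
  have hweak := integral_sum_fluxDeriv_mul h ν D qbar hac hZc hZi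
  set G := ∫ q, |∑ k, fluxDeriv ν D qbar f X Y k q| ∂dq with hG
  have hGc' : Continuous fun q => ∑ k, fluxDeriv ν D qbar f X Y k q := by fun_prop
  have hw1 : ∀ q, w q ≤ 1 := fun q => by
    rw [hw, invGibbs, Real.exp_le_one_iff]
    have : 0 < 2 / (D / ν) := by positivity
    nlinarith [sq_nonneg (rcoord qbar q)]
  have hw0 : ∀ q, 0 < w q := fun q => Real.exp_pos _
  have hdis : ∫ q, ∑ k, Z k q ^ 2 ∂dq ≤ 2 * Real.pi / D * G := by
    have h1 : ∫ q, ∑ k, Z k q ^ 2 ∂dq ≤ 4 / D * ∫ q, ∑ k, flux ν D qbar f X k q * Z k q ∂dq := by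
      rw [← integral_const_mul]
      refine integral_mono (integrable_of_continuous (by fun_prop))
        (integrable_of_continuous (by fun_prop)) fun q => ?_
      simp only [Finset.mul_sum]
      refine Finset.sum_le_sum fun k _ => ?_
      simp only [hZ]
      have e1 : ((1 + (f q * w q) ^ 2)⁻¹ * (4 / D * w q * flux ν D qbar f X k q)) ^ 2
        = (4 / D * flux ν D qbar f X k q) ^ 2 * ((1 + (f q * w q) ^ 2)⁻¹ * w q) *
          ((1 + (f q * w q) ^ 2)⁻¹ * w q) := by ring
      have e2 : 4 / D * (flux ν D qbar f X k q *
            ((1 + (f q * w q) ^ 2)⁻¹ * (4 / D * w q * flux ν D qbar f X k q)))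
        = (4 / D * flux ν D qbar f X k q) ^ 2 * ((1 + (f q * w q) ^ 2)⁻¹ * w q) := by ring
      rw [e1, e2]
      have h3 : (1 + (f q * w q) ^ 2)⁻¹ ≤ 1 := inv_le_one_of_one_le₀ (by nlinarith [sq_nonneg (f q * w q)])
      have h4 : 0 < (1 + (f q * w q) ^ 2)⁻¹ := by positivity
      have h5 := hw0 q
      refine mul_le_of_le_one_right (by positivity) ?_
      exact mul_le_one₀ h3 h5.le (hw1 q)
    have h2 : -∫ q, (∑ k, fluxDeriv ν D qbar f X Y k q) * a q ∂dq ≤ Real.pi / 2 * G := by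
      refine (neg_le_abs _).trans (abs_integral_le_integral_abs.trans ?_)
      rw [hG, ← integral_const_mul]
      refine integral_mono (integrable_of_continuous (by fun_prop))
        (integrable_of_continuous (by fun_prop)) fun q => ?_
      simp only [abs_mul]
      rw [mul_comm]
      refine mul_le_mul_of_nonneg_right ?_ (abs_nonneg _)
      rw [abs_le]
      exact ⟨(Real.neg_pi_div_two_lt_arctan _).le, (Real.arctan_lt_pi_div_two _).le⟩
    rw [hweak, neg_neg] at h2
    calc _ ≤ _ := h1
      _ ≤ 4 / D * (Real.pi / 2 * G) := by gcongr
      _ = _ := by ring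
  refine (integral_abs_sub_average_le hac hZc hZd).trans ?_
  gcongr
  calc ∫ q, ∑ k, |Z k q| ∂dq ≤ ∫ q, (3 * η + 1 / (4 * η) * ∑ k, Z k q ^ 2) ∂dq := by
        refine integral_mono (integrable_of_continuous (by fun_prop))
          (integrable_of_continuous (by fun_prop)) fun q => ?_
        have : ∀ k, |Z k q| ≤ η + 1 / (4 * η) * Z k q ^ 2 := fun k => by
          have e : η + 1 / (4 * η) * Z k q ^ 2 - |Z k q| = (2 * η - |Z k q|) ^ 2 / (4 * η) := by
            rw [← sq_abs (Z k q)]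
            field_simp
            ring
          have : 0 ≤ (2 * η - |Z k q|) ^ 2 / (4 * η) := by positivity
          linarith
        calc ∑ k, |Z k q| ≤ ∑ k, (η + 1 / (4 * η) * Z k q ^ 2) := Finset.sum_le_sum fun k _ => this k
          _ = _ := by rw [Finset.sum_add_distrib, ← Finset.mul_sum]; simp
    _ = 3 * η * vol + 1 / (4 * η) * ∫ q, ∑ k, Z k q ^ 2 ∂dq := by
        rw [integral_add (integrable_const _) (integrable_of_continuous (by fun_prop)),
          integral_const_mul (1 / (4 * η)), integral_const]
        simp only [vol, smul_eq_mul]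
        ring
    _ ≤ 3 * η * vol + 1 / (4 * η) * (2 * Real.pi / D * G) := by gcongr
    _ = _ := by
        field_simp
        ring

/-! ### Limits in `L¹` along convergent mean quaternions -/

lemma eventually_forall_abs_sub_lt {K : H1 → H1 → ℝ} (hK : Continuous (Function.uncurry K))
    {l : Filter ℝ} {p : ℝ → H1} {p₀ : H1} (hp : Tendsto p l (𝓝 p₀)) {δ : ℝ} (hδ : 0 < δ) :
    ∀ᶠ ε in l, ∀ q, |K (p ε) q - K p₀ q| < δ := by
  set κ : C(H1, C(H1, ℝ)) := ContinuousMap.curry ⟨Function.uncurry K, hK⟩ with hκ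
  have h1 : Tendsto (fun ε => κ (p ε)) l (𝓝 (κ p₀)) := (κ.continuous.tendsto p₀).comp hp
  filter_upwards [(Metric.tendsto_nhds.1 h1) δ hδ] with ε hε q
  have := (ContinuousMap.dist_lt_iff hδ).1 hε q
  rwa [Real.dist_eq] at this

lemma exists_abs_le_of_continuous {K : H1 → H1 → ℝ} (hK : Continuous (Function.uncurry K)) :
    ∃ C, 0 ≤ C ∧ ∀ p q, |K p q| ≤ C := by
  obtain ⟨C, hC⟩ := (isCompact_univ (X := H1 × H1)).exists_bound_of_continuousOn hK.continuousOn
  exact ⟨C, (norm_nonneg _).trans (hC (1, 1) (mem_univ _)), fun p q => hC (p, q) (mem_univ _)⟩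

lemma continuous_uncurry_right {K : H1 → H1 → ℝ} (hK : Continuous (Function.uncurry K)) (p : H1) :
    Continuous (K p) := hK.comp (Continuous.prodMk_right p)

lemma integrable_mul_continuous {u K : H1 → ℝ} (hu : Integrable u dq) (hK : Continuous K) :
    Integrable (fun q => u q * K q) dq := by
  obtain ⟨C, hC⟩ := (isCompact_univ (X := H1)).exists_bound_of_continuousOn hK.continuousOn
  exact hu.mul_bdd hK.aestronglyMeasurable (Eventually.of_forall fun q => hC q (mem_univ _))

/-- Convergence in `L¹` is preserved by multiplication with kernels that converge uniformly. -/
lemma tendsto_integral_abs_mul_sub {l : Filter ℝ} (hl : l ≤ 𝓝[>] (0 : ℝ)) {u : ℝ → H1 → ℝ}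
    {v : H1 → ℝ} (huv : TendstoL1 u v) {K : H1 → H1 → ℝ} (hK : Continuous (Function.uncurry K))
    {p : ℝ → H1} {p₀ : H1} (hp : Tendsto p l (𝓝 p₀)) :
    Tendsto (fun ε => ∫ q, |u ε q * K (p ε) q - v q * K p₀ q| ∂dq) l (𝓝 0) := by
  obtain ⟨hv, hu, hlim⟩ := huv
  obtain ⟨C, hC0, hC⟩ := exists_abs_le_of_continuous hK
  have hKc := continuous_uncurry_right hK
  have hV : 0 ≤ ∫ q, |v q| ∂dq := integral_nonneg fun q => abs_nonneg _
  rw [Metric.tendsto_nhds]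
  intro η hη
  set V := ∫ q, |v q| ∂dq with hVdef
  have h1 := eventually_forall_abs_sub_lt hK hp (δ := η / (2 * (V + 1))) (by positivity)
  have h2 := (Metric.tendsto_nhds.1 (hlim.mono_left hl)) (η / (2 * (C + 1))) (by positivity)
  filter_upwards [h1, h2, hl hu] with ε h1 h2 h3
  rw [Real.dist_eq, sub_zero] at h2 ⊢
  have hi : Integrable (fun q => |u ε q - v q|) dq := (h3.sub hv).abs
  rw [abs_of_nonneg (integral_nonneg fun q => abs_nonneg _)] at h2 ⊢
  have h5 : ∫ q, |u ε q * K (p ε) q - v q * K p₀ q| ∂dq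
      ≤ C * ∫ q, |u ε q - v q| ∂dq + η / (2 * (V + 1)) * V := by
    rw [hVdef, ← integral_const_mul, ← integral_const_mul, ← integral_add (hi.const_mul _)
      (hv.abs.const_mul _)]
    refine integral_mono ((integrable_mul_continuous h3 (hKc _)).sub
      (integrable_mul_continuous hv (hKc _))).abs ((hi.const_mul _).add (hv.abs.const_mul _))
      fun q => ?_
    have e : u ε q * K (p ε) q - v q * K p₀ q
        = K (p ε) q * (u ε q - v q) + (K (p ε) q - K p₀ q) * v q := by ring
    simp only
    rw [e]
    refine (abs_add_le _ _).trans ?_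
    rw [abs_mul, abs_mul]
    gcongr
    · exact hC _ _
    · exact (h1 q).le
  have h6 : C * ∫ q, |u ε q - v q| ∂dq ≤ C * (η / (2 * (C + 1))) :=
    mul_le_mul_of_nonneg_left h2.le hC0
  have h7 : C * (η / (2 * (C + 1))) < η / 2 := by
    rw [show C * (η / (2 * (C + 1))) = η / 2 * (C / (C + 1)) by field_simp]
    exact mul_lt_of_lt_one_right (by positivity) ((div_lt_one (by positivity)).2 (by linarith))
  have h8 : η / (2 * (V + 1)) * V < η / 2 := by
    rw [show η / (2 * (V + 1)) * V = η / 2 * (V / (V + 1)) by field_simp]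
    exact mul_lt_of_lt_one_right (by positivity) ((div_lt_one (by positivity)).2 (by linarith))
  linarith

lemma tendsto_integral_mul {l : Filter ℝ} (hl : l ≤ 𝓝[>] (0 : ℝ)) {u : ℝ → H1 → ℝ}
    {v : H1 → ℝ} (huv : TendstoL1 u v) {K : H1 → H1 → ℝ} (hK : Continuous (Function.uncurry K))
    {p : ℝ → H1} {p₀ : H1} (hp : Tendsto p l (𝓝 p₀)) :
    Tendsto (fun ε => ∫ q, u ε q * K (p ε) q ∂dq) l (𝓝 (∫ q, v q * K p₀ q ∂dq)) := by
  have hKc := continuous_uncurry_right hK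
  rw [tendsto_iff_dist_tendsto_zero]
  refine squeeze_zero' (Eventually.of_forall fun _ => dist_nonneg) ?_
    (tendsto_integral_abs_mul_sub hl huv hK hp)
  filter_upwards [hl huv.2.1] with ε h3
  rw [Real.dist_eq, ← integral_sub (integrable_mul_continuous h3 (hKc _))
    (integrable_mul_continuous huv.1 (hKc _))]
  exact abs_integral_le_integral_abs

/-! ### The kinetic equation at a point of space-time -/

section kinetic

variable {ν D : ℝ} {e₁ : E3} {T ε₀ : ℝ} {f : ℝ → ℝ → E3 → H1 → ℝ}

lemma IsKineticFamily.continuous_derivs (hf : IsKineticFamily ν D e₁ T ε₀ f) {ε : ℝ}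
    (hε : ε ∈ Ioo 0 ε₀) {t : ℝ} (ht : t ∈ Ioo 0 T) (x : E3) :
    Continuous (fun q => deriv (fun s => f ε s x q) t) ∧
    (∀ i, Continuous (fun q => partialX i (fun y => f ε t y q) x)) ∧
    ∀ q, DifferentiableAt ℝ (fun y => f ε t y q) x := by
  set G : ℝ × E3 × Quat → ℝ := fun z => homExt (f ε z.1 z.2.1) z.2.2 with hG
  set S : Set (ℝ × E3 × Quat) := Ioo 0 T ×ˢ (univ ×ˢ {0}ᶜ) with hS
  have hSo : IsOpen S := isOpen_Ioo.prod (isOpen_univ.prod isOpen_compl_singleton)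
  have hC : ContDiffOn ℝ 1 G S := hf.contDiff_one ε hε
  have hmem : ∀ q : H1, (t, x, (q : Quat)) ∈ S := fun q => ⟨ht, mem_univ _, coe_H1_ne_zero q⟩
  have hd : ∀ q : H1, HasFDerivAt G (fderiv ℝ G (t, x, (q : Quat))) (t, x, (q : Quat)) := fun q =>
    ((hC.differentiableOn (by norm_num)).differentiableAt (hSo.mem_nhds (hmem q))).hasFDerivAt
  have hcont : Continuous fun q : H1 => fderiv ℝ G (t, x, (q : Quat)) :=
    (hC.continuousOn_fderiv_of_isOpen hSo le_rfl).comp_continuous (by fun_prop) hmem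
  have h1 : ∀ q : H1, HasDerivAt (fun s => f ε s x q) (fderiv ℝ G (t, x, (q : Quat)) (1, 0)) t := by
    intro q
    have hcurve : HasDerivAt (fun s : ℝ => (s, (x, (q : Quat)))) ((1 : ℝ), (0 : E3 × Quat)) t :=
      (hasDerivAt_id t).prodMk (hasDerivAt_const t _)
    have := HasFDerivAt.comp_hasDerivAt (l := G) t (hd q) hcurve
    simpa [hG, Function.comp_def] using this
  have h2 : ∀ q : H1, HasFDerivAt (fun y => f ε t y q) ((fderiv ℝ G (t, x, (q : Quat))).comp
      ((0 : E3 →L[ℝ] ℝ).prod ((ContinuousLinearMap.id ℝ E3).prod (0 : E3 →L[ℝ] Quat)))) x := by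
    intro q
    have hcurve : HasFDerivAt (fun y : E3 => (t, (y, (q : Quat))))
        ((0 : E3 →L[ℝ] ℝ).prod ((ContinuousLinearMap.id ℝ E3).prod (0 : E3 →L[ℝ] Quat))) x :=
      (hasFDerivAt_const t x).prodMk ((hasFDerivAt_id x).prodMk (hasFDerivAt_const _ x))
    have := HasFDerivAt.comp (g := G) x (hd q) hcurve
    simpa [hG, Function.comp_def] using this
  refine ⟨?_, fun i => ?_, fun q => (h2 q).differentiableAt⟩
  · simp only [fun q => (h1 q).deriv]
    exact hcont.clm_apply continuous_const
  · simp only [partialX, fun q => (h2 q).fderiv]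
    exact hcont.clm_apply continuous_const

lemma continuous_rotate (e₁ : E3) (i : Fin 3) : Continuous fun q : H1 => rotate e₁ q i := by
  have h1 : Continuous fun q : H1 => (q : Quat) * ofVec e₁ * star (q : Quat) := by fun_prop
  fin_cases i
  · exact Quaternion.continuous_imI.comp h1
  · exact Quaternion.continuous_imJ.comp h1
  · exact Quaternion.continuous_imK.comp h1

lemma IsKineticFamily.transport_eq (hf : IsKineticFamily ν D e₁ T ε₀ f) {ε : ℝ}
    (hε : ε ∈ Ioo 0 ε₀) {t : ℝ} (ht : t ∈ Ioo 0 T) (x : E3) (q : H1) :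
    transport e₁ (f ε) t x q = deriv (fun s => f ε s x q) t
      + ∑ i, partialX i (fun y => f ε t y q) x * rotate e₁ q i := by
  have hd := (hf.continuous_derivs hε ht x).2.2 q
  rw [transport, divX]
  congr 1
  refine Finset.sum_congr rfl fun i _ => ?_
  simp only [partialX, PiLp.smul_apply, smul_eq_mul]
  rw [fderiv_mul_const hd]
  simp [mul_comm]

lemma IsKineticFamily.continuous_transport (hf : IsKineticFamily ν D e₁ T ε₀ f) {ε : ℝ}
    (hε : ε ∈ Ioo 0 ε₀) {t : ℝ} (ht : t ∈ Ioo 0 T) (x : E3) :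
    Continuous (transport e₁ (f ε) t x) := by
  obtain ⟨h1, h2, _⟩ := hf.continuous_derivs hε ht x
  have h3 := continuous_rotate e₁
  rw [show transport e₁ (f ε) t x = _ from funext fun q => hf.transport_eq hε ht x q]
  exact h1.add (continuous_finsetSum _ fun i _ => (h2 i).mul (h3 i))

lemma continuous_collision {g : H1 → ℝ} (hg : ContDiffOn ℝ 2 (homExt g) {0}ᶜ) (ν D : ℝ)
    (qbar : H1) : Continuous (collision ν D qbar g) := by
  obtain ⟨X, Y, hXY, h⟩ := collision_eq_of_contDiffOn hg
  have := hXY.continuous_fluxDeriv ν D qbar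
  rw [show collision ν D qbar g = fun q => ∑ k, fluxDeriv ν D qbar g X Y k q from
    funext fun q => h ν D qbar q]
  fun_prop

lemma integral_abs_le_of_remainder {ε : ℝ} (hε : 0 < ε) {G R u : H1 → ℝ} {w z : Fin 3 → H1 → ℝ}
    (hG : Continuous G) (hR : Continuous R) (hu : Continuous u) (hw : ∀ i, Continuous (w i))
    (hz : ∀ i, Continuous (z i)) (h : ∀ q, R q = u q + ∑ i, w i q * z i q) :
    ∫ q, |G q| ∂dq ≤ ε * ∫ q, |R q - 1 / ε * G q| ∂dq + ∫ q, |ε * u q| ∂dq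
      + ∑ i, ∫ q, |ε * w i q * z i q| ∂dq := by
  have i1 : Integrable (fun q => ε * |R q - 1 / ε * G q|) dq :=
    integrable_of_continuous (by fun_prop)
  have i2 : Integrable (fun q => |ε * u q|) dq := integrable_of_continuous (by fun_prop)
  have i3 : ∀ i, Integrable (fun q => |ε * w i q * z i q|) dq := fun i =>
    integrable_of_continuous (by fun_prop)
  have i4 : Integrable (fun q => ∑ i, |ε * w i q * z i q|) dq :=
    integrable_finsetSum _ fun i _ => i3 i
  have i12 : Integrable (fun q => ε * |R q - 1 / ε * G q| + |ε * u q|) dq := i1.add i2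
  rw [← integral_const_mul, ← integral_finsetSum _ fun i _ => i3 i, ← integral_add i1 i2,
    ← integral_add i12 i4]
  refine integral_mono (integrable_of_continuous (by fun_prop)) (i12.add i4) fun q => ?_
  have e : G q = -(ε * (R q - 1 / ε * G q)) + ε * u q + ∑ i, ε * w i q * z i q := by
    have : ∑ i, ε * w i q * z i q = ε * ∑ i, w i q * z i q := by
      rw [Finset.mul_sum]
      exact Finset.sum_congr rfl fun i _ => by ring
    rw [this, h q]
    field_simp
    ring
  simp only
  conv_lhs => rw [e]
  refine (abs_add_le _ _).trans (add_le_add ((abs_add_le _ _).trans (add_le_add ?_ le_rfl))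
    (Finset.abs_sum_le_sum_abs _ _))
  rw [abs_neg, abs_mul, abs_of_pos hε]

/-- If the derivatives of the family are `o(1 / ε)`, the collision term vanishes in the limit. -/
lemma IsKineticFamily.tendsto_integral_abs_collision (hε₀ : 0 < ε₀)
    (hf : IsKineticFamily ν D e₁ T ε₀ f)
    {t : ℝ} (ht : t ∈ Ioo 0 T) (x : E3) {qbar : ℝ → H1}
    (heq : (fun ε => ∫ q, |transport e₁ (f ε) t x q
          - 1 / ε * collision ν D (qbar ε) (f ε t x) q| ∂dq) =O[𝓝[>] (0 : ℝ)] (fun ε => ε))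
    (h1 : TendstoL1 (fun ε q => ε * deriv (fun s => f ε s x q) t) 0)
    (h2 : ∀ i, TendstoL1 (fun ε q => ε * partialX i (fun y => f ε t y q) x) 0) :
    Tendsto (fun ε => ∫ q, |collision ν D (qbar ε) (f ε t x) q| ∂dq) (𝓝[>] (0 : ℝ)) (𝓝 0) := by
  have hid : Tendsto (fun ε : ℝ => ε) (𝓝[>] (0 : ℝ)) (𝓝 0) := tendsto_nhdsWithin_of_tendsto_nhds
    tendsto_id
  have h3 : ∀ i, Tendsto (fun ε => ∫ q, |ε * partialX i (fun y => f ε t y q) x * rotate e₁ q i| ∂dq)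
      (𝓝[>] (0 : ℝ)) (𝓝 0) := fun i => by
    have hK : Continuous (Function.uncurry fun _ q : H1 => rotate e₁ q i) :=
      (continuous_rotate e₁ i).comp continuous_snd
    simpa using tendsto_integral_abs_mul_sub le_rfl (h2 i) hK (p := fun _ => 1)
      tendsto_const_nhds
  have h4 : Tendsto (fun ε => ∫ q, |ε * deriv (fun s => f ε s x q) t| ∂dq)
      (𝓝[>] (0 : ℝ)) (𝓝 0) := by simpa using h1.2.2
  have h5 : Tendsto (fun ε : ℝ => ε * ∫ q, |transport e₁ (f ε) t x q
          - 1 / ε * collision ν D (qbar ε) (f ε t x) q| ∂dq) (𝓝[>] (0 : ℝ)) (𝓝 0) := by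
    simpa using hid.mul (heq.trans_tendsto hid)
  have h6 := (h5.add h4).add (tendsto_finsetSum Finset.univ fun i _ => h3 i)
  simp only [add_zero, Finset.sum_const_zero] at h6
  refine squeeze_zero' (Eventually.of_forall fun ε => integral_nonneg fun q => abs_nonneg _) ?_ h6
  filter_upwards [Ioo_mem_nhdsGT hε₀] with ε hε
  obtain ⟨c1, c2, _⟩ := hf.continuous_derivs hε ht x
  exact integral_abs_le_of_remainder hε.1
    (continuous_collision (hf.contDiff_two ε hε t ht x) ν D (qbar ε))
    (hf.continuous_transport hε ht x) c1 c2 (continuous_rotate e₁)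
    fun q => hf.transport_eq hε ht x q

end kinetic

/-! ### Limits of the kinetic family are local equilibria -/

lemma abs_arctan_sub_le (x y : ℝ) : |Real.arctan x - Real.arctan y| ≤ |x - y| := by
  have := Convex.norm_image_sub_le_of_norm_deriv_le (f := Real.arctan) (s := univ) (C := 1)
    (x := y) (y := x) (fun z _ => Real.differentiableAt_arctan z) (fun z _ => ?_) convex_univ
    (mem_univ _) (mem_univ _)
  · simpa using this
  · rw [Real.deriv_arctan, Real.norm_eq_abs, abs_of_pos (by positivity)]
    exact (div_le_one (by positivity)).2 (by nlinarith [sq_nonneg z])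

lemma continuous_invGibbs_uncurry (d : ℝ) :
    Continuous (Function.uncurry fun p q : H1 => invGibbs d p q) := by
  unfold invGibbs rcoord
  simp only [Function.uncurry_def]
  fun_prop

lemma integral_vonMises (d : ℝ) (qbar : H1) :
    0 < ∫ p, gibbs d qbar p ∂dq ∧ ∫ q, vonMises d qbar q ∂dq = 1 := by
  have hc : Continuous (gibbs d qbar) := by unfold gibbs; fun_prop
  have h : 0 < ∫ p, gibbs d qbar p ∂dq := by
    have h0 : ∀ q, 0 ≤ gibbs d qbar q := fun q => (Real.exp_pos _).le
    rw [integral_pos_iff_support_of_nonneg h0 (integrable_of_continuous hc)]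
    have : Function.support (gibbs d qbar) = univ := by
      ext q
      simp [gibbs]
    rw [this]
    simpa [pos_iff_ne_zero] using dq_ne_zero
  refine ⟨h, ?_⟩
  simp only [vonMises]
  rw [integral_div, div_self h.ne']

/-- The limit of a family whose collision terms vanish in the limit is an equilibrium. -/
theorem exists_eq_vonMises_of_tendsto {ν D : ℝ} (hν : 0 < ν) (hD : 0 < D) {g : ℝ → H1 → ℝ}
    {F : H1 → ℝ} (hg : ∀ᶠ ε in 𝓝[>] (0 : ℝ), ContDiffOn ℝ 2 (homExt (g ε)) {0}ᶜ)
    (hg0 : ∀ᶠ ε in 𝓝[>] (0 : ℝ), ∀ q, 0 ≤ g ε q) (hgF : TendstoL1 g F) (qbar : ℝ → H1)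
    (hcol : Tendsto (fun ε => ∫ q, |collision ν D (qbar ε) (g ε) q| ∂dq) (𝓝[>] (0 : ℝ)) (𝓝 0)) :
    ∃ (ρ : ℝ) (p : H1), 0 ≤ ρ ∧ ∀ᵐ q ∂dq, F q = ρ * vonMises (D / ν) p q := by
  set U : Ultrafilter ℝ := Ultrafilter.of (𝓝[>] (0 : ℝ)) with hU
  have hUle : (U : Filter ℝ) ≤ 𝓝[>] (0 : ℝ) := Ultrafilter.of_le _
  obtain ⟨p, -, hp⟩ := isCompact_univ.ultrafilter_le_nhds (U.map qbar) (by simp)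
  have hp : Tendsto qbar U (𝓝 p) := hp
  have hv := vol_pos
  set w := invGibbs (D / ν) with hw
  set a : ℝ → H1 → ℝ := fun ε q => Real.arctan (g ε q * w (qbar ε) q) with ha
  set b : H1 → ℝ := fun q => Real.arctan (F q * w p q) with hb
  have hwc : ∀ p, Continuous (w p) := fun p => continuous_invGibbs _ p
  have hbd : ∀ y, ‖Real.arctan y‖ ≤ Real.pi / 2 := fun y => by
    rw [Real.norm_eq_abs, abs_le]
    exact ⟨(Real.neg_pi_div_two_lt_arctan _).le, (Real.arctan_lt_pi_div_two _).le⟩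
  have hFw : Integrable (fun q => F q * w p q) dq := integrable_mul_continuous hgF.1 (hwc p)
  have hbi : Integrable b dq := by
    refine Integrable.of_bound (Real.continuous_arctan.comp_aestronglyMeasurable
      hFw.aestronglyMeasurable) (Real.pi / 2) (Eventually.of_forall fun q => hbd _)
  have hgw := tendsto_integral_abs_mul_sub hUle hgF (continuous_invGibbs_uncurry (D / ν)) hp
  have hcolU := hcol.mono_left hUle
  set m := vol⁻¹ * ∫ q, b q ∂dq with hm
  have hfin : ∫ q, |b q - m| ∂dq ≤ 0 := by
    refine le_of_forall_pos_le_add fun η' hη' => ?_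
    rw [zero_add]
    set η := η' / (3 * Real.pi * vol) with hηd
    have hη : 0 < η := by positivity
    have hlim : Tendsto (fun ε => 2 * ∫ q, |g ε q * w (qbar ε) q - F q * w p q| ∂dq
        + Real.pi * (3 * η * vol
          + Real.pi / (2 * D * η) * ∫ q, |collision ν D (qbar ε) (g ε) q| ∂dq)) U
        (𝓝 (2 * 0 + Real.pi * (3 * η * vol + Real.pi / (2 * D * η) * 0))) :=
      (hgw.const_mul _).add (((hcolU.const_mul _).const_add _).const_mul _)
    have e : 2 * 0 + Real.pi * (3 * η * vol + Real.pi / (2 * D * η) * 0) = η' := by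
      rw [hηd]; field_simp; ring
    rw [e] at hlim
    refine ge_of_tendsto hlim ?_
    filter_upwards [hUle hg, hUle hgF.2.1] with ε h1 h2
    obtain ⟨X, Y, hXY, hcoll⟩ := collision_eq_of_contDiffOn h1
    have h3 := integral_abs_arctan_sub_average_le hν hD (qbar ε) hXY hη
    have h4 : ∀ q, collision ν D (qbar ε) (g ε) q
      = ∑ k, fluxDeriv ν D (qbar ε) (g ε) X Y k q := fun q => hcoll ν D (qbar ε) q
    simp only [← h4] at h3
    have hac : Continuous (a ε) :=
      Real.continuous_arctan.comp (hXY.continuous.mul (hwc _))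
    have hai : Integrable (a ε) dq := integrable_of_continuous hac
    set m' := vol⁻¹ * ∫ q, a ε q ∂dq with hm'
    have hdi : Integrable (fun q => |g ε q * w (qbar ε) q - F q * w p q|) dq :=
      ((integrable_mul_continuous h2 (hwc _)).sub hFw).abs
    set δ := ∫ q, |g ε q * w (qbar ε) q - F q * w p q| ∂dq with hδ
    have h5 : ∫ q, |a ε q - b q| ∂dq ≤ δ :=
      integral_mono (hai.sub hbi).abs hdi fun q => abs_arctan_sub_le _ _
    have h6 : vol * |m' - m| ≤ δ := by
      have : vol * (m' - m) = ∫ q, (a ε q - b q) ∂dq := by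
        rw [integral_sub hai hbi, hm, hm']
        field_simp
      have h7 : vol * |m' - m| = |vol * (m' - m)| := by rw [abs_mul, abs_of_pos hv]
      rw [h7, this]
      exact abs_integral_le_integral_abs.trans h5
    have hi1 : Integrable (fun q => |a ε q - b q|) dq := (hai.sub hbi).abs
    have hi2 : Integrable (fun q => |a ε q - m'|) dq := (hai.sub (integrable_const _)).abs
    calc ∫ q, |b q - m| ∂dq ≤ ∫ q, (|a ε q - b q| + |a ε q - m'| + |m' - m|) ∂dq := by
          refine integral_mono (hbi.sub (integrable_const _)).abs
            ((hi1.add hi2).add (integrable_const _)) fun q => ?_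
          have e : b q - m = -(a ε q - b q) + (a ε q - m') + (m' - m) := by ring
          simp only
          rw [e]
          refine (abs_add_le _ _).trans (add_le_add ((abs_add_le _ _).trans ?_) le_rfl)
          rw [abs_neg]
      _ = ∫ q, |a ε q - b q| ∂dq + ∫ q, |a ε q - m'| ∂dq + vol * |m' - m| := by
          have hi12 : Integrable (fun q => |a ε q - b q| + |a ε q - m'|) dq := hi1.add hi2
          rw [integral_add hi12 (integrable_const _), integral_add hi1 hi2, integral_const]
          rfl
      _ ≤ _ := by linarith
  have hae : ∀ᵐ q ∂dq, b q = m := by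
    have h0 : ∫ q, |b q - m| ∂dq = 0 :=
      le_antisymm hfin (integral_nonneg fun q => abs_nonneg _)
    have hi : Integrable (fun q => |b q - m|) dq := (hbi.sub (integrable_const _)).abs
    rw [integral_eq_zero_iff_of_nonneg (fun q => abs_nonneg _) hi] at h0
    filter_upwards [h0] with q hq
    simpa [sub_eq_zero] using hq
  obtain ⟨hZ, hone⟩ := integral_vonMises (D / ν) p
  set Z := ∫ q, gibbs (D / ν) p q ∂dq with hZd
  set κ := Real.tan m * Z * Real.exp (2 / (D / ν) * (1 / 4)) with hκ
  have hFeq : ∀ᵐ q ∂dq, F q = κ * vonMises (D / ν) p q := by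
    filter_upwards [hae] with q hq
    have h1 : F q * w p q = Real.tan m := by rw [← hq, hb, Real.tan_arctan]
    have h2 : w p q * (Real.exp (2 / (D / ν) * (1 / 4)) * gibbs (D / ν) p q) = 1 := by
      rw [hw, invGibbs, gibbs, ← Real.exp_add, ← Real.exp_add, Real.exp_eq_one_iff, rcoord]
      ring
    calc F q = F q * w p q * (Real.exp (2 / (D / ν) * (1 / 4)) * gibbs (D / ν) p q) := by
          rw [mul_assoc, h2, mul_one]
      _ = _ := by
          rw [h1, hκ, vonMises, ← hZd]
          field_simp
  refine ⟨κ, p, ?_, hFeq⟩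
  have hκF : κ = ∫ q, F q ∂dq := by
    rw [integral_congr_ae hFeq, integral_const_mul, hone, mul_one]
  rw [hκF]
  have hlim := tendsto_integral_mul le_rfl hgF (K := fun _ _ => 1) continuous_const
    (p := fun _ => 1) tendsto_const_nhds
  simp only [mul_one] at hlim
  refine ge_of_tendsto hlim ?_
  filter_upwards [hg0] with ε hε
  exact integral_nonneg hε

/-! ### Existence of the profile of the collision invariants -/

/-- The weight `(1 - r²)^{3/2} exp (2 r² / d)` of the zero order terms of the profile equation. -/
def wgt (d r : ℝ) : ℝ := (1 - r ^ 2) ^ (3 / 2 : ℝ) * Real.exp (2 * r ^ 2 / d)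

/-- The weight `(1 - r²)^{5/2} exp (2 r² / d)` of the second order term of the profile equation. -/
def pwgt (d r : ℝ) : ℝ := (1 - r ^ 2) ^ (5 / 2 : ℝ) * Real.exp (2 * r ^ 2 / d)

/-- The zero order coefficient `4 r² / d + 3` of the profile equation. -/
def pot (d r : ℝ) : ℝ := 4 / d * r ^ 2 + 3

lemma continuous_wgt (d : ℝ) : Continuous (wgt d) := by
  unfold wgt
  exact ((Real.continuous_rpow_const (by norm_num)).comp (by fun_prop)).mul (by fun_prop)

lemma continuous_pwgt (d : ℝ) : Continuous (pwgt d) := by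
  unfold pwgt
  exact ((Real.continuous_rpow_const (by norm_num)).comp (by fun_prop)).mul (by fun_prop)

lemma continuous_pot (d : ℝ) : Continuous (pot d) := by unfold pot; fun_prop

lemma one_sub_sq_pos {r : ℝ} (hr : r ∈ Ioo (-1 : ℝ) 1) : 0 < 1 - r ^ 2 := by
  nlinarith [hr.1, hr.2]

lemma wgt_pos (d : ℝ) {r : ℝ} (hr : r ∈ Ioo (-1 : ℝ) 1) : 0 < wgt d r :=
  mul_pos (Real.rpow_pos_of_pos (one_sub_sq_pos hr) _) (Real.exp_pos _)

lemma pwgt_pos (d : ℝ) {r : ℝ} (hr : r ∈ Ioo (-1 : ℝ) 1) : 0 < pwgt d r :=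
  mul_pos (Real.rpow_pos_of_pos (one_sub_sq_pos hr) _) (Real.exp_pos _)

lemma pwgt_eq (d : ℝ) {r : ℝ} (hr : r ∈ Ioo (-1 : ℝ) 1) : pwgt d r = (1 - r ^ 2) * wgt d r := by
  have h := one_sub_sq_pos hr
  rw [pwgt, wgt, ← mul_assoc, show (5 / 2 : ℝ) = 1 + 3 / 2 by norm_num,
    Real.rpow_add h, Real.rpow_one]

lemma wgt_neg (d r : ℝ) : wgt d (-r) = wgt d r := by simp [wgt]

lemma pwgt_neg (d r : ℝ) : pwgt d (-r) = pwgt d r := by simp [pwgt]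

lemma pot_neg (d r : ℝ) : pot d (-r) = pot d r := by simp [pot]

lemma pot_pos {d : ℝ} (hd : 0 < d) (r : ℝ) : 0 < pot d r := by unfold pot; positivity

lemma pot_le {d : ℝ} (hd : 0 < d) {r : ℝ} (hr : r ∈ Icc (0 : ℝ) 1) : pot d r ≤ 4 / d + 3 := by
  have : r ^ 2 ≤ 1 := by nlinarith [hr.1, hr.2]
  have h4 : 0 < 4 / d := by positivity
  unfold pot
  nlinarith

/-- The tails of the weight are dominated by the leading coefficient. This makes the Volterra
equation for the solutions that are regular at `r = 1` an equation with a bounded kernel. -/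
lemma abs_integral_wgt_le {d : ℝ} (hd : 0 < d) {y : ℝ → ℝ} {B s : ℝ} (hs : s ∈ Ico (0 : ℝ) 1)
    (hy : ∀ τ ∈ Icc s 1, |y τ| ≤ B) :
    |(∫ τ in s..1, wgt d τ * y τ) / pwgt d s| ≤ Real.exp (2 / d) * B := by
  have hs' : s ∈ Ioo (-1 : ℝ) 1 := ⟨by linarith [hs.1], hs.2⟩
  have hP := pwgt_pos d hs'
  have hB : 0 ≤ B := (abs_nonneg _).trans (hy s ⟨le_rfl, hs.2.le⟩)
  have h1s := one_sub_sq_pos hs'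
  rw [abs_div, abs_of_pos hP, div_le_iff₀ hP]
  have h1 : ‖∫ τ in s..1, wgt d τ * y τ‖
      ≤ (1 - s ^ 2) ^ (3 / 2 : ℝ) * Real.exp (2 / d) * B * |1 - s| := by
    refine intervalIntegral.norm_integral_le_of_norm_le_const fun τ hτ => ?_
    rw [uIoc_of_le hs.2.le] at hτ
    have hτ2 : τ ^ 2 ≤ 1 := by nlinarith [hτ.1, hτ.2, hs.1]
    have hsτ : s ^ 2 ≤ τ ^ 2 := by nlinarith [hτ.1, hτ.2, hs.1]
    rw [norm_mul, Real.norm_eq_abs, Real.norm_eq_abs]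
    refine mul_le_mul ?_ (hy τ ⟨hτ.1.le, hτ.2⟩) (abs_nonneg _) (by positivity)
    rw [wgt, abs_mul, abs_of_nonneg (Real.rpow_nonneg (by linarith) _),
      abs_of_pos (Real.exp_pos _)]
    have e1 : (1 - τ ^ 2) ^ (3 / 2 : ℝ) ≤ (1 - s ^ 2) ^ (3 / 2 : ℝ) :=
      Real.rpow_le_rpow (by linarith) (by linarith) (by norm_num)
    have e2 : Real.exp (2 * τ ^ 2 / d) ≤ Real.exp (2 / d) := by
      rw [Real.exp_le_exp]
      gcongr
      linarith
    exact mul_le_mul e1 e2 (Real.exp_pos _).le (by positivity)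
  rw [Real.norm_eq_abs, abs_of_pos (by linarith [hs.2] : (0 : ℝ) < 1 - s)] at h1
  refine h1.trans ?_
  rw [pwgt_eq d hs', wgt]
  have e3 : 1 ≤ Real.exp (2 * s ^ 2 / d) := Real.one_le_exp (by positivity)
  have e4 : 1 - s ≤ 1 - s ^ 2 := by nlinarith [hs.1, hs.2]
  calc (1 - s ^ 2) ^ (3 / 2 : ℝ) * Real.exp (2 / d) * B * (1 - s)
      = Real.exp (2 / d) * B * ((1 - s) * ((1 - s ^ 2) ^ (3 / 2 : ℝ) * 1)) := by ring
    _ ≤ Real.exp (2 / d) * B *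
        ((1 - s ^ 2) * ((1 - s ^ 2) ^ (3 / 2 : ℝ) * Real.exp (2 * s ^ 2 / d))) := by gcongr

lemma continuous_integral_wgt (d : ℝ) {y : ℝ → ℝ} (hy : Continuous y) :
    Continuous fun s => ∫ τ in s..1, wgt d τ * y τ := by
  have hc : Continuous fun τ => wgt d τ * y τ := (continuous_wgt d).mul hy
  have : (fun s => ∫ τ in s..1, wgt d τ * y τ) = fun s => -∫ τ in (1 : ℝ)..s, wgt d τ * y τ := by
    ext s; rw [intervalIntegral.integral_symm]
  rw [this]
  exact (intervalIntegral.continuous_primitive (fun a b => hc.intervalIntegrable a b) 1).neg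

lemma integrableOn_volterra {d : ℝ} (hd : 0 < d) {y : ℝ → ℝ} (hy : Continuous y) :
    IntegrableOn (fun s => (∫ τ in s..1, wgt d τ * y τ) / pwgt d s) (Icc 0 1) := by
  obtain ⟨B, hB⟩ := (isCompact_Icc (a := (0 : ℝ)) (b := 1)).exists_bound_of_continuousOn
    hy.continuousOn
  rw [integrableOn_Icc_iff_integrableOn_Ioo]
  refine Measure.integrableOn_of_bounded (M := Real.exp (2 / d) * B) (by simp) ?_ ?_
  · exact ((continuous_integral_wgt d hy).measurable.div
      (continuous_pwgt d).measurable).aestronglyMeasurable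
  · filter_upwards [ae_restrict_mem measurableSet_Ioo] with s hs
    exact abs_integral_wgt_le hd ⟨hs.1.le, hs.2⟩ fun τ hτ => hB τ ⟨hs.1.le.trans hτ.1, hτ.2⟩

lemma intervalIntegrable_volterra {d : ℝ} (hd : 0 < d) {y : ℝ → ℝ} (hy : Continuous y) {a b : ℝ}
    (ha : a ∈ Icc (0 : ℝ) 1) (hb : b ∈ Icc (0 : ℝ) 1) :
    IntervalIntegrable (fun s => (∫ τ in s..1, wgt d τ * y τ) / pwgt d s) volume a b := by
  rw [intervalIntegrable_iff]
  refine (integrableOn_volterra hd hy).mono_set (uIoc_subset_uIcc.trans ?_)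
  exact uIcc_subset_Icc ha hb

/-- Solutions of the profile equation, with `b` times its right-hand side, that are regular at
`r = 1` and have the value `c` there. The Volterra operator is a contraction in the norm weighted
by `exp (l (1 - r))`. -/
lemma exists_volterra_solution {d : ℝ} (hd : 0 < d) (b c : ℝ) :
    ∃ y : ℝ → ℝ, Continuous y ∧ ∀ r ∈ Icc (0 : ℝ) 1,
      y r = c + ∫ s in r..1, (∫ τ in s..1, wgt d τ * (pot d τ * y τ + b * τ)) / pwgt d s := by
  set K := Real.exp (2 / d) * (4 / d + 3) with hK
  have hKpos : 0 < K := by positivity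
  set l := 2 * K with hl
  have hlpos : 0 < l := by positivity
  set ext : C(Icc (0 : ℝ) 1, ℝ) → ℝ → ℝ := fun k r =>
    Real.exp (l * (1 - r)) * IccExtend zero_le_one k r with hext
  have hextc : ∀ k, Continuous (ext k) := fun k => by
    have : Continuous (IccExtend zero_le_one k : ℝ → ℝ) := k.continuous.Icc_extend'
    exact (by fun_prop : Continuous fun r : ℝ => Real.exp (l * (1 - r))).mul this
  have hrhs : ∀ k, Continuous fun τ => pot d τ * ext k τ + b * τ := fun k =>
    ((continuous_pot d).mul (hextc k)).add (by fun_prop)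
  have hTc : ∀ k : C(Icc (0 : ℝ) 1, ℝ), Continuous fun r : Icc (0 : ℝ) 1 =>
      Real.exp (-(l * (1 - (r : ℝ)))) * (c + ∫ s in (r : ℝ)..1,
        (∫ τ in s..1, wgt d τ * (pot d τ * ext k τ + b * τ)) / pwgt d s) := fun k => by
    refine Continuous.mul (by fun_prop) (continuous_const.add ?_)
    have := intervalIntegral.continuousOn_primitive_interval_left (a := 0) (b := 1)
      (f := fun s => (∫ τ in s..1, wgt d τ * (pot d τ * ext k τ + b * τ)) / pwgt d s)
      (μ := volume) (by rw [uIcc_of_le zero_le_one]; exact integrableOn_volterra hd (hrhs k))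
    rw [uIcc_of_le zero_le_one] at this
    exact continuousOn_iff_continuous_domRestrict.1 this
  set Tm : C(Icc (0 : ℝ) 1, ℝ) → C(Icc (0 : ℝ) 1, ℝ) := fun k => ⟨_, hTc k⟩ with hTm
  have hcontr : ContractingWith (1 / 2) Tm := by
    refine ⟨by norm_num, LipschitzWith.of_dist_le_mul fun k k' => ?_⟩
    rw [ContinuousMap.dist_le (by positivity)]
    intro r
    set M := dist k k' with hM
    have hM0 : 0 ≤ M := dist_nonneg
    have hz : Continuous fun τ => pot d τ * (ext k τ - ext k' τ) :=
      (continuous_pot d).mul ((hextc k).sub (hextc k'))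
    have hr : (r : ℝ) ∈ Icc (0 : ℝ) 1 := r.2
    have h1mem : (1 : ℝ) ∈ Icc (0 : ℝ) 1 := ⟨zero_le_one, le_rfl⟩
    have hdiff : Tm k r - Tm k' r = Real.exp (-(l * (1 - (r : ℝ)))) * ∫ s in (r : ℝ)..1,
        (∫ τ in s..1, wgt d τ * (pot d τ * (ext k τ - ext k' τ))) / pwgt d s := by
      simp only [hTm, ContinuousMap.coe_mk]
      rw [← mul_sub, add_sub_add_left_eq_sub, ← intervalIntegral.integral_sub
        (intervalIntegrable_volterra hd (hrhs k) hr h1mem)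
        (intervalIntegrable_volterra hd (hrhs k') hr h1mem)]
      congr 1
      refine intervalIntegral.integral_congr fun s _ => ?_
      rw [← sub_div, ← intervalIntegral.integral_sub
        (((continuous_wgt d).fun_mul (hrhs k)).intervalIntegrable _ _)
        (((continuous_wgt d).fun_mul (hrhs k')).intervalIntegrable _ _)]
      congr 1
      refine intervalIntegral.integral_congr fun τ _ => ?_
      ring
    have hle : |∫ s in (r : ℝ)..1,
        (∫ τ in s..1, wgt d τ * (pot d τ * (ext k τ - ext k' τ))) / pwgt d s|
        ≤ ∫ s in (r : ℝ)..1, K * M * Real.exp (l * (1 - s)) := by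
      rw [← Real.norm_eq_abs]
      refine intervalIntegral.norm_integral_le_of_norm_le hr.2 ?_
        ((by fun_prop : Continuous fun s : ℝ => K * M * Real.exp (l * (1 - s))).intervalIntegrable
          _ _)
      have : ∀ᵐ s : ℝ, s ≠ 1 := by simp [ae_iff]
      filter_upwards [this] with s hs1 hs
      have hs' : s ∈ Ico (0 : ℝ) 1 := ⟨hr.1.trans hs.1.le, lt_of_le_of_ne hs.2 hs1⟩
      rw [Real.norm_eq_abs]
      refine (abs_integral_wgt_le hd hs' (B := (4 / d + 3) * (Real.exp (l * (1 - s)) * M))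
        fun τ hτ => ?_).trans (le_of_eq ?_)
      · have hτ' : τ ∈ Icc (0 : ℝ) 1 := ⟨hs'.1.trans hτ.1, hτ.2⟩
        rw [abs_mul, abs_of_pos (pot_pos hd τ)]
        refine mul_le_mul (pot_le hd hτ') ?_ (abs_nonneg _) (by positivity)
        simp only [hext]
        rw [← mul_sub, abs_mul, abs_of_pos (Real.exp_pos _)]
        refine mul_le_mul ?_ ?_ (abs_nonneg _) (Real.exp_pos _).le
        · rw [Real.exp_le_exp]
          gcongr
          exact hτ.1
        · rw [IccExtend_of_mem _ _ hτ', IccExtend_of_mem _ _ hτ', ← Real.dist_eq]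
          exact ContinuousMap.dist_apply_le_dist _
      · rw [hK]; ring
    have hint : ∫ s in (r : ℝ)..1, K * M * Real.exp (l * (1 - s))
        = K * M * ((Real.exp (l * (1 - (r : ℝ))) - 1) / l) := by
      rw [intervalIntegral.integral_eq_sub_of_hasDerivAt
        (f := fun s => -(K * M * (Real.exp (l * (1 - s)) / l)))]
      · simp
        ring
      · intro s _
        have h1 : HasDerivAt (fun s : ℝ => l * (1 - s)) (-l) s := by
          simpa using ((hasDerivAt_id s).const_sub 1).const_mul l
        have h2 := ((h1.exp.div_const l).const_mul (K * M)).neg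
        refine h2.congr_deriv ?_
        field_simp
      · exact (by fun_prop : Continuous fun s : ℝ => K * M * Real.exp (l * (1 - s))
          ).intervalIntegrable _ _
    rw [Real.dist_eq, hdiff, abs_mul, abs_of_pos (Real.exp_pos _)]
    calc _ ≤ Real.exp (-(l * (1 - (r : ℝ)))) * (K * M * ((Real.exp (l * (1 - (r : ℝ))) - 1) / l)) := by
          rw [← hint]
          gcongr
      _ ≤ Real.exp (-(l * (1 - (r : ℝ)))) * (K * M * (Real.exp (l * (1 - (r : ℝ))) / l)) := by
          gcongr
          linarith
      _ = K * M / l * (Real.exp (-(l * (1 - (r : ℝ)))) * Real.exp (l * (1 - (r : ℝ)))) := by ring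
      _ = _ := by
          rw [← Real.exp_add, neg_add_cancel, Real.exp_zero, hl]
          push_cast
          field_simp
  have hfix := hcontr.fixedPoint_isFixedPt
  set k := ContractingWith.fixedPoint Tm hcontr with hk
  refine ⟨ext k, hextc k, fun r hr => ?_⟩
  have h1 : k ⟨r, hr⟩ = Tm k ⟨r, hr⟩ := by rw [hfix.eq]
  have h2 : ext k r = Real.exp (l * (1 - r)) * k ⟨r, hr⟩ := by
    simp only [hext]
    rw [IccExtend_of_mem _ _ hr]
  rw [h2, h1]
  simp only [hTm, ContinuousMap.coe_mk]
  rw [← mul_assoc, ← Real.exp_add, add_neg_cancel, Real.exp_zero, one_mul]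

/-- The homogeneous solution that is regular at `r = 1` does not vanish at `r = 0`. -/
lemma volterra_solution_pos {d : ℝ} (hd : 0 < d) {y : ℝ → ℝ} (hyc : Continuous y)
    (hy : ∀ r ∈ Icc (0 : ℝ) 1,
      y r = 1 + ∫ s in r..1, (∫ τ in s..1, wgt d τ * (pot d τ * y τ + 0 * τ)) / pwgt d s) :
    0 < y 0 := by
  by_contra hneg
  push Not at hneg
  obtain ⟨r, ⟨hr, hyr⟩, hmax⟩ := (isCompact_Icc.inter_right
    (isClosed_le hyc continuous_const : IsClosed {r : ℝ | y r ≤ 0})).exists_isGreatest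
      ⟨(0 : ℝ), ⟨le_rfl, zero_le_one⟩, hneg⟩
  have hpos : ∀ s ∈ Icc (0 : ℝ) 1, r < s → 0 < y s := fun s hs hrs => by
    by_contra h
    push Not at h
    exact absurd (hmax ⟨hs, h⟩) (not_le.2 hrs)
  have h1 := hy r hr
  have h2 : 0 ≤ ∫ s in r..1, (∫ τ in s..1, wgt d τ * (pot d τ * y τ + 0 * τ)) / pwgt d s := by
    refine intervalIntegral.integral_nonneg_of_ae_restrict hr.2 ?_
    rw [← restrict_Ioo_eq_restrict_Icc]
    filter_upwards [ae_restrict_mem measurableSet_Ioo] with s hs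
    have hs0 : 0 ≤ s := hr.1.trans hs.1.le
    refine div_nonneg (intervalIntegral.integral_nonneg hs.2.le fun τ hτ => ?_)
      (pwgt_pos d ⟨by linarith, hs.2⟩).le
    have hτ1 : 0 ≤ 1 - τ ^ 2 := by nlinarith [hτ.1, hτ.2]
    have := (hpos τ ⟨hs0.trans hτ.1, hτ.2⟩ (hs.1.trans_le hτ.1)).le
    have hw : 0 ≤ wgt d τ := mul_nonneg (Real.rpow_nonneg hτ1 _) (Real.exp_pos _).le
    have hp := (pot_pos hd τ).le
    simp only [zero_mul, add_zero]
    positivity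
  have : y r ≤ 0 := hyr
  linarith

/-- The second derivative of a solution with the value `y` and the derivative `y'` at `r` of the
profile equation, divided by `(1 - r²)^{3/2} exp (2 r² / d)`. -/
def profileSnd (d r y y' : ℝ) : ℝ :=
  (pot d r * y + r + 5 * r * y' - 4 / d * r * (1 - r ^ 2) * y') / (1 - r ^ 2)

/-- A profile `h` with the derivative `h'`, with the regularity up to the boundary that is needed to
use it in the collision invariants. -/
structure IsRegularProfile (d : ℝ) (h h' : ℝ → ℝ) : Prop where
  continuous : Continuous h
  odd : ∀ r, h (-r) = -h r
  bounded : ∃ C, ∀ r ∈ Ioo (-1 : ℝ) 1, |h' r| ≤ C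
  hasDerivAt : ∀ r ∈ Ioo (-1 : ℝ) 1, HasDerivAt h (h' r) r
  hasDerivAt_snd : ∀ r ∈ Ioo (-1 : ℝ) 1, HasDerivAt h' (profileSnd d r (h r) (h' r)) r

lemma hasDerivAt_pwgt (d : ℝ) {r : ℝ} (hr : r ∈ Ioo (-1 : ℝ) 1) :
    HasDerivAt (pwgt d) (-5 * r * wgt d r + 4 / d * r * pwgt d r) r := by
  have h0 := one_sub_sq_pos hr
  have h1 : HasDerivAt (fun r : ℝ => 1 - r ^ 2) (-(2 * r)) r := by
    simpa using (hasDerivAt_pow 2 r).const_sub 1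
  have h2 := h1.rpow_const (p := 5 / 2) (Or.inl h0.ne')
  have h3 : HasDerivAt (fun r : ℝ => 2 * r ^ 2 / d) (2 * (2 * r) / d) r := by
    simpa using ((hasDerivAt_pow 2 r).const_mul 2).div_const d
  refine (h2.mul h3.exp).congr_deriv ?_
  rw [wgt, pwgt, show (5 / 2 - 1 : ℝ) = 3 / 2 by norm_num]
  ring

theorem exists_isRegularProfile {d : ℝ} (hd : 0 < d) : ∃ h h' : ℝ → ℝ, IsRegularProfile d h h' := by
  obtain ⟨y₁, hy₁c, hy₁⟩ := exists_volterra_solution hd 1 0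
  obtain ⟨y₀, hy₀c, hy₀⟩ := exists_volterra_solution hd 0 1
  have hpos := volterra_solution_pos hd hy₀c hy₀
  have h1mem : (1 : ℝ) ∈ Icc (0 : ℝ) 1 := ⟨zero_le_one, le_rfl⟩
  have h0mem : (0 : ℝ) ∈ Icc (0 : ℝ) 1 := ⟨le_rfl, zero_le_one⟩
  -- the multiple of the homogeneous solution is chosen to make the odd extension continuous
  set c := -(y₁ 0 / y₀ 0) with hc
  set y : ℝ → ℝ := fun r => y₁ r + c * y₀ r with hy
  have hyc : Continuous y := by fun_prop
  have hy0 : y 0 = 0 := by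
    simp only [hy, hc]; field_simp; ring
  set g : ℝ → ℝ := fun τ => pot d τ * y τ + τ with hg
  have hgc : Continuous g := ((continuous_pot d).mul hyc).add continuous_id
  have hwg : Continuous fun τ => wgt d τ * g τ := (continuous_wgt d).mul hgc
  set J : ℝ → ℝ := fun s => (∫ τ in s..1, wgt d τ * g τ) / pwgt d s with hJ
  have hJi : ∀ {a b : ℝ}, a ∈ Icc (0 : ℝ) 1 → b ∈ Icc (0 : ℝ) 1 → IntervalIntegrable J volume a b :=
    fun ha hb => intervalIntegrable_volterra hd hgc ha hb
  have hyJ : ∀ r ∈ Icc (0 : ℝ) 1, y r = c + ∫ s in r..1, J s := by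
    intro r hr
    have hc1 : Continuous fun τ => pot d τ * y₁ τ + 1 * τ :=
      ((continuous_pot d).mul hy₁c).add (by fun_prop)
    have hc0 : Continuous fun τ => pot d τ * y₀ τ + 0 * τ :=
      ((continuous_pot d).mul hy₀c).add (by fun_prop)
    simp only [hy]
    rw [hy₁ r hr, hy₀ r hr, zero_add, mul_add, mul_one, add_left_comm,
      ← intervalIntegral.integral_const_mul, ← intervalIntegral.integral_add
      (intervalIntegrable_volterra hd hc1 hr h1mem)
      ((intervalIntegrable_volterra hd hc0 hr h1mem).const_mul c)]
    congr 1
    refine intervalIntegral.integral_congr fun s _ => ?_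
    simp only [hJ]
    rw [← mul_div_assoc, ← add_div, ← intervalIntegral.integral_const_mul,
      ← intervalIntegral.integral_add
      (((continuous_wgt d).fun_mul hc1).intervalIntegrable _ _)
      ((((continuous_wgt d).fun_mul hc0).intervalIntegrable _ _).const_mul c)]
    congr 1
    refine intervalIntegral.integral_congr fun τ _ => ?_
    simp only [hg, hy]
    ring
  -- the odd extension of `y`, and its flux
  set h : ℝ → ℝ := fun r => y (max r 0) - y (max (-r) 0) with hh
  have hhc : Continuous h := by fun_prop
  have hodd : ∀ r, h (-r) = -h r := fun r => by simp [hh]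
  have hhy : ∀ r, 0 ≤ r → h r = y r := fun r hr => by
    simp only [hh]
    rw [max_eq_left hr, max_eq_right (by linarith), hy0, sub_zero]
  set G : ℝ → ℝ := fun τ => wgt d τ * (pot d τ * h τ + τ) with hG
  have hGc : Continuous G := (continuous_wgt d).mul (((continuous_pot d).mul hhc).add continuous_id)
  have hGodd : ∀ r, G (-r) = -G r := fun r => by
    simp only [hG, hodd, wgt_neg, pot_neg]; ring
  set Φ : ℝ → ℝ := fun r => -(∫ τ in (0 : ℝ)..1, G τ) + ∫ τ in (0 : ℝ)..r, G τ with hΦ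
  have hΦd : ∀ r, HasDerivAt Φ (G r) r := fun r =>
    (intervalIntegral.integral_hasDerivAt_right (hGc.intervalIntegrable _ _)
      (hGc.stronglyMeasurableAtFilter _ _) hGc.continuousAt).const_add _
  have hΦe : ∀ r, Φ (-r) = Φ r := fun r => by
    simp only [hΦ]
    congr 1
    have := intervalIntegral.integral_comp_neg (a := 0) (b := r) (f := G)
    rw [neg_zero] at this
    rw [intervalIntegral.integral_symm, ← this]
    simp only [hGodd, intervalIntegral.integral_neg, neg_neg]
  have hΦJ : ∀ r ∈ Icc (0 : ℝ) 1, Φ r / pwgt d r = -J r := fun r hr => by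
    have e : ∫ τ in r..1, wgt d τ * g τ = ∫ τ in r..1, G τ := by
      refine intervalIntegral.integral_congr fun τ hτ => ?_
      rw [uIcc_of_le hr.2] at hτ
      simp only [hG, hg]
      rw [hhy τ (hr.1.trans hτ.1)]
    have e2 : Φ r = -∫ τ in r..1, G τ := by
      simp only [hΦ]
      rw [← intervalIntegral.integral_add_adjacent_intervals (hGc.intervalIntegrable 0 r)
        (hGc.intervalIntegrable r 1)]
      ring
    simp only [hJ]
    rw [e, e2, neg_div]
  have hPne : ∀ r ∈ Ioo (-1 : ℝ) 1, pwgt d r ≠ 0 := fun r hr => (pwgt_pos d hr).ne'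
  set h' : ℝ → ℝ := fun r => Φ r / pwgt d r with hh'
  have hh'c : ContinuousOn h' (Ioo (-1) 1) :=
    (continuous_iff_continuousAt.2 fun r => (hΦd r).continuousAt).continuousOn.div
      (continuous_pwgt d).continuousOn hPne
  have hpos_int : ∀ r ∈ Ico (0 : ℝ) 1, h r = ∫ s in (0 : ℝ)..r, h' s := fun r hr => by
    have hr' : r ∈ Icc (0 : ℝ) 1 := ⟨hr.1, hr.2.le⟩
    rw [hhy r hr.1, hyJ r hr']
    have e0 := hyJ 0 h0mem
    rw [hy0, ← intervalIntegral.integral_add_adjacent_intervals (hJi h0mem hr') (hJi hr' h1mem)]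
      at e0
    have e1 : ∫ s in (0 : ℝ)..r, h' s = -∫ s in (0 : ℝ)..r, J s := by
      rw [← intervalIntegral.integral_neg]
      refine intervalIntegral.integral_congr fun s hs => ?_
      rw [uIcc_of_le hr.1] at hs
      exact hΦJ s ⟨hs.1, hs.2.trans hr'.2⟩
    rw [e1]
    linarith
  have h'even : ∀ r, h' (-r) = h' r := fun r => by simp only [hh', hΦe, pwgt_neg]
  have hall_int : ∀ r ∈ Ioo (-1 : ℝ) 1, h r = ∫ s in (0 : ℝ)..r, h' s := fun r hr => by
    rcases le_or_gt 0 r with h0 | h0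
    · exact hpos_int r ⟨h0, hr.2⟩
    · have e := hpos_int (-r) ⟨by linarith, by linarith [hr.1]⟩
      have := intervalIntegral.integral_comp_neg (a := 0) (b := -r) (f := h')
      rw [neg_zero, neg_neg] at this
      simp only [h'even] at this
      rw [hodd, this, intervalIntegral.integral_symm] at e
      linarith
  have hder : ∀ r ∈ Ioo (-1 : ℝ) 1, HasDerivAt h (h' r) r := fun r hr => by
    have h0 : (0 : ℝ) ∈ Ioo (-1 : ℝ) 1 := ⟨by norm_num, by norm_num⟩
    have hsub : uIcc 0 r ⊆ Ioo (-1 : ℝ) 1 := (convex_Ioo _ _).ordConnected.uIcc_subset h0 hr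
    have := intervalIntegral.integral_hasDerivAt_right (a := 0) (b := r) (f := h')
      ((hh'c.mono hsub).intervalIntegrable)
      (hh'c.stronglyMeasurableAtFilter isOpen_Ioo r hr) (hh'c.continuousAt (isOpen_Ioo.mem_nhds hr))
    refine this.congr_of_eventuallyEq ?_
    filter_upwards [isOpen_Ioo.mem_nhds hr] with s hs using hall_int s hs
  refine ⟨h, h', hhc, hodd, ?_, hder, fun r hr => ?_⟩
  · obtain ⟨B, hB⟩ := (isCompact_Icc (a := (0 : ℝ)) (b := 1)).exists_bound_of_continuousOn
      hgc.continuousOn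
    have hb : ∀ r ∈ Ico (0 : ℝ) 1, |h' r| ≤ Real.exp (2 / d) * B := fun r hr => by
      rw [show h' r = -J r from hΦJ r ⟨hr.1, hr.2.le⟩, abs_neg]
      exact abs_integral_wgt_le hd hr fun τ hτ => hB τ ⟨hr.1.trans hτ.1, hτ.2⟩
    refine ⟨Real.exp (2 / d) * B, fun r hr => ?_⟩
    rcases le_or_gt 0 r with h0 | h0
    · exact hb r ⟨h0, hr.2⟩
    · rw [← h'even]
      exact hb (-r) ⟨by linarith, by linarith [hr.1]⟩
  · have h0 := (one_sub_sq_pos hr).ne'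
    have hW := (wgt_pos d hr).ne'
    refine ((hΦd r).div (hasDerivAt_pwgt d hr) (hPne r hr)).congr_deriv ?_
    simp only [profileSnd, hG, hh', pwgt_eq d hr]
    field_simp
    ring

/-! ### Uniqueness of the profile -/

lemma IsGCIProfile.hasDerivAt {d : ℝ} {h : ℝ → ℝ} (hh : IsGCIProfile d h) :
    (∀ r ∈ Ioo (-1 : ℝ) 1, HasDerivAt h (deriv h r) r) ∧
    ∀ r ∈ Ioo (-1 : ℝ) 1, HasDerivAt (fun s => pwgt d s * deriv h s)
      (wgt d r * (pot d r * h r + r)) r := by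
  have hC := hh.contDiff
  have hC1 : ContDiffOn ℝ 1 (deriv h) (Ioo (-1) 1) :=
    ((contDiffOn_succ_iff_deriv_of_isOpen (n := 1) isOpen_Ioo).1
      (by rw [one_add_one_eq_two]; exact hC)).2.2
  refine ⟨fun r hr => ((hC.differentiableOn (by norm_num)).differentiableAt
    (isOpen_Ioo.mem_nhds hr)).hasDerivAt, fun r hr => ?_⟩
  have h1 : DifferentiableAt ℝ (deriv h) r :=
    (hC1.differentiableOn (by norm_num)).differentiableAt (isOpen_Ioo.mem_nhds hr)
  have h2 : DifferentiableAt ℝ (fun s => pwgt d s * deriv h s) r :=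
    (hasDerivAt_pwgt d hr).differentiableAt.mul h1
  refine h2.hasDerivAt.congr_deriv ?_
  have := hh.ode r hr
  simp only [wgt, pwgt, pot] at this ⊢
  linear_combination this

lemma continuousOn_deriv_of_isGCIProfile {d : ℝ} {h : ℝ → ℝ} (hh : IsGCIProfile d h) :
    ContinuousOn (deriv h) (Ioo (-1) 1) :=
  hh.contDiff.continuousOn_deriv_of_isOpen isOpen_Ioo (by norm_num)

/-- A homogeneous solution in the energy space cannot grow in modulus towards `r = 1`: otherwise its
flux is bounded from below near `1`, and the energy is infinite. -/
lemma mul_deriv_nonpos {d : ℝ} (hd : 0 < d) {w w' : ℝ → ℝ}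
    (hw : ∀ r ∈ Ioo (-1 : ℝ) 1, HasDerivAt w (w' r) r)
    (hw' : ∀ r ∈ Ioo (-1 : ℝ) 1, HasDerivAt (fun s => pwgt d s * w' s) (wgt d r * (pot d r * w r)) r)
    (hint : IntegrableOn (fun r => (1 - r ^ 2) ^ (5 / 2 : ℝ) * w' r ^ 2) (Ioo (-1) 1))
    {r₀ : ℝ} (hr₀ : r₀ ∈ Ioo (-1 : ℝ) 1) : w r₀ * w' r₀ ≤ 0 := by
  by_contra hcon
  push Not at hcon
  have hsub : Ico r₀ 1 ⊆ Ioo (-1 : ℝ) 1 := fun r hr => ⟨hr₀.1.trans_le hr.1, hr.2⟩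
  -- the product of the solution and its flux is nondecreasing
  have hφ : ∀ r ∈ Ioo (-1 : ℝ) 1, HasDerivAt (fun s => pwgt d s * w' s * w s)
      (wgt d r * (pot d r * w r) * w r + pwgt d r * w' r * w' r) r := fun r hr =>
    (hw' r hr).mul (hw r hr)
  have hmono : MonotoneOn (fun s => pwgt d s * w' s * w s) (Ico r₀ 1) := by
    refine monotoneOn_of_hasDerivWithinAt_nonneg (convex_Ico _ _)
      (fun r hr => (hφ r (hsub hr)).continuousAt.continuousWithinAt)
      (fun r hr => (hφ r (hsub (interior_subset hr))).hasDerivWithinAt) fun r hr => ?_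
    have hr' := hsub (interior_subset hr)
    have h1 := (wgt_pos d hr').le
    have h2 := (pwgt_pos d hr').le
    have h3 := (pot_pos hd r).le
    have : wgt d r * (pot d r * w r) * w r + pwgt d r * w' r * w' r
      = wgt d r * pot d r * w r ^ 2 + pwgt d r * w' r ^ 2 := by ring
    rw [this]
    positivity
  have hpos : ∀ r ∈ Ico r₀ 1, 0 < pwgt d r * w' r * w r := fun r hr => by
    refine lt_of_lt_of_le ?_ (hmono ⟨le_rfl, hr₀.2⟩ hr hr.1)
    have := pwgt_pos d hr₀
    have : 0 < pwgt d r₀ * (w r₀ * w' r₀) := by positivity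
    simp only
    linarith
  -- hence the square of the flux is nondecreasing
  have hψ : ∀ r ∈ Ioo (-1 : ℝ) 1, HasDerivAt (fun s => (pwgt d s * w' s) ^ 2)
      (2 * (pwgt d r * w' r) * (wgt d r * (pot d r * w r))) r := fun r hr => by
    have := (hw' r hr).fun_pow 2
    simpa using this
  have hmono2 : MonotoneOn (fun s => (pwgt d s * w' s) ^ 2) (Ico r₀ 1) := by
    refine monotoneOn_of_hasDerivWithinAt_nonneg (convex_Ico _ _)
      (fun r hr => (hψ r (hsub hr)).continuousAt.continuousWithinAt)
      (fun r hr => (hψ r (hsub (interior_subset hr))).hasDerivWithinAt) fun r hr => ?_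
    have hr' := interior_subset hr
    have h1 := (wgt_pos d (hsub hr')).le
    have h3 := (pot_pos hd r).le
    have h4 := (hpos r hr').le
    have : 2 * (pwgt d r * w' r) * (wgt d r * (pot d r * w r))
      = 2 * (wgt d r * pot d r) * (pwgt d r * w' r * w r) := by ring
    rw [this]
    positivity
  set c := (pwgt d r₀ * w' r₀) ^ 2 with hc
  have hcpos : 0 < c := by
    have := hpos r₀ ⟨le_rfl, hr₀.2⟩
    have : pwgt d r₀ * w' r₀ ≠ 0 := fun h => by simp [h] at this
    positivity
  -- the energy density dominates a multiple of `1 / (1 - r)`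
  have hlow : ∀ r ∈ Ico r₀ 1, c * Real.exp (-(4 / d)) / 8 * (1 - r)⁻¹
      ≤ (1 - r ^ 2) ^ (5 / 2 : ℝ) * w' r ^ 2 := fun r hr => by
    have hr' := hsub hr
    have h0 := one_sub_sq_pos hr'
    have h1 : c ≤ (pwgt d r * w' r) ^ 2 := hmono2 ⟨le_rfl, hr₀.2⟩ hr hr.1
    have h1r : 0 < 1 - r := by linarith [hr.2]
    set X := (1 - r ^ 2) ^ (5 / 2 : ℝ) with hX
    have hXpos : 0 < X := Real.rpow_pos_of_pos h0 _
    have hX1 : X ≤ 8 * (1 - r) := by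
      have e1 : X ≤ 1 - r ^ 2 := by
        have := Real.rpow_le_rpow_of_exponent_ge h0 (by nlinarith [sq_nonneg r])
          (show (1 : ℝ) ≤ 5 / 2 by norm_num)
        rwa [Real.rpow_one] at this
      nlinarith [hr'.1, hr'.2]
    have hE : Real.exp (2 * r ^ 2 / d) ^ 2 ≤ Real.exp (4 / d) := by
      rw [← Real.exp_nat_mul, Real.exp_le_exp]
      have : r ^ 2 ≤ 1 := by linarith
      rw [show ((2 : ℕ) : ℝ) * (2 * r ^ 2 / d) = 4 * r ^ 2 / d by push_cast; ring]
      gcongr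
      linarith
    have h2 : (pwgt d r * w' r) ^ 2 = X * Real.exp (2 * r ^ 2 / d) ^ 2 * (X * w' r ^ 2) := by
      simp only [pwgt, hX]; ring
    have h3 : c ≤ 8 * (1 - r) * Real.exp (4 / d) * (X * w' r ^ 2) := by
      rw [h2] at h1
      refine h1.trans ?_
      gcongr
    rw [← div_eq_mul_inv, div_le_iff₀ h1r, Real.exp_neg, div_le_iff₀ (by norm_num),
      ← div_eq_mul_inv, div_le_iff₀ (Real.exp_pos _)]
    linarith
  have hint' : IntegrableOn (fun r : ℝ => (1 - r)⁻¹) (Ioo r₀ 1) := by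
    have h1 : IntegrableOn (fun r => c * Real.exp (-(4 / d)) / 8 * (1 - r)⁻¹) (Ioo r₀ 1) := by
      refine Integrable.mono' (hint.mono_set (Ioo_subset_Ioo_left hr₀.1.le)) ?_ ?_
      · exact (Measurable.const_mul (by fun_prop) _).aestronglyMeasurable
      · filter_upwards [ae_restrict_mem measurableSet_Ioo] with r hr
        have : 0 < 1 - r := by linarith [hr.2]
        rw [Real.norm_eq_abs, abs_of_pos (by positivity)]
        exact hlow r ⟨hr.1.le, hr.2⟩
    have hne : c * Real.exp (-(4 / d)) / 8 ≠ 0 := by positivity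
    have h2 := h1.const_mul (c * Real.exp (-(4 / d)) / 8)⁻¹
    refine h2.congr (Eventually.of_forall fun r => ?_)
    simp only
    rw [← mul_assoc, inv_mul_cancel₀ hne, one_mul]
  have h3 : IntervalIntegrable (fun r : ℝ => (r - 1)⁻¹) volume r₀ 1 := by
    rw [intervalIntegrable_iff_integrableOn_Ioo_of_le hr₀.2.le]
    refine hint'.neg.congr (Eventually.of_forall fun r => ?_)
    simp only [Pi.neg_apply]
    rw [← inv_neg, neg_sub]
  rw [intervalIntegrable_sub_inv_iff] at h3
  rcases h3 with h3 | h3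
  · exact hr₀.2.ne h3
  · exact h3 right_mem_uIcc

theorem IsGCIProfile.eqOn {d : ℝ} (hd : 0 < d) {h k : ℝ → ℝ} (hh : IsGCIProfile d h)
    (hk : IsGCIProfile d k) : EqOn h k (Ioo (-1) 1) := by
  obtain ⟨hh1, hh2⟩ := hh.hasDerivAt
  obtain ⟨hk1, hk2⟩ := hk.hasDerivAt
  set w : ℝ → ℝ := fun r => h r - k r with hw
  set w' : ℝ → ℝ := fun r => deriv h r - deriv k r with hw'
  have h1 : ∀ r ∈ Ioo (-1 : ℝ) 1, HasDerivAt w (w' r) r := fun r hr => (hh1 r hr).sub (hk1 r hr)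
  have h2 : ∀ r ∈ Ioo (-1 : ℝ) 1,
      HasDerivAt (fun s => pwgt d s * w' s) (wgt d r * (pot d r * w r)) r := fun r hr => by
    have := (hh2 r hr).sub (hk2 r hr)
    refine (this.congr_of_eventuallyEq (Eventually.of_forall fun s => ?_)).congr_deriv ?_
    · simp only [hw', Pi.sub_apply]; ring
    · simp only [hw]; ring
  have h3 : IntegrableOn (fun r => (1 - r ^ 2) ^ (5 / 2 : ℝ) * w' r ^ 2) (Ioo (-1) 1) := by
    have hsum := (hh.integrable_deriv_sq.add hk.integrable_deriv_sq).const_mul 2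
    refine Integrable.mono' hsum ?_ ?_
    · refine ContinuousOn.aestronglyMeasurable ?_ measurableSet_Ioo
      refine ContinuousOn.mul ?_ (((continuousOn_deriv_of_isGCIProfile hh).sub
        (continuousOn_deriv_of_isGCIProfile hk)).pow 2)
      exact ((Real.continuous_rpow_const (by norm_num)).comp (by fun_prop)).continuousOn
    · filter_upwards [ae_restrict_mem measurableSet_Ioo] with r hr
      have h0 : 0 ≤ (1 - r ^ 2) ^ (5 / 2 : ℝ) := Real.rpow_nonneg (one_sub_sq_pos hr).le _
      rw [Real.norm_eq_abs, abs_of_nonneg (by positivity)]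
      simp only [hw', Pi.add_apply]
      have : (deriv h r - deriv k r) ^ 2 ≤ 2 * (deriv h r ^ 2 + deriv k r ^ 2) := by
        nlinarith [sq_nonneg (deriv h r + deriv k r)]
      nlinarith
  have hneg : ∀ {r : ℝ}, r ∈ Ioo (-1 : ℝ) 1 → -r ∈ Ioo (-1 : ℝ) 1 := fun hr =>
    ⟨by linarith [hr.2], by linarith [hr.1]⟩
  have hle : ∀ r ∈ Ioo (-1 : ℝ) 1, w r * w' r ≤ 0 := fun r hr => mul_deriv_nonpos hd h1 h2 h3 hr
  -- the reflection `r ↦ -r` preserves the homogeneous equation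
  have hge : ∀ r ∈ Ioo (-1 : ℝ) 1, 0 ≤ w r * w' r := fun r hr => by
    have e1 : ∀ s ∈ Ioo (-1 : ℝ) 1, HasDerivAt (fun s => w (-s)) (-w' (-s)) s := fun s hs => by
      have := (h1 (-s) (hneg hs)).comp s (hasDerivAt_neg s)
      rw [mul_neg_one] at this
      exact this
    have e2 : ∀ s ∈ Ioo (-1 : ℝ) 1, HasDerivAt (fun s => pwgt d s * -w' (-s))
        (wgt d s * (pot d s * w (-s))) s := fun s hs => by
      have := ((h2 (-s) (hneg hs)).comp s (hasDerivAt_neg s)).neg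
      refine (this.congr_of_eventuallyEq (Eventually.of_forall fun u => ?_)).congr_deriv ?_
      · simp [pwgt_neg]
      · simp [wgt_neg, pot_neg]
    have e3 : IntegrableOn (fun s => (1 - s ^ 2) ^ (5 / 2 : ℝ) * (-w' (-s)) ^ 2) (Ioo (-1) 1) := by
      have h4 := (Measure.measurePreserving_neg (volume : Measure ℝ)).integrableOn_comp_preimage
        (Homeomorph.neg ℝ).measurableEmbedding (f := fun r => (1 - r ^ 2) ^ (5 / 2 : ℝ) * w' r ^ 2)
        (s := Ioo (-1) 1)
      have h5 := h4.2 h3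
      have h6 : (Neg.neg : ℝ → ℝ) ⁻¹' Ioo (-1) 1 = Ioo (-1) 1 := by simp
      rw [h6] at h5
      refine h5.congr (Eventually.of_forall fun s => ?_)
      simp
    have := mul_deriv_nonpos hd e1 e2 e3 (hneg hr)
    simp only [neg_neg] at this
    linarith
  intro r hr
  have hzero : HasDerivAt (fun s => pwgt d s * w' s * w s) 0 r := by
    refine (hasDerivAt_const r (0 : ℝ)).congr_of_eventuallyEq ?_
    filter_upwards [isOpen_Ioo.mem_nhds hr] with s hs
    have : w s * w' s = 0 := le_antisymm (hle s hs) (hge s hs)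
    rw [mul_assoc, mul_comm (w' s), this, mul_zero]
  have hd2 := ((h2 r hr).mul (h1 r hr)).unique hzero
  have hW := wgt_pos d hr
  have hP := pwgt_pos d hr
  have hκ := pot_pos hd r
  have e : wgt d r * pot d r * w r ^ 2 + pwgt d r * w' r ^ 2 = 0 := by linarith
  have h4 : 0 ≤ pwgt d r * w' r ^ 2 := by positivity
  have h5 : wgt d r * pot d r * w r ^ 2 ≤ 0 := by linarith
  have h6 : w r ^ 2 ≤ 0 := by
    by_contra hcon
    push Not at hcon
    have : 0 < wgt d r * pot d r * w r ^ 2 := by positivity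
    linarith
  have h7 : w r = 0 := by
    have := le_antisymm h6 (sq_nonneg _)
    simpa using this
  simpa [hw, sub_eq_zero] using h7

/-! ### The regular profile is the profile -/

theorem IsRegularProfile.isGCIProfile {d : ℝ} {h h' : ℝ → ℝ} (hh : IsRegularProfile d h h') :
    IsGCIProfile d h := by
  have hderiv : ∀ r ∈ Ioo (-1 : ℝ) 1, deriv h r = h' r := fun r hr => (hh.hasDerivAt r hr).deriv
  have hev : ∀ r ∈ Ioo (-1 : ℝ) 1, deriv h =ᶠ[𝓝 r] h' := fun r hr => by
    filter_upwards [isOpen_Ioo.mem_nhds hr] with s hs using hderiv s hs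
  have hd2 : ∀ r ∈ Ioo (-1 : ℝ) 1, HasDerivAt (deriv h) (profileSnd d r (h r) (h' r)) r :=
    fun r hr => (hh.hasDerivAt_snd r hr).congr_of_eventuallyEq (hev r hr)
  have hh'c : ContinuousOn h' (Ioo (-1) 1) := fun r hr =>
    (hh.hasDerivAt_snd r hr).continuousAt.continuousWithinAt
  have hsc : ContinuousOn (fun r => profileSnd d r (h r) (h' r)) (Ioo (-1) 1) := by
    unfold profileSnd
    have h1 := (continuous_pot d).continuousOn (s := Ioo (-1 : ℝ) 1)
    have h2 := hh.continuous.continuousOn (s := Ioo (-1 : ℝ) 1)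
    refine ContinuousOn.div (by fun_prop) (by fun_prop) fun r hr => (one_sub_sq_pos hr).ne'
  refine ⟨?_, ?_, ?_, fun r hr => ?_⟩
  · rw [show (2 : WithTop ℕ∞) = 1 + 1 by norm_num, contDiffOn_succ_iff_deriv_of_isOpen isOpen_Ioo]
    refine ⟨fun r hr => (hh.hasDerivAt r hr).differentiableAt.differentiableWithinAt,
      by simp, ?_⟩
    rw [show (1 : WithTop ℕ∞) = 0 + 1 by norm_num, contDiffOn_succ_iff_deriv_of_isOpen isOpen_Ioo]
    refine ⟨fun r hr => (hd2 r hr).differentiableAt.differentiableWithinAt, by simp, ?_⟩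
    rw [contDiffOn_zero]
    exact hsc.congr fun r hr => (hd2 r hr).deriv
  · have : Continuous fun r : ℝ => (1 - r ^ 2) ^ (3 / 2 : ℝ) * h r ^ 2 :=
      ((Real.continuous_rpow_const (by norm_num)).comp (by fun_prop)).mul (hh.continuous.pow 2)
    exact (this.integrableOn_Icc (a := -1) (b := 1)).mono_set Ioo_subset_Icc_self
  · obtain ⟨C, hC⟩ := hh.bounded
    refine Measure.integrableOn_of_bounded (M := C ^ 2) (by simp) ?_ ?_
    · exact ((((Real.continuous_rpow_const (by norm_num)).comp (by fun_prop)).measurable).mul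
        ((measurable_deriv h).pow_const 2)).aestronglyMeasurable
    · filter_upwards [ae_restrict_mem measurableSet_Ioo] with r hr
      have h0 := one_sub_sq_pos hr
      have h1 : (1 - r ^ 2) ^ (5 / 2 : ℝ) ≤ 1 :=
        Real.rpow_le_one h0.le (by nlinarith [sq_nonneg r]) (by norm_num)
      have h2 : 0 ≤ (1 - r ^ 2) ^ (5 / 2 : ℝ) := Real.rpow_nonneg h0.le _
      rw [Real.norm_eq_abs, abs_of_nonneg (by positivity), hderiv r hr]
      have h3 : h' r ^ 2 ≤ C ^ 2 := by
        rw [← sq_abs (h' r)]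
        exact pow_le_pow_left₀ (abs_nonneg _) (hC r hr) 2
      calc _ ≤ 1 * h' r ^ 2 := by gcongr
        _ ≤ C ^ 2 := by linarith
  · have h0 := (one_sub_sq_pos hr).ne'
    have h1 := ((hasDerivAt_pwgt d hr).mul (hd2 r hr)).deriv
    have h2 : deriv (fun s => (1 - s ^ 2) ^ (5 / 2 : ℝ) * Real.exp (2 * s ^ 2 / d) * deriv h s) r
      = (-5 * r * wgt d r + 4 / d * r * pwgt d r) * deriv h r
        + pwgt d r * profileSnd d r (h r) (h' r) := h1
    have h3 : (1 - r ^ 2) ^ (3 / 2 : ℝ) * Real.exp (2 * r ^ 2 / d) = wgt d r := rfl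
    rw [h2, mul_assoc r, h3, hderiv r hr, pwgt_eq d hr]
    simp only [profileSnd, pot]
    field_simp
    ring

/-! ### The weight of the constants -/

lemma cos_half_mem {θ : ℝ} (hθ : θ ∈ Ioo 0 Real.pi) : Real.cos (θ / 2) ∈ Ioo (0 : ℝ) 1 := by
  have hpi := Real.pi_pos
  refine ⟨Real.cos_pos_of_mem_Ioo ⟨by linarith [hθ.1], by linarith [hθ.2]⟩, ?_⟩
  have := Real.cos_lt_cos_of_nonneg_of_le_pi (x := 0) (y := θ / 2) le_rfl (by linarith [hθ.2])
    (by linarith [hθ.1])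
  simpa using this

lemma sin_half_pos {θ : ℝ} (hθ : θ ∈ Ioo 0 Real.pi) : 0 < Real.sin (θ / 2) :=
  Real.sin_pos_of_pos_of_lt_pi (by linarith [hθ.1]) (by linarith [hθ.2, hθ.1])

lemma mFun_eq (d θ : ℝ) :
    mFun d θ = Real.exp (2 / d * (Real.cos (θ / 2) ^ 2 - 1 / 4)) := by
  have h : Real.cos θ = 2 * Real.cos (θ / 2) ^ 2 - 1 := by
    rw [← Real.cos_two_mul]; congr 1; ring
  rw [mFun, h]
  congr 1
  ring

lemma continuous_weightTwo (d : ℝ) {h : ℝ → ℝ} (hh : Continuous h) :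
    Continuous (weightTwo d h) := by
  unfold weightTwo mFun
  fun_prop

lemma weightTwo_congr (d : ℝ) {h k : ℝ → ℝ} (hhk : EqOn h k (Ioo (-1) 1)) :
    EqOn (weightTwo d h) (weightTwo d k) (Ioo 0 Real.pi) := fun θ hθ => by
  have := cos_half_mem hθ
  simp only [weightTwo]
  rw [hhk ⟨by linarith [this.1], this.2⟩]

/-- Up to a constant, the integral of the weight is `-∫ (p h'² + q h²)`, the energy of the profile:
the primitive of the weight plus the boundary term `p h h'` is monotone, and the boundary terms
vanish. -/
theorem IsRegularProfile.integral_weightTwo_ne_zero {d : ℝ} (hd : 0 < d) {h h' : ℝ → ℝ}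
    (hh : IsRegularProfile d h h') : (∫ θ in (0 : ℝ)..Real.pi, weightTwo d h θ) ≠ 0 := by
  intro hzero
  have hpi := Real.pi_pos
  obtain ⟨C, hC⟩ := hh.bounded
  have hcw := continuous_weightTwo d hh.continuous
  have hh0 : h 0 = 0 := by
    have := hh.odd 0
    rw [neg_zero] at this
    linarith
  set c := Real.exp (1 / (2 * d)) / 2 with hc
  set Φ : ℝ → ℝ := fun r => pwgt d r * h' r * h r with hΦ
  set K : ℝ → ℝ := fun θ => Φ (Real.cos (θ / 2)) + c * ∫ u in (0 : ℝ)..θ, weightTwo d h u with hK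
  have hΦd : ∀ r ∈ Ioo (-1 : ℝ) 1, HasDerivAt Φ
      (wgt d r * (pot d r * h r + r) * h r + pwgt d r * h' r ^ 2) r := fun r hr => by
    have h0 := (one_sub_sq_pos hr).ne'
    refine (((hasDerivAt_pwgt d hr).mul (hh.hasDerivAt_snd r hr)).mul
      (hh.hasDerivAt r hr)).congr_deriv ?_
    simp only [profileSnd, Pi.mul_apply, pwgt_eq d hr]
    field_simp
    ring
  have hp1 : pwgt d 1 = 0 := by simp [pwgt]
  have hKd : ∀ θ ∈ Ioo 0 Real.pi, HasDerivAt K (-(1 / 2) * Real.sin (θ / 2) *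
      (wgt d (Real.cos (θ / 2)) * pot d (Real.cos (θ / 2)) * h (Real.cos (θ / 2)) ^ 2
        + pwgt d (Real.cos (θ / 2)) * h' (Real.cos (θ / 2)) ^ 2)) θ := fun θ hθ => by
    have hr := cos_half_mem hθ
    have hr' : Real.cos (θ / 2) ∈ Ioo (-1 : ℝ) 1 := ⟨by linarith [hr.1], hr.2⟩
    have h1 : HasDerivAt (fun θ : ℝ => Real.cos (θ / 2)) (-Real.sin (θ / 2) * (1 / 2)) θ :=
      ((hasDerivAt_id θ).div_const 2).cos
    have h2 := (hΦd _ hr').comp θ h1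
    have h3 : HasDerivAt (fun θ => ∫ u in (0 : ℝ)..θ, weightTwo d h u) (weightTwo d h θ) θ :=
      intervalIntegral.integral_hasDerivAt_right (hcw.intervalIntegrable _ _)
        (hcw.stronglyMeasurableAtFilter _ _) hcw.continuousAt
    refine (h2.add (h3.const_mul c)).congr_deriv ?_
    -- the weight is the source term of the profile equation times `h`
    have h4 : c * weightTwo d h θ = 1 / 2 * Real.sin (θ / 2) *
        (wgt d (Real.cos (θ / 2)) * Real.cos (θ / 2) * h (Real.cos (θ / 2))) := by
      have hs := sin_half_pos hθ
      have e1 : (1 - Real.cos (θ / 2) ^ 2) ^ (3 / 2 : ℝ) = Real.sin (θ / 2) ^ 3 := by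
        rw [← Real.sin_sq, ← Real.rpow_natCast, ← Real.rpow_mul hs.le, ← Real.rpow_natCast]
        norm_num
      have e2 : Real.exp (1 / (2 * d)) * mFun d θ = Real.exp (2 * Real.cos (θ / 2) ^ 2 / d) := by
        rw [mFun_eq, ← Real.exp_add]
        congr 1
        field_simp
        ring
      rw [weightTwo, wgt, e1, ← e2, hc]
      ring
    rw [h4]
    ring
  have hΦc : ContinuousOn (fun θ => Φ (Real.cos (θ / 2))) (Icc 0 Real.pi) := by
    have hΦ1 : ContinuousOn Φ (Icc 0 1) := by
      intro r hr
      rcases eq_or_lt_of_le hr.2 with h1 | h1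
      · -- at `r = 1` the coefficient `p` vanishes and the other factors are bounded
        have hlim : Tendsto (fun s => C * |pwgt d s * h s|) (𝓝[Icc 0 1] r) (𝓝 0) := by
          have hc : Continuous fun s => C * |pwgt d s * h s| :=
            continuous_const.mul ((continuous_pwgt d).mul hh.continuous).abs
          have := (hc.tendsto r).mono_left (nhdsWithin_le_nhds (s := Icc 0 1))
          simpa [h1, hp1] using this
        have hΦr : Φ r = 0 := by simp [hΦ, h1, hp1]
        rw [ContinuousWithinAt, hΦr]
        refine squeeze_zero_norm' ?_ hlim
        filter_upwards [self_mem_nhdsWithin] with s hs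
        rcases eq_or_lt_of_le hs.2 with h2 | h2
        · simp [hΦ, h2, hp1]
        · have h3 := hC s ⟨by linarith [hs.1], h2⟩
          have e : Φ s = h' s * (pwgt d s * h s) := by simp only [hΦ]; ring
          rw [e, norm_mul, Real.norm_eq_abs, Real.norm_eq_abs]
          exact mul_le_mul_of_nonneg_right h3 (abs_nonneg _)
      · exact (hΦd r ⟨by linarith [hr.1], h1⟩).continuousAt.continuousWithinAt
    refine hΦ1.comp (by fun_prop) fun θ hθ => ⟨?_, Real.cos_le_one _⟩
    exact Real.cos_nonneg_of_mem_Icc ⟨by linarith [hθ.1], by linarith [hθ.2]⟩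
  have hKc : ContinuousOn K (Icc 0 Real.pi) :=
    hΦc.add (continuousOn_const.mul
      (intervalIntegral.continuous_primitive (fun a b => hcw.intervalIntegrable a b) 0).continuousOn)
  have hanti : AntitoneOn K (Icc 0 Real.pi) := by
    refine antitoneOn_of_hasDerivWithinAt_nonpos (convex_Icc _ _) hKc
      (fun θ hθ => (hKd θ (by simpa using hθ)).hasDerivWithinAt) fun θ hθ => ?_
    rw [interior_Icc] at hθ
    have hr := cos_half_mem hθ
    have hr' : Real.cos (θ / 2) ∈ Ioo (-1 : ℝ) 1 := ⟨by linarith [hr.1], hr.2⟩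
    have h1 := (wgt_pos d hr').le
    have h2 := (pwgt_pos d hr').le
    have h3 := (pot_pos hd (Real.cos (θ / 2))).le
    have h4 := (sin_half_pos hθ).le
    rw [neg_mul, neg_mul, neg_nonpos]
    positivity
  have hK0 : K 0 = 0 := by simp [hK, hΦ, hp1]
  have hKpi : K Real.pi = 0 := by simp [hK, hΦ, hzero, hh0]
  have hKz : ∀ θ ∈ Icc 0 Real.pi, K θ = 0 := fun θ hθ => le_antisymm
    (hK0 ▸ hanti ⟨le_rfl, hpi.le⟩ hθ hθ.1) (hKpi ▸ hanti hθ ⟨hpi.le, le_rfl⟩ hθ.2)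
  have hhz : ∀ r ∈ Ioo (0 : ℝ) 1, h r = 0 := fun r hr => by
    set θ := 2 * Real.arccos r with hθ
    have hθ2 : θ / 2 = Real.arccos r := by rw [hθ]; ring
    have hcos : Real.cos (θ / 2) = r := by
      rw [hθ2, Real.cos_arccos (by linarith [hr.1]) hr.2.le]
    have hθm : θ ∈ Ioo 0 Real.pi := by
      constructor
      · rw [hθ]; have := Real.arccos_pos.2 hr.2; linarith
      · rw [hθ]; have := Real.arccos_lt_pi_div_two.2 hr.1; linarith
    have hr' : r ∈ Ioo (-1 : ℝ) 1 := ⟨by linarith [hr.1], hr.2⟩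
    have h1 : HasDerivAt K 0 θ := by
      refine (hasDerivAt_const θ (0 : ℝ)).congr_of_eventuallyEq ?_
      filter_upwards [isOpen_Ioo.mem_nhds hθm] with u hu using hKz u ⟨hu.1.le, hu.2.le⟩
    have h2 := (hKd θ hθm).unique h1
    rw [hcos] at h2
    have hs := sin_half_pos hθm
    have h3 := wgt_pos d hr'
    have h4 := pwgt_pos d hr'
    have h5 := pot_pos hd r
    have h6 : wgt d r * pot d r * h r ^ 2 + pwgt d r * h' r ^ 2 = 0 := by
      rcases mul_eq_zero.1 h2 with h | h
      · have : -(1 / 2) * Real.sin (θ / 2) ≠ 0 := mul_ne_zero (by norm_num) hs.ne'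
        exact absurd h this
      · exact h
    have h7 : 0 ≤ pwgt d r * h' r ^ 2 := by positivity
    by_contra hne
    have : 0 < wgt d r * pot d r * h r ^ 2 := by positivity
    linarith
  -- the zero function does not solve the profile equation
  have hmem : (1 / 2 : ℝ) ∈ Ioo (-1 : ℝ) 1 := by constructor <;> norm_num
  have hev : ∀ᶠ s in 𝓝 (1 / 2 : ℝ), s ∈ Ioo (0 : ℝ) 1 :=
    isOpen_Ioo.mem_nhds (by constructor <;> norm_num)
  have hh'z : ∀ r ∈ Ioo (0 : ℝ) 1, h' r = 0 := fun r hr =>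
    (hh.hasDerivAt r ⟨by linarith [hr.1], hr.2⟩).unique
      ((hasDerivAt_const r (0 : ℝ)).congr_of_eventuallyEq (by
        filter_upwards [isOpen_Ioo.mem_nhds hr] with s hs using hhz s hs))
  have h1 := (hh.hasDerivAt_snd _ hmem).unique
    ((hasDerivAt_const (1 / 2 : ℝ) (0 : ℝ)).congr_of_eventuallyEq (by
      filter_upwards [hev] with s hs using hh'z s hs))
  rw [hhz _ hev.self_of_nhds, hh'z _ hev.self_of_nhds, profileSnd] at h1
  norm_num at h1

/-! ### Moments of the unit quaternions -/

lemma integral_mul_mul (u v : H1) (f : H1 → ℝ) : ∫ q, f (u * q * v) ∂dq = ∫ q, f q ∂dq := by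
  rw [integral_mul_left_eq_self (μ := dq) (fun q => f (q * v)) u]
  exact integral_mul_right_eq_self f v

/-- The unit quaternion with the components `a, b, c, e`. -/
def mkH (a b c e : ℝ) (h : a ^ 2 + b ^ 2 + c ^ 2 + e ^ 2 = 1) : H1 :=
  ⟨a • (1 : Quat) + ofVec !₂[b, c, e], by
    have h1 := sq_sum_eq_norm_sq (a • (1 : Quat) + ofVec !₂[b, c, e])
    simp [h] at h1
    have := (pow_eq_one_iff_of_nonneg (norm_nonneg (a • (1 : Quat) + ofVec !₂[b, c, e]))
      two_ne_zero).1 h1.symm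
    simpa using this⟩

/-- The integral of `φ (Re q)` against a monomial of the imaginary components. -/
def moment (φ : ℝ → ℝ) (l m n : ℕ) : ℝ :=
  ∫ q : H1, φ (q : Quat).re * ((q : Quat).imI ^ l * (q : Quat).imJ ^ m * (q : Quat).imK ^ n) ∂dq

lemma moment_flip_zero (φ : ℝ → ℝ) (l m n : ℕ) : moment φ l m n = (-1) ^ (m + n) * moment φ l m n := by
  rw [moment, ← integral_const_mul]
  rw [← integral_mul_mul (mkH 0 1 0 0 (by norm_num)) (mkH 0 (-1) 0 0 (by norm_num))]
  refine integral_congr_ae (Eventually.of_forall fun q => ?_)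
  simp [mkH]
  ring

lemma moment_flip_one (φ : ℝ → ℝ) (l m n : ℕ) : moment φ l m n = (-1) ^ (l + n) * moment φ l m n := by
  rw [moment, ← integral_const_mul]
  rw [← integral_mul_mul (mkH 0 0 1 0 (by norm_num)) (mkH 0 0 (-1) 0 (by norm_num))]
  refine integral_congr_ae (Eventually.of_forall fun q => ?_)
  simp [mkH]
  ring

lemma moment_cycle (φ : ℝ → ℝ) (l m n : ℕ) : moment φ l m n = moment φ m n l := by
  rw [moment, moment]
  rw [← integral_mul_mul (mkH (1 / 2) (1 / 2) (1 / 2) (1 / 2) (by norm_num))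
    (mkH (1 / 2) (-1 / 2) (-1 / 2) (-1 / 2) (by norm_num))]
  refine integral_congr_ae (Eventually.of_forall fun q => ?_)
  simp [mkH]
  ring_nf

lemma integrable_moment {φ : ℝ → ℝ} (hφ : Continuous φ) (l m n : ℕ) :
    Integrable (fun q : H1 => φ (q : Quat).re *
      ((q : Quat).imI ^ l * (q : Quat).imJ ^ m * (q : Quat).imK ^ n)) dq := by
  have h0 := Quaternion.continuous_re.comp (continuous_subtype_val (p := (· ∈ Metric.sphere 0 1)))
  have h1 := Quaternion.continuous_imI.comp (continuous_subtype_val (p := (· ∈ Metric.sphere 0 1)))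
  have h2 := Quaternion.continuous_imJ.comp (continuous_subtype_val (p := (· ∈ Metric.sphere 0 1)))
  have h3 := Quaternion.continuous_imK.comp (continuous_subtype_val (p := (· ∈ Metric.sphere 0 1)))
  exact integrable_of_continuous ((hφ.comp h0).mul (((h1.pow l).mul (h2.pow m)).mul (h3.pow n)))

/-- A monomial with an odd exponent has the integral zero. -/
lemma moment_eq_zero (φ : ℝ → ℝ) {l m n : ℕ} (h : Odd (m + n) ∨ Odd (l + n)) :
    moment φ l m n = 0 := by
  rcases h with h | h
  · have := moment_flip_zero φ l m n
    rw [h.neg_one_pow] at this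
    linarith
  · have := moment_flip_one φ l m n
    rw [h.neg_one_pow] at this
    linarith

/-- The relation of the two moments of fourth order, from the rotation with the cosine `-7/25` and the
sine `24/25`. -/
lemma moment_four {φ : ℝ → ℝ} (hφ : Continuous φ) : moment φ 4 0 0 = 3 * moment φ 2 2 0 := by
  have key : moment φ 4 0 0 = (7 / 25) ^ 4 * moment φ 4 0 0
      + (4 * (7 / 25) ^ 3 * (24 / 25) * moment φ 3 1 0
      + (6 * (7 / 25) ^ 2 * (24 / 25) ^ 2 * moment φ 2 2 0
      + (4 * (7 / 25) * (24 / 25) ^ 3 * moment φ 1 3 0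
      + (24 / 25) ^ 4 * moment φ 0 4 0))) := by
    have hi := integrable_moment hφ
    have i1 := (hi 0 4 0).const_mul ((24 / 25) ^ 4)
    have i2 := (hi 1 3 0).const_mul (4 * (7 / 25) * (24 / 25) ^ 3)
    have i3 := (hi 2 2 0).const_mul (6 * (7 / 25) ^ 2 * (24 / 25) ^ 2)
    have i4 := (hi 3 1 0).const_mul (4 * (7 / 25) ^ 3 * (24 / 25))
    have i5 := (hi 4 0 0).const_mul ((7 / 25) ^ 4)
    have i21 := i2.add i1
    have i321 := i3.add i21
    have i4321 := i4.add i321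
    simp only [moment, ← integral_const_mul]
    rw [← integral_add i2 i1]
    erw [← integral_add i3 i21, ← integral_add i4 i321, ← integral_add i5 i4321]
    rw [← integral_mul_mul (mkH (3 / 5) 0 0 (4 / 5) (by norm_num))
      (mkH (3 / 5) 0 0 (-4 / 5) (by norm_num))]
    refine integral_congr_ae (Eventually.of_forall fun q => ?_)
    simp [mkH]
    ring_nf
  have h1 := moment_eq_zero φ (l := 3) (m := 1) (n := 0) (Or.inl (by decide))
  have h2 := moment_eq_zero φ (l := 1) (m := 3) (n := 0) (Or.inl (by decide))
  have h3 := moment_cycle φ 4 0 0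
  have h4 := moment_cycle φ 0 0 4
  rw [h1, h2, ← h4, ← h3] at key
  linarith

/-- The symmetric tensor `δ δ + δ δ + δ δ` of fourth order. -/
def delta4 (a b c e : Fin 3) : ℝ :=
  (if a = b then 1 else 0) * (if c = e then 1 else 0)
    + (if a = c then 1 else 0) * (if b = e then 1 else 0)
    + (if a = e then 1 else 0) * (if b = c then 1 else 0)

lemma sum_sq_imVec (q : H1) :
    (q : Quat).imI ^ 2 + (q : Quat).imJ ^ 2 + (q : Quat).imK ^ 2 = 1 - (q : Quat).re ^ 2 := by
  have := sq_sum_eq_norm_sq (q : Quat)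
  rw [norm_coe_H1] at this
  linarith

lemma moment_two_eq {φ : ℝ → ℝ} (hφ : Continuous φ) :
    moment φ 2 0 0 = (∫ q : H1, φ (q : Quat).re * (1 - (q : Quat).re ^ 2) ∂dq) / 3 := by
  have hi := integrable_moment hφ
  have h : ∫ q : H1, φ (q : Quat).re * (1 - (q : Quat).re ^ 2) ∂dq
      = moment φ 2 0 0 + (moment φ 0 2 0 + moment φ 0 0 2) := by
    simp only [moment]
    rw [← integral_add (hi 0 2 0) (hi 0 0 2)]
    erw [← integral_add (hi 2 0 0) ((hi 0 2 0).add (hi 0 0 2))]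
    refine integral_congr_ae (Eventually.of_forall fun q => ?_)
    simp only [← sum_sq_imVec, Pi.add_apply]
    ring
  have h1 := moment_cycle φ 2 0 0
  have h2 := moment_cycle φ 0 0 2
  rw [h]
  linarith

lemma moment_four_eq {φ : ℝ → ℝ} (hφ : Continuous φ) :
    moment φ 2 2 0 = (∫ q : H1, φ (q : Quat).re * (1 - (q : Quat).re ^ 2) ^ 2 ∂dq) / 15 := by
  have hφ' : Continuous fun r => φ r * (1 - r ^ 2) := by fun_prop
  have h0 := moment_two_eq hφ'
  have hi := integrable_moment hφ
  have h : moment (fun r => φ r * (1 - r ^ 2)) 2 0 0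
      = moment φ 4 0 0 + (moment φ 2 2 0 + moment φ 2 0 2) := by
    simp only [moment]
    rw [← integral_add (hi 2 2 0) (hi 2 0 2)]
    erw [← integral_add (hi 4 0 0) ((hi 2 2 0).add (hi 2 0 2))]
    refine integral_congr_ae (Eventually.of_forall fun q => ?_)
    simp only [← sum_sq_imVec, Pi.add_apply]
    ring
  have h1 := moment_cycle φ 2 2 0
  have h2 := moment_cycle φ 2 0 2
  have h3 := moment_four hφ
  have h4 : ∫ q : H1, φ (q : Quat).re * (1 - (q : Quat).re ^ 2) ^ 2 ∂dq
      = ∫ q : H1, φ (q : Quat).re * (1 - (q : Quat).re ^ 2) * (1 - (q : Quat).re ^ 2) ∂dq := by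
    congr 1; ext q; ring
  rw [h4]
  linarith

lemma imVec_eq_monomial (q : H1) (a : Fin 3) :
    imVec q a = (q : Quat).imI ^ (if a = 0 then 1 else 0) * (q : Quat).imJ ^ (if a = 1 then 1 else 0)
      * (q : Quat).imK ^ (if a = 2 then 1 else 0) := by
  fin_cases a <;> simp

/-- Second moments: `∫ φ(Re q) w_a w_b = (δ_{ab} / 3) ∫ φ(Re q) (1 - (Re q)²)`, `w = Im q`. -/
lemma integral_two_moment {φ : ℝ → ℝ} (hφ : Continuous φ) (a b : Fin 3) :
    ∫ q : H1, φ (q : Quat).re * (imVec q a * imVec q b) ∂dq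
      = (if a = b then 1 else 0) / 3 * ∫ q : H1, φ (q : Quat).re * (1 - (q : Quat).re ^ 2) ∂dq := by
  have h0 := moment_two_eq hφ
  have h1 := moment_cycle φ 2 0 0
  have h2 := moment_cycle φ 0 0 2
  have z1 := moment_eq_zero φ (l := 1) (m := 1) (n := 0) (Or.inl (by decide))
  have z2 := moment_eq_zero φ (l := 1) (m := 0) (n := 1) (Or.inl (by decide))
  have z3 := moment_eq_zero φ (l := 0) (m := 1) (n := 1) (Or.inr (by decide))
  have key : ∫ q : H1, φ (q : Quat).re * (imVec q a * imVec q b) ∂dq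
      = moment φ ((if a = 0 then 1 else 0) + if b = 0 then 1 else 0)
        ((if a = 1 then 1 else 0) + if b = 1 then 1 else 0)
        ((if a = 2 then 1 else 0) + if b = 2 then 1 else 0) := by
    simp only [moment]
    congr 1
    ext q
    rw [imVec_eq_monomial q a, imVec_eq_monomial q b]
    ring
  rw [key]
  fin_cases a <;> fin_cases b <;> simp [z1, z2, z3] <;> linarith

/-- Fourth moments: `∫ φ(Re q) w_a w_b w_c w_e` is `1 / 15` of `∫ φ(Re q) (1 - (Re q)²)²` times the
isotropic tensor. -/
lemma integral_four_moment {φ : ℝ → ℝ} (hφ : Continuous φ) (a b c e : Fin 3) :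
    ∫ q : H1, φ (q : Quat).re * (imVec q a * imVec q b * imVec q c * imVec q e) ∂dq
      = delta4 a b c e / 15 * ∫ q : H1, φ (q : Quat).re * (1 - (q : Quat).re ^ 2) ^ 2 ∂dq := by
  have h0 := moment_four_eq hφ
  have h1 := moment_four hφ
  have h2 := moment_cycle φ 4 0 0
  have h3 := moment_cycle φ 0 0 4
  have h4 := moment_cycle φ 2 2 0
  have h5 := moment_cycle φ 2 0 2
  have z1 := moment_eq_zero φ (l := 3) (m := 1) (n := 0) (Or.inl (by decide))
  have z2 := moment_eq_zero φ (l := 3) (m := 0) (n := 1) (Or.inl (by decide))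
  have z3 := moment_eq_zero φ (l := 1) (m := 3) (n := 0) (Or.inl (by decide))
  have z4 := moment_eq_zero φ (l := 0) (m := 3) (n := 1) (Or.inr (by decide))
  have z5 := moment_eq_zero φ (l := 1) (m := 0) (n := 3) (Or.inl (by decide))
  have z6 := moment_eq_zero φ (l := 0) (m := 1) (n := 3) (Or.inr (by decide))
  have z7 := moment_eq_zero φ (l := 2) (m := 1) (n := 1) (Or.inr (by decide))
  have z8 := moment_eq_zero φ (l := 1) (m := 2) (n := 1) (Or.inl (by decide))
  have z9 := moment_eq_zero φ (l := 1) (m := 1) (n := 2) (Or.inl (by decide))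
  have key : ∫ q : H1, φ (q : Quat).re * (imVec q a * imVec q b * imVec q c * imVec q e) ∂dq
      = moment φ ((if a = 0 then 1 else 0) + (if b = 0 then 1 else 0) + (if c = 0 then 1 else 0)
          + if e = 0 then 1 else 0)
        ((if a = 1 then 1 else 0) + (if b = 1 then 1 else 0) + (if c = 1 then 1 else 0)
          + if e = 1 then 1 else 0)
        ((if a = 2 then 1 else 0) + (if b = 2 then 1 else 0) + (if c = 2 then 1 else 0)
          + if e = 2 then 1 else 0) := by
    simp only [moment]
    congr 1
    ext q
    rw [imVec_eq_monomial q a, imVec_eq_monomial q b, imVec_eq_monomial q c, imVec_eq_monomial q e]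
    ring
  rw [key]
  fin_cases a <;> fin_cases b <;> fin_cases c <;> fin_cases e <;>
    simp [delta4, z1, z2, z3, z4, z5, z6, z7, z8, z9] <;> linarith

/-! ### The distribution of the real part, and the angular averages -/

lemma rcoord_one (q : H1) : rcoord 1 q = (q : Quat).re := by
  rw [rcoord, inner_quat]; simp

lemma continuous_re_coe : Continuous fun q : H1 => (q : Quat).re :=
  Quaternion.continuous_re.comp continuous_subtype_val

lemma integrable_comp_re {φ : ℝ → ℝ} (hφ : Continuous φ) :
    Integrable (fun q : H1 => φ (q : Quat).re) dq :=
  integrable_of_continuous (hφ.comp continuous_re_coe)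

/-- The moments of the real part satisfy a recursion, from the divergence of the fields
`(Re q)ⁿ Im q`. -/
lemma integral_re_pow_succ (n : ℕ) :
    (n + 3) * ∫ q : H1, (q : Quat).re ^ (n + 1) ∂dq
      = n * ∫ q : H1, (q : Quat).re ^ (n - 1) ∂dq := by
  have h : ∀ k, ∫ q, (n * rcoord 1 q ^ (n - 1) * -pcoord 1 k q * pcoord 1 k q
      + rcoord 1 q ^ n * rcoord 1 q) ∂dq = 0 := fun k => by
    have hr := continuous_rcoord 1
    have hp := continuous_pcoord 1 k
    refine integral_flowDeriv_eq_zero_of_continuous (ξ := iu k)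
      (a := fun q => rcoord 1 q ^ n * pcoord 1 k q) (by fun_prop) fun q => ?_
    exact ((hasFlowDeriv_rcoord 1 k q).comp (hasDerivAt_pow n _)).mul (hasFlowDeriv_pcoord 1 k q)
  have hr := continuous_rcoord 1
  have hs : ∑ k, ∫ q, (n * rcoord 1 q ^ (n - 1) * -pcoord 1 k q * pcoord 1 k q
      + rcoord 1 q ^ n * rcoord 1 q) ∂dq = 0 := Finset.sum_eq_zero fun k _ => h k
  rw [← integral_finsetSum] at hs
  · have h2 : ∀ q, ∑ k, (n * rcoord 1 q ^ (n - 1) * -pcoord 1 k q * pcoord 1 k q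
        + rcoord 1 q ^ n * rcoord 1 q)
        = (n + 3) * (q : Quat).re ^ (n + 1) - n * (q : Quat).re ^ (n - 1) := fun q => by
      have h3 := sum_sq_coord 1 q
      have h4 : (n : ℝ) * rcoord 1 q ^ (n - 1) * rcoord 1 q ^ 2 = n * rcoord 1 q ^ (n + 1) := by
        rcases n with _ | n
        · simp
        · simp only [Nat.add_sub_cancel]; ring
      rw [Fin.sum_univ_three] at h3 ⊢
      rw [← rcoord_one]
      linear_combination (-(n : ℝ) * rcoord 1 q ^ (n - 1)) * h3 + h4
    simp only [h2] at hs
    rw [integral_sub, integral_const_mul, integral_const_mul] at hs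
    · linarith
    · exact (integrable_comp_re (continuous_pow _)).const_mul _
    · exact (integrable_comp_re (continuous_pow _)).const_mul _
  · intro k _
    have hp := continuous_pcoord 1 k
    exact integrable_of_continuous (by fun_prop)

lemma integral_cos_pow_succ_mul_sin_sq (n : ℕ) :
    (n + 3) * ∫ α in (0 : ℝ)..Real.pi, Real.cos α ^ (n + 1) * Real.sin α ^ 2
      = n * ∫ α in (0 : ℝ)..Real.pi, Real.cos α ^ (n - 1) * Real.sin α ^ 2 := by
  have h : ∫ α in (0 : ℝ)..Real.pi, ((n + 3) * (Real.cos α ^ (n + 1) * Real.sin α ^ 2)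
      - n * (Real.cos α ^ (n - 1) * Real.sin α ^ 2)) = 0 := by
    rw [intervalIntegral.integral_eq_sub_of_hasDerivAt
      (f := fun α => Real.cos α ^ n * Real.sin α ^ 3)]
    · simp
    · intro α _
      refine (((Real.hasDerivAt_cos α).pow n).mul ((Real.hasDerivAt_sin α).pow 3)).congr_deriv ?_
      have h3 := Real.sin_sq_add_cos_sq α
      have h4 : (n : ℝ) * Real.cos α ^ (n - 1) * Real.cos α ^ 2 = n * Real.cos α ^ (n + 1) := by
        rcases n with _ | n
        · simp
        · simp only [Nat.add_sub_cancel]; ring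
      simp only [Pi.pow_apply]
      push_cast
      linear_combination Real.sin α ^ 2 * h4 - n * Real.cos α ^ (n - 1) * Real.sin α ^ 2 * h3
    · exact (by fun_prop : Continuous fun α => (n + 3) * (Real.cos α ^ (n + 1) * Real.sin α ^ 2)
        - n * (Real.cos α ^ (n - 1) * Real.sin α ^ 2)).intervalIntegrable _ _
  rw [intervalIntegral.integral_sub, intervalIntegral.integral_const_mul,
    intervalIntegral.integral_const_mul] at h
  · linarith
  · exact (by fun_prop : Continuous fun α => ((n : ℝ) + 3) * (Real.cos α ^ (n + 1)
      * Real.sin α ^ 2)).intervalIntegrable _ _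
  · exact (by fun_prop : Continuous fun α => (n : ℝ) * (Real.cos α ^ (n - 1)
      * Real.sin α ^ 2)).intervalIntegrable _ _

/-- The real part of a unit quaternion is distributed like the cosine of an angle with the density
`sin²`: the moments agree by their recursion, and polynomials are dense. -/
theorem exists_integral_comp_re_eq : ∃ C : ℝ, 0 < C ∧ ∀ φ : ℝ → ℝ, Continuous φ →
    ∫ q : H1, φ (q : Quat).re ∂dq
      = C * ∫ α in (0 : ℝ)..Real.pi, φ (Real.cos α) * Real.sin α ^ 2 := by
  have hpi := Real.pi_pos
  have hi : ∀ φ : ℝ → ℝ, Continuous φ →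
      IntervalIntegrable (fun α => φ (Real.cos α) * Real.sin α ^ 2) volume 0 Real.pi :=
    fun φ hφ => ((hφ.comp Real.continuous_cos).mul
      (Real.continuous_sin.pow 2)).intervalIntegrable _ _
  have hC : 0 < vol / (Real.pi / 2) := div_pos vol_pos (by positivity)
  set C := vol / (Real.pi / 2) with hCdef
  refine ⟨C, hC, fun φ hφ => ?_⟩
  set Λ : (ℝ → ℝ) → ℝ := fun φ => (∫ q : H1, φ (q : Quat).re ∂dq)
      - C * ∫ α in (0 : ℝ)..Real.pi, φ (Real.cos α) * Real.sin α ^ 2 with hΛ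
  suffices h : Λ φ = 0 by simp only [hΛ] at h; linarith
  have hpow : ∀ n : ℕ, Λ (fun r => r ^ n) = 0 ∧ Λ (fun r => r ^ (n + 1)) = 0 := by
    intro n
    induction n with
    | zero =>
      constructor
      · simp only [hΛ, pow_zero, one_mul, integral_sin_sq, integral_const, hCdef]
        simp only [Real.sin_zero, Real.sin_pi, smul_eq_mul, vol]
        field_simp
        simp
      · have h1 := integral_re_pow_succ 0
        have h2 := integral_cos_pow_succ_mul_sin_sq 0
        simp only [hΛ]
        simp only [CharP.cast_eq_zero, zero_add, zero_mul, mul_eq_zero, OfNat.ofNat_ne_zero,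
          false_or] at h1 h2 ⊢
        simp only [h1, h2, mul_zero, sub_zero]
    | succ n ih =>
      refine ⟨ih.2, ?_⟩
      have h1 := integral_re_pow_succ (n + 1)
      have h2 := integral_cos_pow_succ_mul_sin_sq (n + 1)
      have h3 := ih.1
      simp only [hΛ, Nat.add_sub_cancel] at h1 h2 h3 ⊢
      have h4 : (((n + 1 : ℕ) : ℝ) + 3) ≠ 0 := by positivity
      refine (mul_eq_zero.1 ?_).resolve_left h4
      linear_combination h1 - C * h2 + ((n + 1 : ℕ) : ℝ) * h3
  have hpoly : ∀ p : Polynomial ℝ, Λ (fun r => p.eval r) = 0 := by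
    intro p
    induction p using Polynomial.induction_on' with
    | add p p' hp hp' =>
      simp only [hΛ, Polynomial.eval_add, add_mul] at hp hp' ⊢
      rw [integral_add (integrable_comp_re p.continuous) (integrable_comp_re p'.continuous),
        intervalIntegral.integral_add (hi _ p.continuous) (hi _ p'.continuous)]
      linarith
    | monomial n a =>
      have := (hpow n).1
      simp only [hΛ, Polynomial.eval_monomial, mul_assoc] at this ⊢
      rw [integral_const_mul, intervalIntegral.integral_const_mul]
      linear_combination a * this
  have hle : ∀ ε > 0, |Λ φ| ≤ ε * (vol + C * Real.pi) := fun ε hε => by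
    obtain ⟨p, hp⟩ := exists_polynomial_near_of_continuousOn (-1) 1 φ hφ.continuousOn ε hε
    have e1 : |∫ q : H1, (φ (q : Quat).re - p.eval (q : Quat).re) ∂dq| ≤ ε * vol := by
      refine norm_integral_le_of_norm_le_const (μ := dq) (C := ε)
        (f := fun q : H1 => φ (q : Quat).re - p.eval (q : Quat).re)
        (Eventually.of_forall fun q => ?_)
      have h1 := sum_sq_imVec q
      have h2 : |(q : Quat).re| ≤ 1 := by
        rw [abs_le_one_iff_mul_self_le_one]
        nlinarith [sq_nonneg (q : Quat).imI, sq_nonneg (q : Quat).imJ, sq_nonneg (q : Quat).imK]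
      rw [Real.norm_eq_abs, abs_sub_comm]
      exact (hp _ (abs_le.1 h2)).le
    have e2 : |∫ α in (0 : ℝ)..Real.pi, (φ (Real.cos α) * Real.sin α ^ 2
        - p.eval (Real.cos α) * Real.sin α ^ 2)| ≤ ε * Real.pi := by
      have := intervalIntegral.norm_integral_le_of_norm_le_const (a := 0) (b := Real.pi) (C := ε)
        (f := fun α => φ (Real.cos α) * Real.sin α ^ 2 - p.eval (Real.cos α) * Real.sin α ^ 2)
        fun α _ => by
          rw [← sub_mul, norm_mul, Real.norm_eq_abs, abs_sub_comm, Real.norm_eq_abs,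
            abs_of_nonneg (sq_nonneg (Real.sin α))]
          have h1 := (hp _ (Real.cos_mem_Icc α)).le
          have h2 := Real.sin_sq_le_one α
          nlinarith [abs_nonneg (p.eval (Real.cos α) - φ (Real.cos α))]
      rwa [sub_zero, abs_of_pos hpi] at this
    have e3 : Λ φ = (∫ q : H1, (φ (q : Quat).re - p.eval (q : Quat).re) ∂dq)
        - C * ∫ α in (0 : ℝ)..Real.pi, (φ (Real.cos α) * Real.sin α ^ 2
          - p.eval (Real.cos α) * Real.sin α ^ 2) := by
      have h0 := hpoly p
      simp only [hΛ] at h0 ⊢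
      rw [integral_sub (integrable_comp_re hφ) (integrable_comp_re p.continuous),
        intervalIntegral.integral_sub (hi _ hφ) (hi _ p.continuous)]
      linarith
    rw [e3]
    refine (abs_sub _ _).trans ?_
    rw [abs_mul, abs_of_pos hC]
    nlinarith
  by_contra hne
  have h0 : 0 < vol + C * Real.pi := by have := vol_pos; positivity
  have h1 := hle (|Λ φ| / (2 * (vol + C * Real.pi))) (div_pos (abs_pos.2 hne) (by positivity))
  have h2 : |Λ φ| / (2 * (vol + C * Real.pi)) * (vol + C * Real.pi) = |Λ φ| / 2 := by
    field_simp
  have h3 := abs_pos.2 hne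
  linarith

/-- For even functions the angle may be halved. -/
theorem exists_integral_comp_re_eq_half : ∃ C : ℝ, 0 < C ∧ ∀ φ : ℝ → ℝ, Continuous φ →
    (∀ r, φ (-r) = φ r) → ∫ q : H1, φ (q : Quat).re ∂dq
      = C * ∫ θ in (0 : ℝ)..Real.pi, φ (Real.cos (θ / 2)) * Real.sin (θ / 2) ^ 2 := by
  obtain ⟨C, hC, h⟩ := exists_integral_comp_re_eq
  refine ⟨C, hC, fun φ hφ he => ?_⟩
  have hc : Continuous fun α => φ (Real.cos α) * Real.sin α ^ 2 := by fun_prop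
  rw [h φ hφ, intervalIntegral.integral_comp_div
    (fun α => φ (Real.cos α) * Real.sin α ^ 2) two_ne_zero, zero_div, smul_eq_mul,
    ← intervalIntegral.integral_add_adjacent_intervals (b := Real.pi / 2)
      (hc.intervalIntegrable _ _) (hc.intervalIntegrable _ _)]
  have h2 : ∫ α in (Real.pi / 2)..Real.pi, φ (Real.cos α) * Real.sin α ^ 2
      = ∫ α in (0 : ℝ)..(Real.pi / 2), φ (Real.cos α) * Real.sin α ^ 2 := by
    have := intervalIntegral.integral_comp_sub_left (a := 0) (b := Real.pi / 2)
      (fun α => φ (Real.cos α) * Real.sin α ^ 2) Real.pi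
    simp only [Real.cos_pi_sub, Real.sin_pi_sub, he, sub_zero] at this
    rw [this]
    congr 1
    ring
  rw [h2]
  ring

/-- The equilibrium `gibbs` as a function of the component along `qbar`. -/
def gibbsFun (d r : ℝ) : ℝ := Real.exp (2 / d * (r ^ 2 - 1 / 4))

lemma continuous_gibbsFun (d : ℝ) : Continuous (gibbsFun d) := by
  unfold gibbsFun; fun_prop

lemma cos_eq_half (θ : ℝ) : Real.cos θ = 2 * Real.cos (θ / 2) ^ 2 - 1 := by
  rw [← Real.cos_two_mul]; congr 1; ring

lemma angAvg_eq_div (g w : ℝ → ℝ) : angAvg g w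
    = (∫ θ in (0 : ℝ)..Real.pi, g θ * w θ) / ∫ θ in (0 : ℝ)..Real.pi, w θ := by
  rw [angAvg, ← intervalIntegral.integral_div]
  simp only [mul_div_assoc]

lemma c1_eq (d : ℝ) : c1 d * ∫ q : H1, gibbsFun d (q : Quat).re ∂dq
    = ∫ q : H1, gibbsFun d (q : Quat).re * ((4 * (q : Quat).re ^ 2 - 1) / 3) ∂dq := by
  obtain ⟨C, hC, h⟩ := exists_integral_comp_re_eq_half
  have hg := continuous_gibbsFun d
  have h1 := h (gibbsFun d) hg fun r => by simp [gibbsFun]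
  have h2 := h (fun r => gibbsFun d r * ((4 * r ^ 2 - 1) / 3)) (by fun_prop) fun r => by
    simp [gibbsFun]
  have hpos := (integral_vonMises d 1).1
  have h3 : ∀ q, gibbs d 1 q = gibbsFun d (q : Quat).re := fun q => by
    rw [← rcoord_one]; rfl
  have e1 : ∀ θ, gibbsFun d (Real.cos (θ / 2)) * Real.sin (θ / 2) ^ 2 = weightOne d θ := fun θ => by
    rw [weightOne, mFun_eq]; rfl
  have e2 : ∀ θ, gibbsFun d (Real.cos (θ / 2)) * ((4 * Real.cos (θ / 2) ^ 2 - 1) / 3)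
      * Real.sin (θ / 2) ^ 2 = 2 / 3 * ((1 / 2 + Real.cos θ) * weightOne d θ) := fun θ => by
    rw [← e1, cos_eq_half θ]; ring
  simp only [h3] at hpos
  rw [h1] at hpos
  rw [h1, h2, c1, angAvg_eq_div]
  simp only [e1, e2, intervalIntegral.integral_const_mul] at hpos ⊢
  have := (pos_of_mul_pos_right hpos hC.le).ne'
  field_simp

/-- The integrals over the unit quaternions behind the averages with the weight `weightTwo`. -/
lemma IsRegularProfile.c2_c4_eq {d : ℝ} (hd : 0 < d) {h h' : ℝ → ℝ} (hh : IsRegularProfile d h h') :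
    (∫ q : H1, gibbsFun d (q : Quat).re * ((q : Quat).re * h (q : Quat).re
        * (1 - (q : Quat).re ^ 2)) ∂dq) ≠ 0 ∧
    c2 d h * ∫ q : H1, gibbsFun d (q : Quat).re * ((q : Quat).re * h (q : Quat).re
        * (1 - (q : Quat).re ^ 2)) ∂dq
      = ∫ q : H1, gibbsFun d (q : Quat).re * ((q : Quat).re * h (q : Quat).re
        * (1 - (q : Quat).re ^ 2) * ((8 * (q : Quat).re ^ 2 - 3) / 5)) ∂dq ∧
    c4 d h * ∫ q : H1, gibbsFun d (q : Quat).re * ((q : Quat).re * h (q : Quat).re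
        * (1 - (q : Quat).re ^ 2)) ∂dq
      = ∫ q : H1, gibbsFun d (q : Quat).re * ((q : Quat).re * h (q : Quat).re
        * (1 - (q : Quat).re ^ 2) * (2 * (1 - (q : Quat).re ^ 2) / 5)) ∂dq := by
  obtain ⟨C, hC, hm⟩ := exists_integral_comp_re_eq_half
  have hg := continuous_gibbsFun d
  have hhc := hh.continuous
  have h1 := hm (fun r => gibbsFun d r * (r * h r * (1 - r ^ 2))) (by fun_prop) fun r => by
    simp [gibbsFun, hh.odd]
  have h2 := hm (fun r => gibbsFun d r * (r * h r * (1 - r ^ 2) * ((8 * r ^ 2 - 3) / 5)))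
    (by fun_prop) fun r => by simp [gibbsFun, hh.odd]
  have h4 := hm (fun r => gibbsFun d r * (r * h r * (1 - r ^ 2) * (2 * (1 - r ^ 2) / 5)))
    (by fun_prop) fun r => by simp [gibbsFun, hh.odd]
  have e1 : ∀ θ, gibbsFun d (Real.cos (θ / 2)) * (Real.cos (θ / 2) * h (Real.cos (θ / 2))
      * (1 - Real.cos (θ / 2) ^ 2)) * Real.sin (θ / 2) ^ 2 = weightTwo d h θ := fun θ => by
    rw [weightTwo, mFun_eq, ← Real.sin_sq, gibbsFun]; ring
  have e2 : ∀ θ, gibbsFun d (Real.cos (θ / 2)) * (Real.cos (θ / 2) * h (Real.cos (θ / 2))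
      * (1 - Real.cos (θ / 2) ^ 2) * ((8 * Real.cos (θ / 2) ^ 2 - 3) / 5)) * Real.sin (θ / 2) ^ 2
      = 1 / 5 * ((1 + 4 * Real.cos θ) * weightTwo d h θ) := fun θ => by
    rw [← e1, cos_eq_half θ]; ring
  have e4 : ∀ θ, gibbsFun d (Real.cos (θ / 2)) * (Real.cos (θ / 2) * h (Real.cos (θ / 2))
      * (1 - Real.cos (θ / 2) ^ 2) * (2 * (1 - Real.cos (θ / 2) ^ 2) / 5)) * Real.sin (θ / 2) ^ 2
      = 1 / 5 * ((1 - Real.cos θ) * weightTwo d h θ) := fun θ => by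
    rw [← e1, cos_eq_half θ]; ring
  have hne := hh.integral_weightTwo_ne_zero hd
  rw [h1, h2, h4, c2, c4, angAvg_eq_div, angAvg_eq_div]
  simp only [e1, e2, e4, intervalIntegral.integral_const_mul]
  refine ⟨mul_ne_zero hC.ne' hne, ?_, ?_⟩ <;> field_simp

/-- The averages with the weight `weightTwo` only see the values of the profile on `(-1, 1)`. -/
lemma angAvg_weightTwo_congr (d : ℝ) {h k : ℝ → ℝ} (hhk : EqOn h k (Ioo (-1) 1)) (g : ℝ → ℝ) :
    angAvg g (weightTwo d h) = angAvg g (weightTwo d k) := by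
  have h0 := weightTwo_congr d hhk
  have hpi := Real.pi_pos.le
  simp only [angAvg_eq_div, intervalIntegral.integral_of_le hpi, integral_Ioc_eq_integral_Ioo]
  rw [setIntegral_congr_fun measurableSet_Ioo h0, setIntegral_congr_fun (g := fun θ => g θ * weightTwo d k θ)
    measurableSet_Ioo fun θ hθ => by simp only [h0 hθ]]

/-! ### The collision invariants -/

open scoped Pointwise in
lemma dq_setOf_inner_eq_zero {a : Quat} (ha : a ≠ 0) :
    dq {q : H1 | inner ℝ a (q : Quat) = 0} = 0 := by
  have hs : MeasurableSet {q : H1 | inner ℝ a (q : Quat) = 0} :=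
    (isClosed_eq (by fun_prop) continuous_const).measurableSet
  rw [dq, Measure.toSphere_apply' _ hs]
  have hsub : Ioo (0 : ℝ) 1 • (((↑) : H1 → Quat) '' {q : H1 | inner ℝ a (q : Quat) = 0})
      ⊆ (((ℝ ∙ a)ᗮ : Submodule ℝ Quat) : Set Quat) := by
    rintro _ ⟨r, -, _, ⟨q, hq, rfl⟩, rfl⟩
    exact Submodule.smul_mem _ _ ((Submodule.mem_orthogonal_singleton_iff_inner_right).2 hq)
  have hne : ((ℝ ∙ a)ᗮ : Submodule ℝ Quat) ≠ ⊤ := by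
    intro h
    have : a ∈ ((ℝ ∙ a)ᗮ : Submodule ℝ Quat) := by rw [h]; trivial
    rw [Submodule.mem_orthogonal_singleton_iff_inner_right] at this
    exact ha (inner_self_eq_zero.1 this)
  have h0 := measure_mono_null hsub (Measure.addHaar_submodule volume _ hne)
  rw [h0, mul_zero]

lemma rcoord_mem (qbar q : H1) : rcoord qbar q ∈ Icc (-1 : ℝ) 1 := by
  have h := sum_sq_coord qbar q
  rw [Fin.sum_univ_three] at h
  rw [mem_Icc, ← abs_le, abs_le_one_iff_mul_self_le_one]
  nlinarith [sq_nonneg (pcoord qbar 0 q), sq_nonneg (pcoord qbar 1 q), sq_nonneg (pcoord qbar 2 q)]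

lemma pcoord_sq_le (qbar : H1) (k : Fin 3) (q : H1) :
    pcoord qbar k q ^ 2 ≤ 1 - rcoord qbar q ^ 2 := by
  have h := sum_sq_coord qbar q
  have := Finset.single_le_sum (f := fun k => pcoord qbar k q ^ 2) (fun k _ => sq_nonneg _)
    (Finset.mem_univ k)
  linarith

/-- Almost every orbit of the flow of `iu k` avoids `qbar` and `-qbar`. -/
lemma ae_forall_rcoord_mem (qbar : H1) (k : Fin 3) :
    ∀ᵐ q ∂dq, ∀ s, rcoord qbar (rotor (iu k) s * q) ∈ Ioo (-1 : ℝ) 1 := by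
  obtain ⟨m, hm⟩ : ∃ m : Fin 3, m ≠ k := exists_ne k
  have hne : (iu m).val * (qbar : Quat) ≠ 0 := by
    rw [← frame_succ]
    exact (frame qbar).orthonormal.ne_zero _
  have h0 : ∀ᵐ q ∂dq, pcoord qbar m q ≠ 0 := by
    rw [ae_iff]
    simpa [pcoord] using dq_setOf_inner_eq_zero hne
  filter_upwards [h0] with q hq s
  have hI := rcoord_mem qbar (rotor (iu k) s * q)
  by_contra hcon
  apply hq
  -- at an end point of the range of `rcoord` all other components vanish
  have hr : rcoord qbar (rotor (iu k) s * q) ^ 2 = 1 := by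
    rw [mem_Ioo, not_and_or, not_lt, not_lt] at hcon
    rcases hcon with h | h
    · rw [le_antisymm h hI.1]; norm_num
    · rw [le_antisymm hI.2 h]; norm_num
  have hp : ∀ j, pcoord qbar j (rotor (iu k) s * q) = 0 := fun j => by
    have := pcoord_sq_le qbar j (rotor (iu k) s * q)
    rw [hr, sub_self] at this
    exact pow_eq_zero_iff two_ne_zero |>.1 (le_antisymm this (sq_nonneg _))
  have hx : ((rotor (iu k) s * q : H1) : Quat)
      = rcoord qbar (rotor (iu k) s * q) • (qbar : Quat) := by
    have := (frame qbar).sum_repr' ((rotor (iu k) s * q : H1) : Quat)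
    rw [Fin.sum_univ_succ] at this
    simp only [frame_zero, frame_succ] at this
    have h2 : ∀ j, inner ℝ ((iu j).val * (qbar : Quat)) ((rotor (iu k) s * q : H1) : Quat) = 0 := hp
    simp only [h2, zero_smul, Finset.sum_const_zero, add_zero] at this
    exact this.symm
  have hq2 : (q : Quat) = rotor (iu k) (-s) * ((rotor (iu k) s * q : H1) : Quat) := by
    rw [← Metric.unitSphere.coe_mul, ← mul_assoc, ← rotor_add, neg_add_cancel, rotor_zero, one_mul]
  have hmk : inner ℝ ((iu m).val * (qbar : Quat)) ((iu k).val * (qbar : Quat)) = 0 := by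
    rw [← frame_succ, ← frame_succ]
    exact (frame qbar).orthonormal.2 (by simpa using hm)
  rw [pcoord, hq2, hx, coe_rotor]
  simp only [mul_smul_comm, add_mul, smul_mul_assoc, one_mul, inner_smul_right, inner_add_right,
    hmk, inner_iu_mul_self]
  ring

/-- The derivative of a profile may be set to zero outside of `(-1, 1)`, so that it is bounded
and measurable. -/
lemma IsRegularProfile.exists_measurable {d : ℝ} {h h' : ℝ → ℝ} (hh : IsRegularProfile d h h') :
    ∃ g, IsRegularProfile d h g ∧ Measurable g ∧ ∃ C, ∀ r, |g r| ≤ C := by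
  obtain ⟨C, hC⟩ := hh.bounded
  have heq : EqOn ((Ioo (-1 : ℝ) 1).indicator (deriv h)) h' (Ioo (-1 : ℝ) 1) := fun r hr => by
    rw [indicator_of_mem hr, (hh.hasDerivAt r hr).deriv]
  refine ⟨(Ioo (-1 : ℝ) 1).indicator (deriv h), ⟨hh.continuous, hh.odd, ⟨C, fun r hr => ?_⟩,
    fun r hr => ?_, fun r hr => ?_⟩, (measurable_deriv h).indicator measurableSet_Ioo, |C|,
    fun r => ?_⟩
  · rw [heq hr]; exact hC r hr
  · rw [heq hr]; exact hh.hasDerivAt r hr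
  · rw [heq hr]
    exact (hh.hasDerivAt_snd r hr).congr_of_eventuallyEq
      (heq.eventuallyEq_of_mem (isOpen_Ioo.mem_nhds hr))
  · by_cases hr : r ∈ Ioo (-1 : ℝ) 1
    · rw [heq hr]; exact (hC r hr).trans (le_abs_self C)
    · rw [indicator_of_notMem hr, abs_zero]; exact abs_nonneg C

/-- The generalized collision invariants: the components of `h(qbar · q) Im (q qbar*)`. -/
def gci (h : ℝ → ℝ) (k : Fin 3) (qbar q : H1) : ℝ := pcoord qbar k q * h (rcoord qbar q)

lemma integrable_mul_of_bounded {u g : H1 → ℝ} (hu : Continuous u) (hg : Measurable g) {C : ℝ}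
    (hC : ∀ q, |g q| ≤ C) : Integrable (fun q => u q * g q) dq :=
  (integrable_of_continuous hu).mul_bdd (c := C) hg.aestronglyMeasurable
    (Eventually.of_forall hC)

lemma sum_inner_iu_mul_mul_pcoord (l : Fin 3) (qbar q : H1) :
    ∑ k, inner ℝ ((iu l).val * (qbar : Quat)) ((iu k).val * (q : Quat)) * pcoord qbar k q
      = rcoord qbar q * pcoord qbar l q := by
  simp only [pcoord, rcoord, inner_quat, val_iu, Fin.sum_univ_three]
  fin_cases l <;> simp <;> ring

/-- The collision operator, integrated against an invariant, gives a component of the gradient of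
the energy `q · Q_f q` at `qbar`: two integrations by parts, where the profile equation removes
all other terms. -/
theorem integral_sum_fluxDeriv_mul_gci {ν D : ℝ} (hν : 0 < ν) (hD : 0 < D) {h h' : ℝ → ℝ}
    (hh' : IsRegularProfile (D / ν) h h') {f : H1 → ℝ} {X Y : Fin 3 → H1 → ℝ}
    (hf : HasFrameDerivs f X Y) (qbar : H1) (l : Fin 3) :
    ∫ q, (∑ k, fluxDeriv ν D qbar f X Y k q) * gci h l qbar q ∂dq
      = D / 4 * ∫ q, f q * (rcoord qbar q * pcoord qbar l q) ∂dq := by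
  obtain ⟨g, hh, hgm, C, hC⟩ := hh'.exists_measurable
  have hr := continuous_rcoord qbar
  have hp := continuous_pcoord qbar
  have hfc := hf.continuous
  have hhc := hh.continuous
  have hψ : Continuous (gci h l qbar) := (hp l).mul (hhc.comp hr)
  set β : Fin 3 → H1 → ℝ := fun k q =>
    inner ℝ ((iu l).val * (qbar : Quat)) ((iu k).val * (q : Quat)) with hβ
  have hβc : ∀ k, Continuous (β k) := fun k => by simp only [hβ]; fun_prop
  set g' : ℝ → ℝ := fun r => profileSnd (D / ν) r (h r) (g r) with hg'
  have hg'm : Measurable g' := by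
    simp only [hg', profileSnd, pot]
    fun_prop
  -- the first and second derivatives of `gci h l qbar` along the flow of `iu k`
  set G : Fin 3 → H1 → ℝ := fun k q => β k q * h (rcoord qbar q)
    + pcoord qbar l q * (g (rcoord qbar q) * -pcoord qbar k q) with hG
  set G' : Fin 3 → H1 → ℝ := fun k q => -pcoord qbar l q * h (rcoord qbar q)
    + β k q * (g (rcoord qbar q) * -pcoord qbar k q)
    + (β k q * (g (rcoord qbar q) * -pcoord qbar k q)
      + pcoord qbar l q * (g' (rcoord qbar q) * -pcoord qbar k q * -pcoord qbar k q
        + g (rcoord qbar q) * -rcoord qbar q)) with hG'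
  have hgr : Measurable fun q => g (rcoord qbar q) := hgm.comp hr.measurable
  have hg'r : Measurable fun q => g' (rcoord qbar q) := hg'm.comp hr.measurable
  have hC0 : 0 ≤ C := (abs_nonneg _).trans (hC 0)
  obtain ⟨C', hC'⟩ : ∃ C', ∀ k q, |g' (rcoord qbar q) * pcoord qbar k q ^ 2| ≤ C' := by
    have hc1 : Continuous fun r => pot (D / ν) r * h r + r := by unfold pot; fun_prop
    have hc2 : Continuous fun r : ℝ => 5 * r - 4 / (D / ν) * r * (1 - r ^ 2) := by fun_prop
    obtain ⟨B₁, hB₁⟩ := isCompact_Icc.exists_bound_of_continuousOn (s := Icc (-1 : ℝ) 1)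
      hc1.continuousOn
    obtain ⟨B₂, hB₂⟩ := isCompact_Icc.exists_bound_of_continuousOn (s := Icc (-1 : ℝ) 1)
      hc2.continuousOn
    refine ⟨B₁ + B₂ * C, fun k q => ?_⟩
    have hm := rcoord_mem qbar q
    have h1 := pcoord_sq_le qbar k q
    have h2 : 0 ≤ 1 - rcoord qbar q ^ 2 := (sq_nonneg _).trans h1
    have e1 := hB₁ _ hm
    have e2 := hB₂ _ hm
    rw [Real.norm_eq_abs] at e1 e2
    have hnum : |(pot (D / ν) (rcoord qbar q) * h (rcoord qbar q) + rcoord qbar q)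
        + (5 * rcoord qbar q - 4 / (D / ν) * rcoord qbar q * (1 - rcoord qbar q ^ 2))
          * g (rcoord qbar q)| ≤ B₁ + B₂ * C := by
      refine (abs_add_le _ _).trans (add_le_add e1 ?_)
      rw [abs_mul]
      exact mul_le_mul e2 (hC _) (abs_nonneg _) ((abs_nonneg _).trans e2)
    rw [abs_mul, abs_of_nonneg (sq_nonneg (pcoord qbar k q))]
    refine (mul_le_mul_of_nonneg_left h1 (abs_nonneg _)).trans (le_trans ?_ hnum)
    rcases h2.eq_or_lt with h3 | h3
    · rw [← h3, mul_zero]; exact abs_nonneg _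
    · simp only [hg', profileSnd]
      rw [abs_div, abs_of_pos h3, div_mul_cancel₀ _ h3.ne']
      refine le_of_eq ?_
      congr 1
      ring
  have hgi : ∀ {u : H1 → ℝ}, Continuous u → Integrable (fun q => u q * g (rcoord qbar q)) dq :=
    fun hu => integrable_mul_of_bounded hu hgr fun q => hC _
  have hi1 : ∀ k {u : H1 → ℝ}, Continuous u → Integrable (fun q => u q * G k q) dq := by
    intro k u hu
    have h1 : Integrable (fun q => u q * β k q * h (rcoord qbar q)) dq :=
      integrable_of_continuous ((hu.mul (hβc k)).mul (hhc.comp hr))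
    have h2 := hgi (u := fun q => u q * pcoord qbar l q * -pcoord qbar k q)
      ((hu.mul (hp l)).mul (hp k).neg)
    refine (h1.add h2).congr (Eventually.of_forall fun q => ?_)
    simp only [hG, Pi.add_apply]
    ring
  have hi2 : ∀ k {u : H1 → ℝ}, Continuous u → Integrable (fun q => u q * G' k q) dq := by
    intro k u hu
    have h1 : Integrable (fun q => u q * -pcoord qbar l q * h (rcoord qbar q)) dq :=
      integrable_of_continuous ((hu.mul (hp l).neg).mul (hhc.comp hr))
    have h2 := hgi (u := fun q => u q * (-2 * β k q * pcoord qbar k q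
      - pcoord qbar l q * rcoord qbar q))
      (hu.mul (((continuous_const.mul (hβc k)).mul (hp k)).sub ((hp l).mul hr)))
    have h3 := integrable_mul_of_bounded (u := fun q => u q * pcoord qbar l q) (hu.mul (hp l))
      (hg'r.mul ((hp k).measurable.pow_const 2)) (hC' k)
    refine ((h1.add h2).add h3).congr (Eventually.of_forall fun q => ?_)
    simp only [hG', Pi.add_apply, Pi.mul_apply]
    ring
  have hGm : ∀ k, Measurable (G k) := fun k => by
    have h1 := (hβc k).measurable
    have h2 := (hp k).measurable
    have h3 := (hp l).measurable
    have h4 : Measurable fun q => h (rcoord qbar q) := (hhc.comp hr).measurable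
    simp only [hG]
    fun_prop
  have hGm' : ∀ k, Measurable (G' k) := fun k => by
    have h1 := (hβc k).measurable
    have h2 := (hp k).measurable
    have h3 := (hp l).measurable
    have h4 : Measurable fun q => h (rcoord qbar q) := (hhc.comp hr).measurable
    have h5 := hr.measurable
    simp only [hG']
    fun_prop
  have hX := hf.continuous_fst
  have hF := hf.continuous_fluxDeriv ν D qbar
  -- the flow derivative of `flux * ψ - D / 4 f ∇ψ`
  set b : Fin 3 → H1 → ℝ := fun k q => fluxDeriv ν D qbar f X Y k q * gci h l qbar q
    + (ν * (f q * rcoord qbar q * pcoord qbar k q) * G k q + -(D / 4) * f q * G' k q) with hb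
  have hbm : ∀ k, Measurable (b k) := fun k => by
    have h1 := (hF k).measurable
    have h2 := hψ.measurable
    have h3 := hfc.measurable
    have h4 := hr.measurable
    have h5 := (hp k).measurable
    have h6 := hGm k
    have h7 := hGm' k
    simp only [hb]
    fun_prop
  have hbi : ∀ k, Integrable (b k) dq := fun k =>
    (integrable_of_continuous ((hF k).mul hψ)).add
      ((hi1 k (continuous_const.mul ((hfc.mul hr).mul (hp k)))).add
        (hi2 k (continuous_const.mul hfc)))
  have hb0 : ∀ k, ∫ q, b k q ∂dq = 0 := fun k => by
    refine integral_flowDeriv_eq_zero (ξ := iu k) (a := fun q => flux ν D qbar f X k q * gci h l qbar q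
      + -(D / 4) * (f q * G k q)) (hbm k) (hbi k) ?_
    filter_upwards [ae_forall_rcoord_mem qbar k] with q hq s
    specialize hq s
    set p := rotor (iu k) s * q
    have hpl : HasFlowDeriv (iu k) (pcoord qbar l) (β k p) p :=
      hasFlowDeriv_inner (iu k) ((iu l).val * qbar) p
    have hβd : HasFlowDeriv (iu k) (β k) (-pcoord qbar l p) p := by
      have h1 := hasFlowDeriv_inner (iu k) (-((iu k).val * ((iu l).val * (qbar : Quat)))) p
      rw [inner_iu_mul_comm, mul_neg, iu_mul_iu_mul, neg_neg] at h1
      refine h1.congr (fun x => ?_) rfl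
      simp only [hβ]
      rw [inner_iu_mul_comm, inner_neg_left]
    have hrd := hasFlowDeriv_rcoord qbar k p
    have hhd := hrd.comp (hh.hasDerivAt _ hq)
    have hgd := hrd.comp (hh.hasDerivAt_snd _ hq)
    have hpk := hasFlowDeriv_pcoord qbar k p
    have hψd : HasFlowDeriv (iu k) (gci h l qbar) (G k p) p :=
      (hpl.mul hhd).congr (fun _ => rfl) rfl
    have hGd : HasFlowDeriv (iu k) (G k) (G' k p) p := by
      refine ((hβd.mul hhd).add (hpl.mul (hgd.mul (hpk.const_mul (-1))))).congr (fun x => ?_) ?_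
      · simp only [hG]; ring
      · simp only [hG', hg']; ring
    refine (((hf.hasFlowDeriv_flux ν D qbar k p).mul hψd).add
      (((hf.flow_iu k p).mul hGd).const_mul (-(D / 4)))).congr (fun _ => rfl) ?_
    simp only [hb, flux]
    ring
  have hsum : ∫ q, ∑ k, b k q ∂dq = 0 := by
    rw [integral_finsetSum _ fun k _ => hbi k]
    exact Finset.sum_eq_zero fun k _ => hb0 k
  have hpt : ∀ q, ∑ k, b k q = (∑ k, fluxDeriv ν D qbar f X Y k q) * gci h l qbar q
      - D / 4 * (f q * (rcoord qbar q * pcoord qbar l q)) := fun q => by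
    have h1 := sum_inner_iu_mul_mul_pcoord l qbar q
    have h2 := sum_sq_coord qbar q
    have h3 : pcoord qbar l q * ((1 - rcoord qbar q ^ 2) * g' (rcoord qbar q))
        = pcoord qbar l q * (pot (D / ν) (rcoord qbar q) * h (rcoord qbar q) + rcoord qbar q
          + 5 * rcoord qbar q * g (rcoord qbar q)
          - 4 / (D / ν) * rcoord qbar q * (1 - rcoord qbar q ^ 2) * g (rcoord qbar q)) := by
      by_cases h0 : pcoord qbar l q = 0
      · simp [h0]
      · have := pcoord_sq_le qbar l q
        have : 0 < pcoord qbar l q ^ 2 := by positivity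
        have : 1 - rcoord qbar q ^ 2 ≠ 0 := by linarith
        simp only [hg', profileSnd]
        rw [mul_div_cancel₀ _ this]
    have hdν : 4 / (D / ν) * D = 4 * ν := by field_simp
    simp only [pot] at h3
    generalize 4 / (D / ν) = κ at h3 hdν
    simp only [Fin.sum_univ_three] at h1 h2 ⊢
    simp only [hb, hG, hG']
    linear_combination (ν * f q * rcoord qbar q * h (rcoord qbar q)
        + D / 2 * f q * g (rcoord qbar q)) * h1
      + (-ν * f q * rcoord qbar q * pcoord qbar l q * g (rcoord qbar q)
        - D / 4 * f q * pcoord qbar l q * g' (rcoord qbar q)) * h2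
      - D / 4 * f q * h3 - 1 / 4 * f q * pcoord qbar l q * (rcoord qbar q ^ 2 * h (rcoord qbar q)
        - rcoord qbar q * (1 - rcoord qbar q ^ 2) * g (rcoord qbar q)) * hdν
  simp only [hpt] at hsum
  rw [integral_sub, integral_const_mul] at hsum
  · linarith
  · exact integrable_of_continuous ((continuous_finsetSum _ fun k _ => hF k).mul hψ)
  · exact integrable_of_continuous (continuous_const.mul (hfc.mul (hr.mul (hp l))))

/-! ### Mean quaternions -/

lemma inner_qTensor {g : H1 → ℝ} (hg : Integrable g dq) (p : H1) :
    inner ℝ (p : Quat) (qTensor g p) = ∫ q, g q * (rcoord p q ^ 2 - 1 / 4) ∂dq := by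
  have hi : Integrable (fun q : H1 => g q • (inner ℝ (q : Quat) (p : Quat) • (q : Quat)
      - (1 / 4 : ℝ) • (p : Quat))) dq := by
    have hc : Continuous fun q : H1 => inner ℝ (q : Quat) (p : Quat) • (q : Quat)
      - (1 / 4 : ℝ) • (p : Quat) := by fun_prop
    obtain ⟨C, hC⟩ := isCompact_univ.exists_bound_of_continuousOn hc.continuousOn
    exact hg.smul_bdd C hc.aestronglyMeasurable (Eventually.of_forall fun q => hC q trivial)
  rw [qTensor, ← integral_inner hi]
  refine integral_congr_ae (Eventually.of_forall fun q => ?_)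
  simp only [inner_smul_right, inner_sub_right, real_inner_self_eq_norm_sq, norm_coe_H1, rcoord]
  rw [real_inner_comm (q : Quat) (p : Quat)]
  ring

lemma integrable_mul_rcoord_sq {g : H1 → ℝ} (hg : Integrable g dq) (p : H1) :
    Integrable (fun q => g q * rcoord p q ^ 2) dq :=
  integrable_mul_continuous hg ((continuous_rcoord p).pow 2)

/-- A mean quaternion maximises the second moment of the component along it. -/
lemma IsMeanQuat.integral_le {g : H1 → ℝ} (hg : Integrable g dq) {qbar : H1}
    (h : IsMeanQuat g qbar) (p : H1) :
    ∫ q, g q * rcoord p q ^ 2 ∂dq ≤ ∫ q, g q * rcoord qbar q ^ 2 ∂dq := by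
  have h1 := h p
  rw [inner_qTensor hg, inner_qTensor hg] at h1
  simp only [mul_sub] at h1
  rw [integral_sub (integrable_mul_rcoord_sq hg p) (hg.mul_const _),
    integral_sub (integrable_mul_rcoord_sq hg qbar) (hg.mul_const _)] at h1
  linarith

lemma rcoord_rotor_mul (l : Fin 3) (s : ℝ) (qbar q : H1) :
    rcoord (rotor (iu l) s * qbar) q = Real.cos s * rcoord qbar q + Real.sin s * pcoord qbar l q := by
  rw [rcoord, Metric.unitSphere.coe_mul, coe_rotor, add_mul, inner_add_left, smul_mul_assoc, one_mul,
    smul_mul_assoc, real_inner_smul_left, real_inner_smul_left]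
  rfl

/-- The gradient of the energy vanishes at a mean quaternion. -/
lemma IsMeanQuat.integral_eq_zero {g : H1 → ℝ} (hg : Integrable g dq) {qbar : H1}
    (h : IsMeanQuat g qbar) (l : Fin 3) :
    ∫ q, g q * (rcoord qbar q * pcoord qbar l q) ∂dq = 0 := by
  have hr := continuous_rcoord qbar
  have hp := continuous_pcoord qbar l
  set A := ∫ q, g q * rcoord qbar q ^ 2 ∂dq
  set B := ∫ q, g q * (rcoord qbar q * pcoord qbar l q) ∂dq with hB
  set C := ∫ q, g q * pcoord qbar l q ^ 2 ∂dq
  have hE : ∀ s, ∫ q, g q * rcoord (rotor (iu l) s * qbar) q ^ 2 ∂dq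
      = Real.cos s ^ 2 * A + (2 * Real.cos s * Real.sin s * B + Real.sin s ^ 2 * C) := fun s => by
    have i1 := (integrable_mul_continuous hg (hr.pow 2)).const_mul (Real.cos s ^ 2)
    have i2 := (integrable_mul_continuous hg (hr.mul hp)).const_mul (2 * Real.cos s * Real.sin s)
    have i3 := (integrable_mul_continuous hg (hp.pow 2)).const_mul (Real.sin s ^ 2)
    have e1 := integral_add i1 (i2.add i3)
    have e2 := integral_add i2 i3
    simp only [integral_const_mul, Pi.add_apply, Pi.pow_apply, Pi.mul_apply] at e1 e2
    rw [← e2, ← e1]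
    refine integral_congr_ae (Eventually.of_forall fun q => ?_)
    simp only [rcoord_rotor_mul]
    ring
  have hmax : IsLocalMax (fun s => Real.cos s ^ 2 * A
      + (2 * Real.cos s * Real.sin s * B + Real.sin s ^ 2 * C)) 0 :=
    Eventually.of_forall fun s => by
      have := h.integral_le hg (rotor (iu l) s * qbar)
      rw [hE] at this
      simpa using this
  have hd : HasDerivAt (fun s => Real.cos s ^ 2 * A
      + (2 * Real.cos s * Real.sin s * B + Real.sin s ^ 2 * C)) (2 * B) 0 := by
    refine ((((Real.hasDerivAt_cos 0).pow 2).mul_const A).add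
      (((((Real.hasDerivAt_cos 0).const_mul 2).mul (Real.hasDerivAt_sin 0)).mul_const B).add
        (((Real.hasDerivAt_sin 0).pow 2).mul_const C))).congr_deriv ?_
    simp
  linarith [hmax.hasDerivAt_eq_zero hd]

/-- The collision operator is orthogonal to the invariants at its mean quaternion. -/
theorem integral_collision_mul_gci {ν D : ℝ} (hν : 0 < ν) (hD : 0 < D) {h h' : ℝ → ℝ}
    (hh : IsRegularProfile (D / ν) h h') {f : H1 → ℝ} (hf : ContDiffOn ℝ 2 (homExt f) {0}ᶜ)
    {qbar : H1} (hq : IsMeanQuat f qbar) (k : Fin 3) :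
    ∫ q, collision ν D qbar f q * gci h k qbar q ∂dq = 0 := by
  obtain ⟨X, Y, hXY, hcol⟩ := collision_eq_of_contDiffOn hf
  have h1 := integral_sum_fluxDeriv_mul_gci hν hD hh hXY qbar k
  rw [hq.integral_eq_zero (integrable_of_continuous hXY.continuous) k, mul_zero] at h1
  rw [← h1]
  refine integral_congr_ae (Eventually.of_forall fun q => ?_)
  simp only [hcol, fluxDeriv]

/-- Conservation of mass by the collision operator. -/
lemma integral_collision {f : H1 → ℝ} (hf : ContDiffOn ℝ 2 (homExt f) {0}ᶜ) (ν D : ℝ) (qbar : H1) :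
    ∫ q, collision ν D qbar f q ∂dq = 0 := by
  obtain ⟨X, Y, hXY, hcol⟩ := collision_eq_of_contDiffOn hf
  have h1 := integral_sum_fluxDeriv_mul hXY ν D qbar (φ := fun _ => 1) (Φ := fun _ _ => 0)
    continuous_const (fun _ => continuous_const) fun k q => hasDerivAt_const _ _
  simp only [mul_one, mul_zero, Finset.sum_const_zero, integral_zero, neg_zero] at h1
  rw [← h1]
  refine integral_congr_ae (Eventually.of_forall fun q => ?_)
  simp only [hcol, fluxDeriv]

/-- The limit of the kinetic equation, tested with functions that annihilate the collision
operator. -/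
theorem IsKineticFamily.integral_limit_eq_zero {ν D : ℝ} {e₁ : E3} {T ε₀ : ℝ}
    {f : ℝ → ℝ → E3 → H1 → ℝ} (hε₀ : 0 < ε₀) (hf : IsKineticFamily ν D e₁ T ε₀ f)
    {t : ℝ} (ht : t ∈ Ioo 0 T) (x : E3) {qbar : ℝ → H1}
    (heq : (fun ε => ∫ q, |transport e₁ (f ε) t x q
          - 1 / ε * collision ν D (qbar ε) (f ε t x) q| ∂dq) =O[𝓝[>] (0 : ℝ)] (fun ε => ε))
    {u : H1 → ℝ} {w : Fin 3 → H1 → ℝ}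
    (h1 : TendstoL1 (fun ε q => deriv (fun s => f ε s x q) t) u)
    (h2 : ∀ i, TendstoL1 (fun ε q => partialX i (fun y => f ε t y q) x) (w i))
    {l : Filter ℝ} [l.NeBot] (hl : l ≤ 𝓝[>] (0 : ℝ)) {K : H1 → H1 → ℝ}
    (hK : Continuous (Function.uncurry K)) {p : ℝ → H1} {p₀ : H1} (hp : Tendsto p l (𝓝 p₀))
    (h0 : ∀ ε ∈ Ioo 0 ε₀, ∫ q, collision ν D (qbar ε) (f ε t x) q * K (p ε) q ∂dq = 0) :
    ∫ q, u q * K p₀ q ∂dq + ∑ i, ∫ q, w i q * (rotate e₁ q i * K p₀ q) ∂dq = 0 := by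
  have hKi : ∀ i, Continuous (Function.uncurry fun p q : H1 => rotate e₁ q i * K p q) := fun i =>
    ((continuous_rotate e₁ i).comp continuous_snd).mul hK
  have hKc := continuous_uncurry_right hK
  have hlim := (tendsto_integral_mul hl h1 hK hp).add
    (tendsto_finsetSum Finset.univ fun i _ => tendsto_integral_mul hl (h2 i) (hKi i) hp)
  refine tendsto_nhds_unique hlim ?_
  obtain ⟨C, -, hC⟩ := exists_abs_le_of_continuous hK
  have hid : Tendsto (fun ε : ℝ => ε) (𝓝[>] (0 : ℝ)) (𝓝 0) := tendsto_nhdsWithin_of_tendsto_nhds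
    tendsto_id
  have h3 := ((heq.trans_tendsto hid).mono_left hl).const_mul C
  rw [mul_zero] at h3
  refine squeeze_zero_norm' ?_ h3
  filter_upwards [hl (Ioo_mem_nhdsGT hε₀)] with ε hε
  obtain ⟨c1, c2, _⟩ := hf.continuous_derivs hε ht x
  have c3 := hf.continuous_transport hε ht x
  have c4 := continuous_collision (hf.contDiff_two ε hε t ht x) ν D (qbar ε)
  have c5 := continuous_rotate e₁
  have c6 := hKc (p ε)
  have e1 : ∫ q, deriv (fun s => f ε s x q) t * K (p ε) q ∂dq
      + ∑ i, ∫ q, partialX i (fun y => f ε t y q) x * (rotate e₁ q i * K (p ε) q) ∂dq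
      = ∫ q, (transport e₁ (f ε) t x q - 1 / ε * collision ν D (qbar ε) (f ε t x) q)
        * K (p ε) q ∂dq := by
    have i1 : Integrable (fun q => transport e₁ (f ε) t x q * K (p ε) q) dq :=
      integrable_of_continuous (c3.mul c6)
    have i2 : Integrable (fun q => collision ν D (qbar ε) (f ε t x) q * K (p ε) q) dq :=
      integrable_of_continuous (c4.mul c6)
    have e2 : ∀ q, (transport e₁ (f ε) t x q - 1 / ε * collision ν D (qbar ε) (f ε t x) q)
        * K (p ε) q = transport e₁ (f ε) t x q * K (p ε) q
          - 1 / ε * (collision ν D (qbar ε) (f ε t x) q * K (p ε) q) := fun q => by ring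
    simp only [e2]
    rw [integral_sub i1 (i2.const_mul _), integral_const_mul, h0 ε hε, mul_zero, sub_zero,
      ← integral_finsetSum, ← integral_add]
    · refine integral_congr_ae (Eventually.of_forall fun q => ?_)
      simp only [hf.transport_eq hε ht x, add_mul, Finset.sum_mul, mul_assoc]
    · exact integrable_of_continuous (c1.mul c6)
    · exact integrable_of_continuous (continuous_finsetSum _ fun i _ => (c2 i).mul ((c5 i).mul c6))
    · exact fun i _ => integrable_of_continuous ((c2 i).mul ((c5 i).mul c6))
  rw [e1, ← integral_const_mul]
  refine (norm_integral_le_integral_norm _).trans (integral_mono ?_ ?_ fun q => ?_)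
  · exact integrable_of_continuous ((c3.sub (continuous_const.mul c4)).mul c6).norm
  · exact integrable_of_continuous (continuous_const.mul (c3.sub (continuous_const.mul c4)).abs)
  · simp only
    rw [norm_mul, Real.norm_eq_abs, Real.norm_eq_abs, mul_comm]
    exact mul_le_mul_of_nonneg_right (hC _ _) (abs_nonneg _)

/-! ### Moments against the equilibrium -/

lemma integral_comp_mul_right (v : H1) (f : H1 → ℝ) : ∫ y, f (y * v) ∂dq = ∫ q, f q ∂dq :=
  integral_mul_right_eq_self f v

/-- Only the even part under `y ↦ y*` contributes to an integral. -/
lemma integral_eq_of_even_part {Ξ E : H1 → ℝ} (hΞ : Continuous Ξ) (hE : Continuous E)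
    (h : ∀ y : H1, Ξ (sphereMap starIso y) + Ξ y = 2 * E y) : ∫ y, Ξ y ∂dq = ∫ y, E y ∂dq := by
  have h0 : ∫ y, (Ξ y - E y) ∂dq = 0 := by
    have hs : ∫ y, (Ξ (sphereMap starIso y) - Ξ y) ∂dq = 0 := by
      have hc : Continuous fun y => Ξ (sphereMap starIso y) := hΞ.comp (continuous_sphereMap _)
      rw [integral_sub (integrable_of_continuous hc) (integrable_of_continuous hΞ),
        integral_comp_sphereMap, sub_self]
    have h2 : ∀ y, Ξ y - E y = -(1 / 2) * (Ξ (sphereMap starIso y) - Ξ y) := fun y => by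
      linear_combination (1 / 2) * h y
    simp only [h2]
    rw [integral_const_mul, hs, mul_zero]
  rw [integral_sub (integrable_of_continuous hΞ) (integrable_of_continuous hE)] at h0
  linarith

lemma continuous_imVec (a : Fin 3) : Continuous fun q : H1 => imVec (q : Quat) a := by
  fin_cases a
  · exact Quaternion.continuous_imI.comp continuous_subtype_val
  · exact Quaternion.continuous_imJ.comp continuous_subtype_val
  · exact Quaternion.continuous_imK.comp continuous_subtype_val

lemma starIso_re (y : H1) : ((sphereMap starIso y : H1) : Quat).re = (y : Quat).re :=
  Quaternion.re_star _

lemma starIso_imVec (y : H1) (a : Fin 3) :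
    imVec ((sphereMap starIso y : H1) : Quat) a = -imVec (y : Quat) a := by
  have h : ((sphereMap starIso y : H1) : Quat) = star (y : Quat) := rfl
  rw [h]
  fin_cases a <;> simp

lemma continuous_sum_mul_imVec (c : E3) : Continuous fun q : H1 => ∑ a, c a * imVec (q : Quat) a :=
  continuous_finsetSum _ fun a _ => continuous_const.mul (continuous_imVec a)

lemma integral_lin_moment {φ : ℝ → ℝ} (hφ : Continuous φ) (c : E3) (k : Fin 3) :
    ∫ y : H1, φ (y : Quat).re * ((∑ a, c a * imVec y a) * imVec y k) ∂dq
      = c k / 3 * ∫ y : H1, φ (y : Quat).re * (1 - (y : Quat).re ^ 2) ∂dq := by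
  have hre := hφ.comp continuous_re_coe
  have him := continuous_imVec
  have e : ∀ y : H1, φ (y : Quat).re * ((∑ a, c a * imVec y a) * imVec y k)
      = ∑ a, c a * (φ (y : Quat).re * (imVec y a * imVec y k)) := fun y => by
    rw [Finset.sum_mul, Finset.mul_sum]
    exact Finset.sum_congr rfl fun a _ => by ring
  have hi : ∀ a, Integrable (fun y : H1 =>
      c a * (φ (y : Quat).re * (imVec y a * imVec y k))) dq := fun a =>
    integrable_of_continuous (continuous_const.mul (hre.mul ((him a).mul (him k))))
  simp only [e]
  rw [integral_finsetSum _ fun a _ => hi a]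
  simp only [integral_const_mul, integral_two_moment hφ]
  fin_cases k <;> simp [Fin.sum_univ_three] <;> ring

lemma integral_cubic_moment {φ : ℝ → ℝ} (hφ : Continuous φ) (v : E3) (ω : Fin 3 → E3) (k : Fin 3) :
    ∫ y : H1, φ (y : Quat).re * ((∑ b, v b * imVec y b)
        * (∑ i, imVec y i * ∑ a, ω i a * imVec y a) * imVec y k) ∂dq
      = (∑ i, v i * ω i k + ∑ a, ω k a * v a + (∑ i, ω i i) * v k) / 15
        * ∫ y : H1, φ (y : Quat).re * (1 - (y : Quat).re ^ 2) ^ 2 ∂dq := by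
  have hre := hφ.comp continuous_re_coe
  have him := continuous_imVec
  have e : ∀ y : H1, φ (y : Quat).re * ((∑ b, v b * imVec y b)
        * (∑ i, imVec y i * ∑ a, ω i a * imVec y a) * imVec y k)
      = ∑ b, ∑ i, ∑ a, v b * ω i a
        * (φ (y : Quat).re * (imVec y b * imVec y i * imVec y a * imVec y k)) := fun y => by
    simp only [Fin.sum_univ_three]
    ring
  have hi : ∀ b i a, Integrable (fun y : H1 => v b * ω i a
      * (φ (y : Quat).re * (imVec y b * imVec y i * imVec y a * imVec y k))) dq := fun b i a =>
    integrable_of_continuous (continuous_const.mul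
      (hre.mul ((((him b).mul (him i)).mul (him a)).mul (him k))))
  simp only [e]
  rw [integral_finsetSum _ fun b _ => integrable_finsetSum _ fun i _ =>
    integrable_finsetSum _ fun a _ => hi b i a]
  have h2 : ∀ b, ∫ y : H1, ∑ i, ∑ a, v b * ω i a
        * (φ (y : Quat).re * (imVec y b * imVec y i * imVec y a * imVec y k)) ∂dq
      = ∑ i, ∑ a, v b * ω i a * (delta4 b i a k / 15
        * ∫ y : H1, φ (y : Quat).re * (1 - (y : Quat).re ^ 2) ^ 2 ∂dq) := fun b => by
    rw [integral_finsetSum _ fun i _ => integrable_finsetSum _ fun a _ => hi b i a]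
    refine Finset.sum_congr rfl fun i _ => ?_
    rw [integral_finsetSum _ fun a _ => hi b i a]
    refine Finset.sum_congr rfl fun a _ => ?_
    rw [integral_const_mul, integral_four_moment hφ]
  simp only [h2]
  fin_cases k <;> simp [Fin.sum_univ_three, delta4] <;> ring

lemma hasDerivAt_gibbsFun (d r : ℝ) : HasDerivAt (gibbsFun d) (gibbsFun d r * (4 / d * r)) r := by
  have h1 : HasDerivAt (fun r : ℝ => 2 / d * (r ^ 2 - 1 / 4)) (4 / d * r) r := by
    refine (((hasDerivAt_pow 2 r).sub_const (1 / 4)).const_mul (2 / d)).congr_deriv ?_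
    push_cast
    ring
  exact h1.exp

/-- The excess of the second moment of the equilibrium along its axis. -/
lemma integral_gibbsFun_identity (d : ℝ) :
    ∫ y : H1, gibbsFun d (y : Quat).re * ((4 * (y : Quat).re ^ 2 - 1) / 3) ∂dq
      = 4 / d / 3 * ∫ y : H1, gibbsFun d (y : Quat).re * (y : Quat).re ^ 2
        * (1 - (y : Quat).re ^ 2) ∂dq := by
  have hg := continuous_gibbsFun d
  have hre := continuous_re_coe
  have hr := continuous_rcoord 1
  have hp := continuous_pcoord 1
  have hgd := hasDerivAt_gibbsFun d
  set b : Fin 3 → H1 → ℝ := fun k q => (gibbsFun d (rcoord 1 q) * (4 / d * rcoord 1 q)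
    * rcoord 1 q + gibbsFun d (rcoord 1 q)) * -pcoord 1 k q * pcoord 1 k q
      + gibbsFun d (rcoord 1 q) * rcoord 1 q * rcoord 1 q with hb
  have hbc : ∀ k, Continuous (b k) := fun k => by simp only [hb]; fun_prop
  have h0 : ∀ k, ∫ q, b k q ∂dq = 0 := fun k =>
    integral_flowDeriv_eq_zero_of_continuous (ξ := iu k)
      (a := fun q => gibbsFun d (rcoord 1 q) * rcoord 1 q * pcoord 1 k q) (hbc k) fun q => by
      refine ((hasFlowDeriv_rcoord 1 k q).comp
        (φ := fun r => gibbsFun d r * r) ((hgd _).mul (hasDerivAt_id' _))).mul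
        (hasFlowDeriv_pcoord 1 k q) |>.congr (fun _ => rfl) ?_
      simp only [hb]
      ring
  have hsum : ∫ q, ∑ k, b k q ∂dq = 0 := by
    rw [integral_finsetSum _ fun k _ => integrable_of_continuous (hbc k)]
    exact Finset.sum_eq_zero fun k _ => h0 k
  have hpt : ∀ q, ∑ k, b k q = 3 * (gibbsFun d (q : Quat).re * ((4 * (q : Quat).re ^ 2 - 1) / 3))
      - 4 / d * (gibbsFun d (q : Quat).re * (q : Quat).re ^ 2 * (1 - (q : Quat).re ^ 2)) := fun q => by
    have h3 := sum_sq_coord 1 q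
    simp only [hb]
    rw [← rcoord_one]
    rw [Fin.sum_univ_three] at h3 ⊢
    linear_combination (-(gibbsFun d (rcoord 1 q) * (4 / d * rcoord 1 q) * rcoord 1 q
      + gibbsFun d (rcoord 1 q))) * h3
  simp only [hpt] at hsum
  rw [integral_sub, integral_const_mul, integral_const_mul] at hsum
  · linarith
  · exact integrable_of_continuous (by fun_prop)
  · exact integrable_of_continuous (by fun_prop)

lemma integral_gibbsFun_pos {d : ℝ} (hd : 0 < d) :
    0 < ∫ y : H1, gibbsFun d (y : Quat).re * ((4 * (y : Quat).re ^ 2 - 1) / 3) ∂dq := by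
  rw [integral_gibbsFun_identity]
  refine mul_pos (by positivity) ?_
  have hg := continuous_gibbsFun d
  have hre := continuous_re_coe
  have hc : Continuous fun y : H1 =>
      gibbsFun d (y : Quat).re * (y : Quat).re ^ 2 * (1 - (y : Quat).re ^ 2) := by fun_prop
  refine hc.integral_pos_of_hasCompactSupport_nonneg_nonzero (HasCompactSupport.of_compactSpace _)
    (fun y => ?_) (x := mkH (1 / 2) (1 / 2) (1 / 2) (1 / 2) (by norm_num)) ?_
  · have h1 := rcoord_mem 1 y
    rw [rcoord_one] at h1
    have h2 : 0 ≤ 1 - (y : Quat).re ^ 2 := by nlinarith [h1.1, h1.2]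
    have h3 : 0 ≤ gibbsFun d (y : Quat).re := (Real.exp_pos _).le
    exact mul_nonneg (mul_nonneg h3 (sq_nonneg _)) h2
  · have : ((mkH (1 / 2) (1 / 2) (1 / 2) (1 / 2) (by norm_num) : H1) : Quat).re = 1 / 2 := by
      simp [mkH]
    rw [this]
    have : gibbsFun d (1 / 2) ≠ 0 := (Real.exp_pos _).ne'
    norm_num [this]

/-! ### Coordinates relative to a mean quaternion -/

lemma rcoord_mul_right (p qbar y : H1) :
    rcoord p (y * qbar) = (y : Quat).re * rcoord qbar p
      + ∑ a, pcoord qbar a p * imVec y a := by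
  simp only [rcoord, pcoord, inner_quat, Metric.unitSphere.coe_mul, val_iu, Fin.sum_univ_three]
  simp
  ring

lemma rcoord_mul_self (qbar y : H1) : rcoord qbar (y * qbar) = (y : Quat).re := by
  have h1 : ∀ a, pcoord qbar a qbar = 0 := fun a => inner_iu_mul_self a qbar
  have h2 : rcoord qbar qbar = 1 := by
    rw [rcoord, real_inner_self_eq_norm_sq, norm_coe_H1, one_pow]
  rw [rcoord_mul_right, h2]
  simp [h1]

lemma pcoord_mul_self (qbar y : H1) (k : Fin 3) : pcoord qbar k (y * qbar) = imVec y k := by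
  have h := sq_sum_eq_norm_sq (qbar : Quat)
  rw [norm_coe_H1, one_pow] at h
  simp only [pcoord, inner_quat, Metric.unitSphere.coe_mul, val_iu]
  fin_cases k <;> simp
  · linear_combination (y : Quat).imI * h
  · linear_combination (y : Quat).imJ * h
  · linear_combination (y : Quat).imK * h

/-- A maximiser of the energy of an equilibrium is its axis, up to the sign. -/
lemma eq_or_eq_neg_of_integral_le {d : ℝ} (hd : 0 < d) {ρ : ℝ} (hρ : 0 < ρ) (qbar p : H1)
    (h : ∫ q, ρ * vonMises d qbar q * rcoord qbar q ^ 2 ∂dq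
      ≤ ∫ q, ρ * vonMises d qbar q * rcoord p q ^ 2 ∂dq) :
    (p : Quat) = qbar ∨ (p : Quat) = -qbar := by
  have hg := continuous_gibbsFun d
  have hre := continuous_re_coe
  have him := continuous_imVec
  have hZ := (integral_vonMises d qbar).1
  set Z := ∫ q, gibbs d qbar q ∂dq with hZd
  set R := ∫ y : H1, gibbsFun d (y : Quat).re * (y : Quat).re ^ 2 ∂dq with hR
  set S := ∫ y : H1, gibbsFun d (y : Quat).re * (1 - (y : Quat).re ^ 2) ∂dq with hS
  have hE : ∀ p, ∫ q, ρ * vonMises d qbar q * rcoord p q ^ 2 ∂dq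
      = ρ / Z * (rcoord qbar p ^ 2 * R + (1 - rcoord qbar p ^ 2) / 3 * S) := fun p => by
    set c : E3 := WithLp.toLp 2 (fun a => pcoord qbar a p) with hc
    have hlin := continuous_sum_mul_imVec c
    have hgr : Continuous fun y : H1 => gibbsFun d (y : Quat).re := hg.comp hre
    rw [← integral_comp_mul_right qbar]
    have e1 : ∀ y : H1, ρ * vonMises d qbar (y * qbar) * rcoord p (y * qbar) ^ 2
        = ρ / Z * (gibbsFun d (y : Quat).re
          * ((y : Quat).re * rcoord qbar p + ∑ a, c a * imVec y a) ^ 2) := fun y => by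
      rw [vonMises, gibbs, ← rcoord, rcoord_mul_self, rcoord_mul_right, ← hZd, gibbsFun]
      simp only [hc]
      ring
    simp only [e1]
    rw [integral_const_mul]
    congr 1
    have e2 := integral_eq_of_even_part (Ξ := fun y : H1 => gibbsFun d (y : Quat).re
        * ((y : Quat).re * rcoord qbar p + ∑ a, c a * imVec y a) ^ 2)
      (E := fun y => rcoord qbar p ^ 2 * (gibbsFun d (y : Quat).re * (y : Quat).re ^ 2)
        + ∑ k, c k * (gibbsFun d (y : Quat).re * ((∑ a, c a * imVec y a) * imVec y k)))
      (hgr.mul (((hre.mul continuous_const).add hlin).pow 2))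
      ((continuous_const.mul (hgr.mul (hre.pow 2))).add (continuous_finsetSum _ fun k _ =>
        continuous_const.mul (hgr.mul (hlin.mul (him k))))) fun y => by
        simp only [starIso_re, starIso_imVec, Fin.sum_univ_three]
        ring
    have hk : ∀ k, Integrable (fun y : H1 => c k * (gibbsFun d (y : Quat).re
        * ((∑ a, c a * imVec y a) * imVec y k))) dq := fun k =>
      integrable_of_continuous (continuous_const.mul (hgr.mul (hlin.mul (him k))))
    have h0 : Integrable (fun y : H1 => rcoord qbar p ^ 2
        * (gibbsFun d (y : Quat).re * (y : Quat).re ^ 2)) dq :=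
      integrable_of_continuous (by fun_prop)
    rw [e2, integral_add h0 (integrable_finsetSum _ fun k _ => hk k),
      integral_finsetSum _ fun k _ => hk k]
    simp only [integral_const_mul, integral_lin_moment hg]
    have h1 := sum_sq_coord qbar p
    rw [← hR, ← hS, ← h1]
    simp only [hc, Fin.sum_univ_three]
    ring
  have h1 : rcoord qbar qbar = 1 := by
    rw [rcoord, real_inner_self_eq_norm_sq, norm_coe_H1, one_pow]
  have hpos := integral_gibbsFun_pos hd
  have hRS : ∫ y : H1, gibbsFun d (y : Quat).re * ((4 * (y : Quat).re ^ 2 - 1) / 3) ∂dq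
      = R - 1 / 3 * S := by
    have i1 : Integrable (fun y : H1 => gibbsFun d (y : Quat).re * (y : Quat).re ^ 2) dq :=
      integrable_of_continuous (by fun_prop)
    have i2 : Integrable (fun y : H1 => 1 / 3 * (gibbsFun d (y : Quat).re
      * (1 - (y : Quat).re ^ 2))) dq := integrable_of_continuous (by fun_prop)
    rw [hR, hS, ← integral_const_mul, ← integral_sub i1 i2]
    congr 1
    ext y
    ring
  rw [hE, hE, h1] at h
  have h2 := le_of_mul_le_mul_left h (by positivity)
  rw [hRS] at hpos
  have hm := rcoord_mem qbar p
  have h3 : rcoord qbar p ^ 2 = 1 := by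
    refine le_antisymm (by nlinarith [hm.1, hm.2]) ?_
    by_contra hlt
    rw [not_le] at hlt
    nlinarith
  have h4 : rcoord qbar p = 1 ∨ rcoord qbar p = -1 :=
    sq_eq_sq_iff_eq_or_eq_neg.1 (by rw [h3, one_pow])
  rcases h4 with h4 | h4
  · exact Or.inl ((inner_eq_one_iff_of_norm_eq_one (norm_coe_H1 _) (norm_coe_H1 _)).1 h4).symm
  · right
    rw [(inner_eq_neg_one_iff_of_norm_eq_one (norm_coe_H1 _) (norm_coe_H1 _)).1 h4, neg_neg]

/-! ### The fluxes of the limit equation -/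

lemma cross_apply_zero (v w : E3) : cross v w 0 = v 1 * w 2 - v 2 * w 1 := rfl

lemma cross_apply_one (v w : E3) : cross v w 1 = v 2 * w 0 - v 0 * w 2 := rfl

lemma cross_apply_two (v w : E3) : cross v w 2 = v 0 * w 1 - v 1 * w 0 := rfl

/-- The rotation of `v` by the unit quaternion `y`, by Rodrigues' formula. -/
def rodrigues (v : E3) (y : H1) (i : Fin 3) : ℝ :=
  (2 * (y : Quat).re ^ 2 - 1) * v i + 2 * (∑ a, v a * imVec y a) * imVec y i
    + 2 * (y : Quat).re * cross (imVec y) v i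

lemma continuous_rodrigues (v : E3) (i : Fin 3) : Continuous fun y => rodrigues v y i := by
  have hre := continuous_re_coe
  have him := continuous_imVec
  have hlin := continuous_sum_mul_imVec v
  have hcr : Continuous fun y : H1 => cross (imVec (y : Quat)) v i := by
    fin_cases i
    · exact ((him 1).mul continuous_const).sub ((him 2).mul continuous_const)
    · exact ((him 2).mul continuous_const).sub ((him 0).mul continuous_const)
    · exact ((him 0).mul continuous_const).sub ((him 1).mul continuous_const)
  exact (((continuous_const.mul (hre.pow 2)).sub continuous_const).mul continuous_const).add
    ((continuous_const.mul hlin).mul (him i)) |>.add ((continuous_const.mul hre).mul hcr)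

/-- The rate of change of the equilibrium along the characteristics, without the equilibrium itself:
`c`, `g` are the derivatives of the density and `ω₀`, `ω` those of the mean quaternion. -/
def rate (c κ : ℝ) (v g ω₀ : E3) (ω : Fin 3 → E3) (y : H1) : ℝ :=
  (c + κ * (y : Quat).re * ∑ a, ω₀ a * imVec y a)
    + ∑ i, (g i + κ * (y : Quat).re * ∑ a, ω i a * imVec y a) * rodrigues v y i

lemma continuous_rate (c κ : ℝ) (v g ω₀ : E3) (ω : Fin 3 → E3) :
    Continuous (rate c κ v g ω₀ ω) := by
  have hre := continuous_re_coe
  exact (continuous_const.add ((continuous_const.mul hre).mul (continuous_sum_mul_imVec ω₀))).add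
    (continuous_finsetSum _ fun i _ => (continuous_const.add ((continuous_const.mul hre).mul
      (continuous_sum_mul_imVec (ω i)))).mul (continuous_rodrigues v i))

lemma integral_mul_rate_mul_imVec {φ : ℝ → ℝ} (hφ : Continuous φ) (c κ : ℝ) (v g ω₀ : E3)
    (ω : Fin 3 → E3) (k : Fin 3) :
    ∫ y : H1, φ (y : Quat).re * (rate c κ v g ω₀ ω y * imVec y k) ∂dq
      = (κ * ω₀ k + 2 * cross v g k) / 3
          * ∫ y : H1, φ (y : Quat).re * (y : Quat).re * (1 - (y : Quat).re ^ 2) ∂dq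
        + κ * (∑ i, v i * ω i k) / 3 * ∫ y : H1, φ (y : Quat).re * (y : Quat).re
          * (2 * (y : Quat).re ^ 2 - 1) * (1 - (y : Quat).re ^ 2) ∂dq
        + 2 * κ * (∑ i, v i * ω i k + ∑ a, ω k a * v a + (∑ i, ω i i) * v k) / 15
          * ∫ y : H1, φ (y : Quat).re * (y : Quat).re * (1 - (y : Quat).re ^ 2) ^ 2 ∂dq := by
  have hre := continuous_re_coe
  have him := continuous_imVec
  have hφr : Continuous fun y : H1 => φ (y : Quat).re := hφ.comp hre
  set c₁ : E3 := κ • ω₀ + (2 : ℝ) • cross v g with hc₁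
  set c₂ : E3 := ∑ i, v i • ω i with hc₂
  have hφ₁ : Continuous fun r => φ r * r := by fun_prop
  have hφ₂ : Continuous fun r => φ r * r * (2 * r ^ 2 - 1) := by fun_prop
  have m1 := integral_lin_moment hφ₁ c₁ k
  have m2 := integral_lin_moment hφ₂ c₂ k
  have m3 := integral_cubic_moment hφ₁ v ω k
  have i1 : Integrable (fun y : H1 => φ (y : Quat).re * (y : Quat).re
      * ((∑ a, c₁ a * imVec y a) * imVec y k)) dq :=
    integrable_of_continuous ((hφr.mul hre).mul ((continuous_sum_mul_imVec c₁).mul (him k)))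
  have i2 : Integrable (fun y : H1 => κ * (φ (y : Quat).re * (y : Quat).re
      * (2 * (y : Quat).re ^ 2 - 1) * ((∑ a, c₂ a * imVec y a) * imVec y k))) dq :=
    integrable_of_continuous (continuous_const.mul (((hφr.mul hre).mul
      ((continuous_const.mul (hre.pow 2)).sub continuous_const)).mul
      ((continuous_sum_mul_imVec c₂).mul (him k))))
  have i3c : Continuous fun y : H1 => 2 * κ * (φ (y : Quat).re * (y : Quat).re
      * ((∑ b, v b * imVec y b) * (∑ i, imVec y i * ∑ a, ω i a * imVec y a) * imVec y k)) :=
    continuous_const.mul ((hφr.mul hre).mul (((continuous_sum_mul_imVec v).mul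
      (continuous_finsetSum _ fun i _ => (him i).mul (continuous_sum_mul_imVec (ω i)))).mul (him k)))
  have i3 := integrable_of_continuous i3c
  have hc₁a : ∀ a, c₁ a = κ * ω₀ a + 2 * cross v g a := fun a => by
    simp only [hc₁, PiLp.add_apply, PiLp.smul_apply, smul_eq_mul]
  have hc₂a : ∀ a, c₂ a = ∑ i, v i * ω i a := fun a => by
    simp [hc₂, Fin.sum_univ_three]
  have hint := integral_eq_of_even_part
    (Ξ := fun y : H1 => φ (y : Quat).re * (rate c κ v g ω₀ ω y * imVec y k))
    (E := fun y : H1 => φ (y : Quat).re * (y : Quat).re * ((∑ a, c₁ a * imVec y a) * imVec y k)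
      + (κ * (φ (y : Quat).re * (y : Quat).re * (2 * (y : Quat).re ^ 2 - 1)
          * ((∑ a, c₂ a * imVec y a) * imVec y k))
        + 2 * κ * (φ (y : Quat).re * (y : Quat).re
      * ((∑ b, v b * imVec y b) * (∑ i, imVec y i * ∑ a, ω i a * imVec y a) * imVec y k))))
    (hφr.mul ((continuous_rate c κ v g ω₀ ω).mul (him k)))
    (((hφr.mul hre).mul ((continuous_sum_mul_imVec c₁).mul (him k))).add
      ((continuous_const.mul (((hφr.mul hre).mul
      ((continuous_const.mul (hre.pow 2)).sub continuous_const)).mul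
      ((continuous_sum_mul_imVec c₂).mul (him k)))).add i3c)) fun y => by
    simp only [rate, rodrigues, starIso_re, starIso_imVec, Fin.sum_univ_three, cross_apply_zero,
      cross_apply_one, cross_apply_two, hc₁a, hc₂a]
    ring
  refine hint.trans ((integral_add i1 (i2.add i3)).trans ?_)
  simp only [Pi.add_apply]
  rw [integral_add i2 i3, integral_const_mul,
    integral_const_mul, m1, m2, m3, hc₁a, hc₂a]
  ring

lemma integral_mul_rate {φ : ℝ → ℝ} (hφ : Continuous φ) (c κ : ℝ) (v g ω₀ : E3)
    (ω : Fin 3 → E3) :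
    ∫ y : H1, φ (y : Quat).re * rate c κ v g ω₀ ω y ∂dq
      = c * ∫ y : H1, φ (y : Quat).re ∂dq
        + (∑ i, g i * v i) * ∫ y : H1, φ (y : Quat).re * ((4 * (y : Quat).re ^ 2 - 1) / 3) ∂dq
        + 2 * κ / 3 * (∑ i, cross (ω i) v i)
          * ∫ y : H1, φ (y : Quat).re * (y : Quat).re ^ 2 * (1 - (y : Quat).re ^ 2) ∂dq := by
  have hre := continuous_re_coe
  have him := continuous_imVec
  have hφr : Continuous fun y : H1 => φ (y : Quat).re := hφ.comp hre
  have hφ₂ : Continuous fun r => φ r * r ^ 2 := by fun_prop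
  -- the coefficients of the quadratic form `∑ i, (ω i · w) (w × v)_i`
  set b : Fin 3 → E3 := ![v 1 • ω 2 - v 2 • ω 1, v 2 • ω 0 - v 0 • ω 2, v 0 • ω 1 - v 1 • ω 0] with hb
  have i0 : Integrable (fun y : H1 => c * φ (y : Quat).re) dq :=
    integrable_of_continuous (continuous_const.mul hφr)
  have i1c : Continuous fun y : H1 => (∑ i, g i * v i)
      * (φ (y : Quat).re * (2 * (y : Quat).re ^ 2 - 1)) :=
    continuous_const.mul (hφr.mul ((continuous_const.mul (hre.pow 2)).sub continuous_const))
  have i1 := integrable_of_continuous i1c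
  have i2c : ∀ k, Continuous fun y : H1 =>
      2 * g k * (φ (y : Quat).re * ((∑ a, v a * imVec y a) * imVec y k)) := fun k =>
    continuous_const.mul (hφr.mul ((continuous_sum_mul_imVec v).mul (him k)))
  have i2 := fun k => integrable_of_continuous (i2c k)
  have i3c : ∀ k, Continuous fun y : H1 => 2 * κ * (φ (y : Quat).re * (y : Quat).re ^ 2
      * ((∑ a, b k a * imVec y a) * imVec y k)) := fun k =>
    continuous_const.mul ((hφr.mul (hre.pow 2)).mul ((continuous_sum_mul_imVec (b k)).mul (him k)))
  have i3 := fun k => integrable_of_continuous (i3c k)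
  have i2s := integrable_finsetSum Finset.univ fun k _ => i2 k
  have i3s := integrable_finsetSum Finset.univ fun k _ => i3 k
  have hint := integral_eq_of_even_part
    (Ξ := fun y : H1 => φ (y : Quat).re * rate c κ v g ω₀ ω y)
    (E := fun y : H1 => c * φ (y : Quat).re + ((∑ i, g i * v i)
      * (φ (y : Quat).re * (2 * (y : Quat).re ^ 2 - 1))
      + (∑ k, 2 * g k * (φ (y : Quat).re * ((∑ a, v a * imVec y a) * imVec y k))
      + ∑ k, 2 * κ * (φ (y : Quat).re * (y : Quat).re ^ 2
      * ((∑ a, b k a * imVec y a) * imVec y k)))))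
    (hφr.mul (continuous_rate c κ v g ω₀ ω))
    ((continuous_const.mul hφr).add (i1c.add ((continuous_finsetSum _ fun k _ => i2c k).add
      (continuous_finsetSum _ fun k _ => i3c k)))) fun y => by
    simp only [rate, rodrigues, starIso_re, starIso_imVec, Fin.sum_univ_three, cross_apply_zero,
      cross_apply_one, cross_apply_two, hb, Matrix.cons_val, PiLp.sub_apply, PiLp.smul_apply,
      smul_eq_mul]
    ring
  have h4 : ∫ y : H1, φ (y : Quat).re * ((4 * (y : Quat).re ^ 2 - 1) / 3) ∂dq
      = ∫ y : H1, φ (y : Quat).re * (2 * (y : Quat).re ^ 2 - 1) ∂dq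
        + 2 / 3 * ∫ y : H1, φ (y : Quat).re * (1 - (y : Quat).re ^ 2) ∂dq := by
    rw [← integral_const_mul, ← integral_add]
    · congr 1
      ext y
      ring
    · exact integrable_of_continuous
        (hφr.mul ((continuous_const.mul (hre.pow 2)).sub continuous_const))
    · exact integrable_of_continuous
        (continuous_const.mul (hφr.mul (continuous_const.sub (hre.pow 2))))
  refine hint.trans ((integral_add i0 (i1.add (i2s.add i3s))).trans ?_)
  simp only [Pi.add_apply]
  have e1 := integral_add i1 (i2s.add i3s)
  simp only [Pi.add_apply] at e1
  rw [e1, integral_add i2s i3s, integral_finsetSum _ fun k _ => i2 k, integral_finsetSum _ fun k _ => i3 k]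
  simp only [integral_const_mul, integral_lin_moment hφ, integral_lin_moment hφ₂]
  rw [h4]
  simp only [Fin.sum_univ_three, hb, cross_apply_zero,
      cross_apply_one, cross_apply_two, Matrix.cons_val, PiLp.sub_apply, PiLp.smul_apply,
      smul_eq_mul]
  ring

/-! ### Derivatives of the local equilibria -/

lemma ofVec_imVec {p : Quat} (hp : p.re = 0) : ofVec (imVec p) = p := by
  ext <;> simp [hp]

lemma re_mul_star (A : Quat) (q : H1) : (A * star (q : Quat)).re = inner ℝ A (q : Quat) := by
  rw [Quaternion.inner_def]

lemma star_mul_coe (q : H1) : star (q : Quat) * (q : Quat) = 1 := by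
  rw [Quaternion.star_mul_self, Quaternion.normSq_eq_norm_mul_self, norm_coe_H1]
  simp

/-- A tangent vector at `q` is the product of an imaginary quaternion and `q`. -/
lemma ofVec_imVec_mul {A : Quat} {q : H1} (h : inner ℝ A (q : Quat) = 0) :
    ofVec (imVec (A * star (q : Quat))) * (q : Quat) = A := by
  rw [ofVec_imVec (by rw [re_mul_star, h]), mul_assoc, star_mul_coe, mul_one]

lemma inner_mul_coe {A : Quat} {q : H1} (h : inner ℝ A (q : Quat) = 0) (y : H1) :
    inner ℝ A ((y * q : H1) : Quat) = ∑ a, imVec (A * star (q : Quat)) a * imVec (y : Quat) a := by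
  conv_lhs => rw [← ofVec_imVec_mul h]
  generalize imVec (A * star (q : Quat)) = v
  have h2 := (mulRightIso q).inner_map_map (ofVec v) (y : Quat)
  have h3 : ∀ p : Quat, mulRightIso q p = p * q := fun p => rfl
  rw [Metric.unitSphere.coe_mul, ← h3, ← h3, h2, inner_quat]
  simp [Fin.sum_univ_three]

lemma mul_ofVec_mul_star (e : E3) (q : H1) :
    (q : Quat) * ofVec e * star (q : Quat) = ofVec (rotate e q) := by
  rw [rotate, ofVec_imVec]
  simp
  ring

lemma rotate_mul (e : E3) (y q : H1) (i : Fin 3) :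
    rotate e ((y * q : H1) : Quat) i = rodrigues (rotate e q) y i := by
  have h : rotate e ((y * q : H1) : Quat) = rotate (rotate e q) y := by
    conv_rhs => rw [rotate, ← mul_ofVec_mul_star]
    rw [rotate, Metric.unitSphere.coe_mul, star_mul]
    simp only [mul_assoc]
  rw [h]
  generalize rotate e q = v
  have hy := sum_sq_imVec y
  simp only [rotate, rodrigues, Fin.sum_univ_three]
  fin_cases i <;> simp [cross_apply_zero, cross_apply_one, cross_apply_two]
  · linear_combination (-v 0) * hy
  · linear_combination (-v 1) * hy
  · linear_combination (-v 2) * hy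

section derivatives

variable {E : Type} [NormedAddCommGroup E] [NormedSpace ℝ E]

lemma inner_deriv_eq_zero {Q : E → H1} {Q' : E →L[ℝ] Quat} {z : E}
    (hQ : HasFDerivAt (fun z => (Q z : Quat)) Q' z) (e : E) : inner ℝ (Q' e) (Q z : Quat) = 0 := by
  have h1 := hQ.inner ℝ hQ
  have h2 : (fun z => inner ℝ (Q z : Quat) (Q z : Quat)) = fun _ => (1 : ℝ) := funext fun z => by
    rw [real_inner_self_eq_norm_sq, norm_coe_H1, one_pow]
  rw [h2] at h1
  have h3 := congrArg (fun L => L e) (h1.unique (hasFDerivAt_const 1 z))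
  rw [real_inner_comm]
  simpa [real_inner_comm] using h3

lemma integral_gibbs (d : ℝ) (qbar : H1) :
    ∫ q, gibbs d qbar q ∂dq = ∫ y : H1, gibbsFun d (y : Quat).re ∂dq := by
  rw [← integral_comp_mul_right qbar]
  refine integral_congr_ae (Eventually.of_forall fun y => ?_)
  simp only [gibbs, gibbsFun]
  rw [← rcoord, rcoord_mul_self]

/-- The derivative of a local equilibrium. -/
lemma hasFDerivAt_mul_vonMises (d : ℝ) {ρ : E → ℝ} {Q : E → H1} {ρ' : E →L[ℝ] ℝ}
    {Q' : E →L[ℝ] Quat} {z : E} (hρ : HasFDerivAt ρ ρ' z)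
    (hQ : HasFDerivAt (fun z => (Q z : Quat)) Q' z) (q : H1) :
    ∃ L : E →L[ℝ] ℝ, HasFDerivAt (fun z => ρ z * vonMises d (Q z) q) L z ∧ ∀ e, L e =
      (∫ y : H1, gibbsFun d (y : Quat).re ∂dq)⁻¹ * (gibbsFun d (rcoord (Q z) q)
        * (ρ' e + ρ z * (4 / d) * rcoord (Q z) q * inner ℝ (Q' e) (q : Quat))) := by
  have h1 := hQ.inner ℝ (hasFDerivAt_const (𝕜 := ℝ) (q : Quat) z)
  have h2 := (hasDerivAt_gibbsFun d _).comp_hasFDerivAt z h1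
  have h3 := (hρ.mul h2).mul_const (∫ y : H1, gibbsFun d (y : Quat).re ∂dq)⁻¹
  refine ⟨_, h3.congr_of_eventuallyEq (Eventually.of_forall fun z => ?_), fun e => ?_⟩
  · simp only [vonMises, integral_gibbs]
    simp only [gibbs, gibbsFun, Pi.mul_apply, Function.comp_apply]
    ring
  · simp [rcoord]
    ring

end derivatives

lemma partialX_rotate {Q : E3 → H1} {x : E3} (hQ : DifferentiableAt ℝ (fun y => (Q y : Quat)) x)
    (e : E3) (i j : Fin 3) :
    DifferentiableAt ℝ (fun y => rotate e (Q y) j) x ∧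
    partialX i (fun y => rotate e (Q y) j) x
      = 2 * cross (imVec (relPartial i (fun y => (Q y : Quat)) x)) (rotate e (Q x)) j := by
  have hd := hQ.hasFDerivAt
  set Q' := fderiv ℝ (fun y => (Q y : Quat)) x with hQ'
  have : StarModule ℝ Quat := ⟨fun r p => by simp⟩
  have h1 := (hd.mul_const' (ofVec e)).mul' hd.star
  have h2 := ((hasFDerivAt_const (𝕜 := ℝ) (iu j).val x).inner ℝ h1)
  have h3 : (fun y => rotate e (Q y) j) = fun y => inner ℝ (iu j).val
      ((Q y : Quat) * ofVec e * star (Q y : Quat)) := funext fun y => by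
    rw [rotate, inner_quat, val_iu]
    fin_cases j <;> simp
  have h4 := inner_deriv_eq_zero hd (EuclideanSpace.single i 1)
  have h5 := h2.congr_of_eventuallyEq (Eventually.of_forall fun y => congrFun h3 y)
  refine ⟨h5.differentiableAt, ?_⟩
  set A := Q' (EuclideanSpace.single i 1) with hA
  have h6 : partialX i (fun y => rotate e (Q y) j) x = inner ℝ (iu j).val
      ((Q x : Quat) * ofVec e * star A + A * (ofVec e * star (Q x : Quat))) := by
    rw [partialX, h5.fderiv]
    simp [mul_assoc, hA]
  have h7 : A = ofVec (imVec (relPartial i (fun y => (Q y : Quat)) x)) * (Q x : Quat) :=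
    (ofVec_imVec_mul h4).symm
  generalize imVec (relPartial i (fun y => (Q y : Quat)) x) = ω at h7 ⊢
  have h8 : (Q x : Quat) * ofVec e * star A + A * (ofVec e * star (Q x : Quat))
      = ofVec (rotate e (Q x)) * star (ofVec ω) + ofVec ω * ofVec (rotate e (Q x)) := by
    rw [h7, star_mul, ← mul_ofVec_mul_star]
    simp only [mul_assoc]
  rw [h6, h8, inner_quat, val_iu]
  generalize rotate e (Q x) = v
  fin_cases j <;> simp [cross_apply_zero, cross_apply_one, cross_apply_two] <;> ring

/-! ### The macroscopic equations -/

lemma ofVec_add (v w : E3) : ofVec (v + w) = ofVec v + ofVec w := by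
  ext <;> simp

lemma ofVec_smul (c : ℝ) (v : E3) : ofVec (c • v) = c • ofVec v := by
  ext <;> simp

lemma ofVec_zero : ofVec 0 = 0 := by
  simpa using ofVec_smul 0 0

section macroscopic

variable {d : ℝ} {ρ : ℝ → E3 → ℝ} {qbar : ℝ → E3 → H1} {t : ℝ} {x : E3}

/-- The weak form of the limit equation, in the frame of the mean quaternion. -/
lemma integral_transport_localEquilibrium (d : ℝ) (e₁ : E3)
    (hρ : DifferentiableAt ℝ (fun z : ℝ × E3 => ρ z.1 z.2) (t, x))
    (hq : DifferentiableAt ℝ (fun z : ℝ × E3 => (qbar z.1 z.2 : Quat)) (t, x))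
    {K : H1 → ℝ} (hK : Continuous K) :
    ∫ q, deriv (fun s => ρ s x * vonMises d (qbar s x) q) t * K q ∂dq
      + ∑ i, ∫ q, partialX i (fun y => ρ t y * vonMises d (qbar t y) q) x
        * (rotate e₁ q i * K q) ∂dq
    = (∫ y : H1, gibbsFun d (y : Quat).re ∂dq)⁻¹ * ∫ y : H1, gibbsFun d (y : Quat).re
      * (rate (deriv (fun s => ρ s x) t) (ρ t x * (4 / d)) (rotate e₁ (qbar t x)) (gradX (ρ t) x)
        (imVec (deriv (fun s => (qbar s x : Quat)) t * star (qbar t x : Quat)))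
        (fun i => imVec (relPartial i (fun y => (qbar t y : Quat)) x)) y
          * K (y * qbar t x)) ∂dq := by
  have hρt : DifferentiableAt ℝ (fun s => ρ s x) t :=
    hρ.comp (f := fun s : ℝ => (s, x)) t (by fun_prop)
  have hqt : DifferentiableAt ℝ (fun s => (qbar s x : Quat)) t :=
    hq.comp (f := fun s : ℝ => (s, x)) t (by fun_prop)
  have hρx : DifferentiableAt ℝ (ρ t) x := hρ.comp (f := fun y : E3 => (t, y)) x (by fun_prop)
  have hqx : DifferentiableAt ℝ (fun y => (qbar t y : Quat)) x :=
    hq.comp (f := fun y : E3 => (t, y)) x (by fun_prop)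
  have hg : Continuous fun y : H1 => gibbsFun d (y : Quat).re :=
    (continuous_gibbsFun d).comp continuous_re_coe
  set Z := ∫ y : H1, gibbsFun d (y : Quat).re ∂dq with hZ
  set ω₀ := imVec (deriv (fun s => (qbar s x : Quat)) t * star (qbar t x : Quat)) with hω₀
  set ω := fun i => imVec (relPartial i (fun y => (qbar t y : Quat)) x) with hω
  have hu : ∀ y : H1, deriv (fun s => ρ s x * vonMises d (qbar s x) (y * qbar t x)) t
      = Z⁻¹ * (gibbsFun d (y : Quat).re * (deriv (fun s => ρ s x) t
        + ρ t x * (4 / d) * (y : Quat).re * ∑ a, ω₀ a * imVec y a)) := fun y => by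
    obtain ⟨L, hL, hLe⟩ := hasFDerivAt_mul_vonMises d hρt.hasFDerivAt hqt.hasFDerivAt (y * qbar t x)
    have h1 := inner_mul_coe (inner_deriv_eq_zero hqt.hasFDerivAt 1) y
    rw [hL.hasDerivAt.deriv, hLe, h1, rcoord_mul_self, fderiv_eq_smul_deriv, fderiv_eq_smul_deriv,
      one_smul, one_smul]
  have hw : ∀ i (y : H1), partialX i (fun z => ρ t z * vonMises d (qbar t z) (y * qbar t x)) x
      = Z⁻¹ * (gibbsFun d (y : Quat).re * (gradX (ρ t) x i
        + ρ t x * (4 / d) * (y : Quat).re * ∑ a, ω i a * imVec y a)) := fun i y => by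
    obtain ⟨L, hL, hLe⟩ := hasFDerivAt_mul_vonMises d hρx.hasFDerivAt hqx.hasFDerivAt (y * qbar t x)
    have h1 := inner_mul_coe (inner_deriv_eq_zero hqx.hasFDerivAt (EuclideanSpace.single i 1)) y
    rw [partialX, hL.fderiv, hLe, h1, rcoord_mul_self]
    rfl
  have hre := continuous_re_coe
  have hKc : Continuous fun y => K (y * qbar t x) := hK.comp (continuous_id.mul continuous_const)
  have hlin := continuous_sum_mul_imVec
  have i1 : Integrable (fun y : H1 => Z⁻¹ * (gibbsFun d (y : Quat).re * (deriv (fun s => ρ s x) t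
        + ρ t x * (4 / d) * (y : Quat).re * ∑ a, ω₀ a * imVec y a)) * K (y * qbar t x)) dq :=
    integrable_of_continuous ((continuous_const.mul (hg.mul (continuous_const.add
      ((continuous_const.mul hre).mul (hlin ω₀))))).mul hKc)
  have i2 : ∀ i, Integrable (fun y : H1 => Z⁻¹ * (gibbsFun d (y : Quat).re * (gradX (ρ t) x i
        + ρ t x * (4 / d) * (y : Quat).re * ∑ a, ω i a * imVec y a))
        * (rodrigues (rotate e₁ (qbar t x)) y i * K (y * qbar t x))) dq := fun i =>
    integrable_of_continuous ((continuous_const.mul (hg.mul (continuous_const.add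
      ((continuous_const.mul hre).mul (hlin (ω i)))))).mul ((continuous_rodrigues _ i).mul hKc))
  have e1 : ∫ q, deriv (fun s => ρ s x * vonMises d (qbar s x) q) t * K q ∂dq
      = ∫ y : H1, Z⁻¹ * (gibbsFun d (y : Quat).re * (deriv (fun s => ρ s x) t
        + ρ t x * (4 / d) * (y : Quat).re * ∑ a, ω₀ a * imVec y a)) * K (y * qbar t x) ∂dq := by
    rw [← integral_comp_mul_right (qbar t x)]
    simp only [hu]
  have e2 : ∀ i, ∫ q, partialX i (fun y => ρ t y * vonMises d (qbar t y) q) x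
        * (rotate e₁ q i * K q) ∂dq
      = ∫ y : H1, Z⁻¹ * (gibbsFun d (y : Quat).re * (gradX (ρ t) x i
        + ρ t x * (4 / d) * (y : Quat).re * ∑ a, ω i a * imVec y a))
        * (rodrigues (rotate e₁ (qbar t x)) y i * K (y * qbar t x)) ∂dq := fun i => by
    rw [← integral_comp_mul_right (qbar t x)]
    simp only [hw, rotate_mul]
  rw [e1, Finset.sum_congr rfl fun i _ => e2 i, ← integral_finsetSum _ fun i _ => i2 i,
    ← integral_add i1 (integrable_finsetSum _ fun i _ => i2 i), ← integral_const_mul]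
  refine integral_congr_ae (Eventually.of_forall fun y => ?_)
  simp only [rate, Fin.sum_univ_three]
  ring

/-- The weak form with the test function `1` is the continuity equation. -/
lemma continuityEq_of_integral_eq_zero (e₁ : E3)
    (hρ : DifferentiableAt ℝ (fun z : ℝ × E3 => ρ z.1 z.2) (t, x))
    (hq : DifferentiableAt ℝ (fun z : ℝ × E3 => (qbar z.1 z.2 : Quat)) (t, x))
    (h : ∫ q, deriv (fun s => ρ s x * vonMises d (qbar s x) q) t ∂dq
      + ∑ i, ∫ q, partialX i (fun y => ρ t y * vonMises d (qbar t y) q) x * rotate e₁ q i ∂dq = 0) :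
    ContinuityEq d e₁ ρ qbar t x := by
  have hρx : DifferentiableAt ℝ (ρ t) x := hρ.comp (f := fun y : E3 => (t, y)) x (by fun_prop)
  have hqx : DifferentiableAt ℝ (fun y => (qbar t y : Quat)) x :=
    hq.comp (f := fun y : E3 => (t, y)) x (by fun_prop)
  have h1 := integral_transport_localEquilibrium d e₁ hρ hq (K := fun _ => 1) continuous_const
  simp only [mul_one] at h1
  rw [h, integral_mul_rate (continuous_gibbsFun d), ← c1_eq] at h1
  have h2 := integral_gibbsFun_identity d
  rw [← c1_eq] at h2
  have hZ : 0 < ∫ y : H1, gibbsFun d (y : Quat).re ∂dq := by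
    rw [← integral_gibbs d 1]
    exact (integral_vonMises d 1).1
  set Z := ∫ y : H1, gibbsFun d (y : Quat).re ∂dq
  set J := ∫ y : H1, gibbsFun d (y : Quat).re * (y : Quat).re ^ 2 * (1 - (y : Quat).re ^ 2) ∂dq
  have h3 := (mul_eq_zero.1 h1.symm).resolve_left (inv_ne_zero hZ.ne')
  have hp : ∀ i, partialX i (fun y => ((c1 d * ρ t y) • rotate e₁ (qbar t y)) i) x
      = c1 d * (gradX (ρ t) x i * rotate e₁ (qbar t x) i + ρ t x * (2 * cross (imVec
        (relPartial i (fun y => (qbar t y : Quat)) x)) (rotate e₁ (qbar t x)) i)) := fun i => by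
    obtain ⟨h4, h5⟩ := partialX_rotate hqx e₁ i i
    rw [← h5]
    have h6 := (hρx.hasFDerivAt.const_mul (c1 d)).mul h4.hasFDerivAt
    have h7 : (fun y => ((c1 d * ρ t y) • rotate e₁ (qbar t y)) i)
      = fun y => c1 d * ρ t y * rotate e₁ (qbar t y) i := rfl
    rw [h7, partialX]
    erw [h6.fderiv]
    simp [gradX, partialX]
    ring
  rw [ContinuityEq, divX]
  simp only [hp]
  refine (mul_eq_zero.1 ?_).resolve_right hZ.ne'
  simp only [Fin.sum_univ_three] at h3 ⊢
  linear_combination h3 + 2 * ρ t x * (cross (imVec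
    (relPartial 0 (fun y => (qbar t y : Quat)) x)) (rotate e₁ (qbar t x)) 0 + cross (imVec
    (relPartial 1 (fun y => (qbar t y : Quat)) x)) (rotate e₁ (qbar t x)) 1 + cross (imVec
    (relPartial 2 (fun y => (qbar t y : Quat)) x)) (rotate e₁ (qbar t x)) 2) * h2

/-- The weak form with the collision invariants as test functions is the equation of the
orientation. -/
lemma orientationEq_of_integral_eq_zero (hd : 0 < d) {h h' : ℝ → ℝ} (hh : IsRegularProfile d h h')
    (e₁ : E3) (hρ : DifferentiableAt ℝ (fun z : ℝ × E3 => ρ z.1 z.2) (t, x))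
    (hq : DifferentiableAt ℝ (fun z : ℝ × E3 => (qbar z.1 z.2 : Quat)) (t, x))
    (h0 : ∀ k, ∫ q, deriv (fun s => ρ s x * vonMises d (qbar s x) q) t * gci h k (qbar t x) q ∂dq
      + ∑ i, ∫ q, partialX i (fun y => ρ t y * vonMises d (qbar t y) q) x
        * (rotate e₁ q i * gci h k (qbar t x) q) ∂dq = 0) :
    OrientationEq d h e₁ ρ qbar t x := by
  have hqt : DifferentiableAt ℝ (fun s => (qbar s x : Quat)) t :=
    hq.comp (f := fun s : ℝ => (s, x)) t (by fun_prop)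
  have hqx : DifferentiableAt ℝ (fun y => (qbar t y : Quat)) x :=
    hq.comp (f := fun y : E3 => (t, y)) x (by fun_prop)
  have hhc := hh.continuous
  have hφ : Continuous fun r => gibbsFun d r * h r := (continuous_gibbsFun d).mul hhc
  have hgci : ∀ k, Continuous (gci h k (qbar t x)) := fun k =>
    (continuous_pcoord _ k).mul (hhc.comp (continuous_rcoord _))
  have hZ : 0 < ∫ y : H1, gibbsFun d (y : Quat).re ∂dq := by
    rw [← integral_gibbs d 1]
    exact (integral_vonMises d 1).1
  set v := rotate e₁ (qbar t x) with hv
  set g := gradX (ρ t) x with hg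
  set A₀ := deriv (fun s => (qbar s x : Quat)) t with hA₀
  set A : Fin 3 → Quat := fun i => partialX i (fun y => (qbar t y : Quat)) x with hA
  set ω₀ := imVec (A₀ * star (qbar t x : Quat)) with hω₀
  set ω : Fin 3 → E3 := fun i => imVec (relPartial i (fun y => (qbar t y : Quat)) x) with hω
  have hA₀eq : A₀ = ofVec ω₀ * (qbar t x : Quat) := by
    have := inner_deriv_eq_zero hqt.hasFDerivAt 1
    rw [fderiv_eq_smul_deriv, one_smul] at this
    exact (ofVec_imVec_mul this).symm
  have hAeq : ∀ i, A i = ofVec (ω i) * (qbar t x : Quat) := fun i =>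
    (ofVec_imVec_mul (inner_deriv_eq_zero hqx.hasFDerivAt (EuclideanSpace.single i 1))).symm
  obtain ⟨hN, hc2, hc4⟩ := hh.c2_c4_eq hd
  set N := ∫ q : H1, gibbsFun d (q : Quat).re * ((q : Quat).re * h (q : Quat).re
        * (1 - (q : Quat).re ^ 2)) ∂dq with hNd
  -- the components of the equation in the frame
  have key : ∀ k, ρ t x * (ω₀ k + c2 d h * ∑ i, v i * ω i k) + c3 d * cross v g k
      + c4 d h * ρ t x * (∑ a, ω k a * v a + (∑ i, ω i i) * v k) = 0 := fun k => by
    have h1 := integral_transport_localEquilibrium d e₁ hρ hq (hgci k)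
    rw [h0 k] at h1
    have h2 : ∫ y : H1, gibbsFun d (y : Quat).re * (rate (deriv (fun s => ρ s x) t)
        (ρ t x * (4 / d)) v g ω₀ ω y * gci h k (qbar t x) (y * qbar t x)) ∂dq = 0 :=
      (mul_eq_zero.1 h1.symm).resolve_left (inv_ne_zero hZ.ne')
    have e0 : ∀ y : H1, gibbsFun d (y : Quat).re * (rate (deriv (fun s => ρ s x) t)
        (ρ t x * (4 / d)) v g ω₀ ω y * gci h k (qbar t x) (y * qbar t x))
        = gibbsFun d (y : Quat).re * h (y : Quat).re * (rate (deriv (fun s => ρ s x) t)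
        (ρ t x * (4 / d)) v g ω₀ ω y * imVec y k) := fun y => by
      rw [gci, pcoord_mul_self, rcoord_mul_self]
      ring
    simp only [e0] at h2
    rw [integral_mul_rate_mul_imVec hφ] at h2
    have hφr : Continuous fun y : H1 => gibbsFun d (y : Quat).re * h (y : Quat).re :=
      hφ.comp continuous_re_coe
    have hre := continuous_re_coe
    have e1 : ∫ y : H1, gibbsFun d (y : Quat).re * h (y : Quat).re * (y : Quat).re
        * (1 - (y : Quat).re ^ 2) ∂dq = N := by
      rw [hNd]
      congr 1
      ext y
      ring
    set I₂ := ∫ y : H1, gibbsFun d (y : Quat).re * h (y : Quat).re * (y : Quat).re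
      * (2 * (y : Quat).re ^ 2 - 1) * (1 - (y : Quat).re ^ 2) ∂dq with hI₂
    set I₃ := ∫ y : H1, gibbsFun d (y : Quat).re * h (y : Quat).re * (y : Quat).re
      * (1 - (y : Quat).re ^ 2) ^ 2 ∂dq with hI₃
    have e4 : c4 d h * N = 2 / 5 * I₃ := by
      rw [hc4, hI₃, ← integral_const_mul]
      congr 1
      ext y
      ring
    have e2 : c2 d h * N = I₂ + 2 / 5 * I₃ := by
      have j2 : Integrable (fun y : H1 => gibbsFun d (y : Quat).re * h (y : Quat).re
          * (y : Quat).re * (2 * (y : Quat).re ^ 2 - 1) * (1 - (y : Quat).re ^ 2)) dq :=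
        integrable_of_continuous (((hφr.mul hre).mul ((continuous_const.mul (hre.pow 2)).sub
          continuous_const)).mul (continuous_const.sub (hre.pow 2)))
      have j3 : Integrable (fun y : H1 => 2 / 5 * (gibbsFun d (y : Quat).re * h (y : Quat).re
          * (y : Quat).re * (1 - (y : Quat).re ^ 2) ^ 2)) dq :=
        integrable_of_continuous (continuous_const.mul ((hφr.mul hre).mul
          ((continuous_const.sub (hre.pow 2)).pow 2)))
      rw [hc2, hI₂, hI₃, ← integral_const_mul, ← integral_add j2 j3]
      congr 1
      ext y
      ring
    rw [e1] at h2
    have hdd : d * (4 / d) = 4 := by field_simp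
    refine (mul_eq_zero.1 ?_).resolve_right hN
    rw [c3]
    generalize 4 / d = κ at h2 hdd
    linear_combination 3 * d / 4 * h2 + ρ t x * (∑ i, v i * ω i k) * e2
      + ρ t x * (∑ a, ω k a * v a + (∑ i, ω i i) * v k) * e4
      - 1 / 4 * (ρ t x * ω₀ k * N + ρ t x * (∑ i, v i * ω i k) * I₂
        + 2 / 5 * ρ t x * (∑ i, v i * ω i k + ∑ a, ω k a * v a + (∑ i, ω i i) * v k) * I₃) * hdd
  have hrel : ∀ k, relGradMul (fun y => (qbar t y : Quat)) v x k = ∑ a, ω k a * v a := fun k => by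
    simp only [relGradMul, inner_quat, hω, Fin.sum_univ_three]
    simp
  have hvec : ρ t x • (ω₀ + c2 d h • ∑ i, v i • ω i) + c3 d • cross v g
      + (c4 d h * ρ t x) • (relGradMul (fun y => (qbar t y : Quat)) v x
        + relDiv (fun y => (qbar t y : Quat)) x • v) = 0 := by
    ext k
    have h1 := key k
    have h2 : relDiv (fun y => (qbar t y : Quat)) x = ∑ i, ω i i := rfl
    simp only [Fin.sum_univ_three, PiLp.add_apply, PiLp.smul_apply, smul_eq_mul, PiLp.zero_apply,
      hrel, h2] at h1 ⊢
    exact h1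
  have hadv : advect v (fun y => (qbar t y : Quat)) x = ofVec (∑ i, v i • ω i) * (qbar t x : Quat) := by
    have h1 : advect v (fun y => (qbar t y : Quat)) x = ∑ i, v i • A i := rfl
    rw [h1]
    simp only [hAeq, Fin.sum_univ_three, ofVec_add, ofVec_smul, add_mul, smul_mul_assoc]
  rw [OrientationEq, ← hv, ← hg, ← hA₀, hadv, hA₀eq]
  have h1 := congrArg (fun p => ofVec p * (qbar t x : Quat)) hvec
  simp only [ofVec_add, ofVec_smul, add_mul, smul_mul_assoc] at h1 ⊢
  rw [h1, ofVec_zero, zero_mul]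

end macroscopic

/-! ### The macroscopic limit -/

lemma continuous_gci {h : ℝ → ℝ} (hh : Continuous h) (k : Fin 3) :
    Continuous (Function.uncurry fun p q : H1 => gci h k p q) := by
  unfold gci rcoord pcoord
  simp only [Function.uncurry_def]
  fun_prop

lemma gci_neg {h : ℝ → ℝ} (hh : ∀ r, h (-r) = -h r) (k : Fin 3) {p qbar : H1}
    (hp : (p : Quat) = -qbar) (q : H1) : gci h k p q = gci h k qbar q := by
  simp only [gci, pcoord, rcoord, hp, mul_neg, inner_neg_left, hh, neg_mul, neg_neg]

lemma orientationEq_of_eq_zero {d : ℝ} {h : ℝ → ℝ} {e₁ : E3} {ρ : ℝ → E3 → ℝ} {qbar : ℝ → E3 → H1}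
    {t : ℝ} {x : E3} (hρ : ∀ y, 0 ≤ ρ t y) (h0 : ρ t x = 0) : OrientationEq d h e₁ ρ qbar t x := by
  -- the density is minimal at `x`
  have hmin : IsLocalMin (ρ t) x := Eventually.of_forall fun y => by rw [h0]; exact hρ y
  have hg : gradX (ρ t) x = 0 := by
    ext i
    simp [gradX, partialX, hmin.fderiv_eq_zero]
  have hc : ∀ v, cross v 0 = 0 := fun v => by
    ext i
    fin_cases i <;> simp [cross]
  rw [OrientationEq, h0, hg, hc, ofVec_zero]
  simp

lemma orientationEq_congr {d : ℝ} {h k : ℝ → ℝ} (hhk : EqOn h k (Ioo (-1) 1)) {e₁ : E3}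
    {ρ : ℝ → E3 → ℝ} {qbar : ℝ → E3 → H1} {t : ℝ} {x : E3}
    (hk : OrientationEq d k e₁ ρ qbar t x) : OrientationEq d h e₁ ρ qbar t x := by
  rw [OrientationEq, c2, c4] at hk ⊢
  rwa [angAvg_weightTwo_congr d hhk, angAvg_weightTwo_congr d hhk]

section limit

variable {ν D : ℝ} {e₁ : E3} {T ε₀ : ℝ} {f : ℝ → ℝ → E3 → H1 → ℝ} {ρ : ℝ → E3 → ℝ}
  {qbar : ℝ → E3 → H1} {t : ℝ} {x : E3}

lemma IsKineticFamily.exists_eq_vonMises (hν : 0 < ν) (hD : 0 < D) (hε₀ : 0 < ε₀)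
    (hf : IsKineticFamily ν D e₁ T ε₀ f) {F : ℝ → E3 → H1 → ℝ} (hF : FormalLimit T f F)
    (ht : t ∈ Ioo 0 T) (x : E3) :
    ∃ (r : ℝ) (p : H1), 0 ≤ r ∧ ∀ᵐ q ∂dq, F t x q = r * vonMises (D / ν) p q := by
  obtain ⟨m, hm, heq⟩ := hf.equation
  obtain ⟨h0, h1, h2⟩ := hF t ht x
  have hev : ∀ᶠ ε in 𝓝[>] (0 : ℝ), ε ∈ Ioo 0 ε₀ := Ioo_mem_nhdsGT hε₀
  exact exists_eq_vonMises_of_tendsto hν hD (hev.mono fun ε hε => hf.contDiff_two ε hε t ht x)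
    (hev.mono fun ε hε => hf.nonneg ε hε t ht x) h0 (fun ε => m ε t x)
    (hf.tendsto_integral_abs_collision hε₀ ht x (heq t ht x) h1 h2)

lemma IsKineticFamily.continuityEq (hε₀ : 0 < ε₀) (hf : IsKineticFamily ν D e₁ T ε₀ f)
    (ht : t ∈ Ioo 0 T) (hρ : DifferentiableAt ℝ (fun z : ℝ × E3 => ρ z.1 z.2) (t, x))
    (hq : DifferentiableAt ℝ (fun z : ℝ × E3 => (qbar z.1 z.2 : Quat)) (t, x))
    (hF : StrongLimit T f (fun t x q => ρ t x * vonMises (D / ν) (qbar t x) q)) :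
    ContinuityEq (D / ν) e₁ ρ qbar t x := by
  obtain ⟨m, hm, heq⟩ := hf.equation
  obtain ⟨-, h1, h2⟩ := hF t ht x
  have h3 := hf.integral_limit_eq_zero hε₀ ht x (heq t ht x) h1 h2 (l := 𝓝[>] (0 : ℝ)) le_rfl
    (K := fun _ _ => 1) (p := fun _ => 1) (p₀ := 1) continuous_const tendsto_const_nhds
    fun ε hε => by
      simp only [mul_one]
      exact integral_collision (hf.contDiff_two ε hε t ht x) ν D _
  simp only [mul_one] at h3
  exact continuityEq_of_integral_eq_zero e₁ hρ hq h3

lemma IsKineticFamily.orientationEq (hν : 0 < ν) (hD : 0 < D) (hε₀ : 0 < ε₀)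
    (hf : IsKineticFamily ν D e₁ T ε₀ f) {h h' : ℝ → ℝ} (hh : IsRegularProfile (D / ν) h h')
    (ht : t ∈ Ioo 0 T) (hρ0 : ∀ y, 0 ≤ ρ t y)
    (hρ : DifferentiableAt ℝ (fun z : ℝ × E3 => ρ z.1 z.2) (t, x))
    (hq : DifferentiableAt ℝ (fun z : ℝ × E3 => (qbar z.1 z.2 : Quat)) (t, x))
    (hF : StrongLimit T f (fun t x q => ρ t x * vonMises (D / ν) (qbar t x) q)) :
    OrientationEq (D / ν) h e₁ ρ qbar t x := by
  have hd : 0 < D / ν := div_pos hD hν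
  rcases (hρ0 x).eq_or_lt with h0 | hpos
  · exact orientationEq_of_eq_zero hρ0 h0.symm
  obtain ⟨m, hm, heq⟩ := hf.equation
  obtain ⟨hL, h1, h2⟩ := hF t ht x
  -- the mean quaternions converge along an ultrafilter, possibly to `-qbar`
  set U : Ultrafilter ℝ := Ultrafilter.of (𝓝[>] (0 : ℝ))
  have hU : (U : Filter ℝ) ≤ 𝓝[>] (0 : ℝ) := Ultrafilter.of_le _
  obtain ⟨p₀, -, hp₀⟩ := isCompact_univ.ultrafilter_le_nhds (U.map fun ε => m ε t x) (by simp)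
  have hp : Tendsto (fun ε => m ε t x) U (𝓝 p₀) := hp₀
  have hK : Continuous (Function.uncurry fun p q : H1 => rcoord p q ^ 2) := by
    unfold rcoord
    simp only [Function.uncurry_def]
    fun_prop
  have hle : ∫ q, ρ t x * vonMises (D / ν) (qbar t x) q * rcoord (qbar t x) q ^ 2 ∂dq
      ≤ ∫ q, ρ t x * vonMises (D / ν) (qbar t x) q * rcoord p₀ q ^ 2 ∂dq := by
    refine le_of_tendsto_of_tendsto
      (tendsto_integral_mul hU hL hK (p := fun _ => qbar t x) tendsto_const_nhds)
      (tendsto_integral_mul hU hL hK hp) ?_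
    filter_upwards [hU (Ioo_mem_nhdsGT hε₀), hU hL.2.1] with ε hε hi
    exact (hm ε hε t ht x).integral_le hi _
  have hgci : ∀ k q, gci h k p₀ q = gci h k (qbar t x) q := fun k q => by
    rcases eq_or_eq_neg_of_integral_le hd hpos _ _ hle with h3 | h3
    · rw [Subtype.ext h3]
    · exact gci_neg hh.odd k h3 q
  refine orientationEq_of_integral_eq_zero hd hh e₁ hρ hq fun k => ?_
  have h3 := hf.integral_limit_eq_zero hε₀ ht x (heq t ht x) h1 h2 hU
    (continuous_gci hh.continuous k) hp fun ε hε =>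
      integral_collision_mul_gci hν hD hh (hf.contDiff_two ε hε t ht x) (hm ε hε t ht x) k
  simpa only [hgci] using h3

end limit

end SOHQ

end

theorem theorem4p1 (ν D : ℝ) (hν : 0 < ν) (hD : 0 < D) (e₁ : SOHQ.E3) (he₁ : ‖e₁‖ = 1)
    (T : ℝ) (hT : 0 < T) :
    -- the profile `h` exists and is unique, and the averages that define the constants make sense
    (∃ h, SOHQ.IsGCIProfile (D / ν) h) ∧
    (∀ h k, SOHQ.IsGCIProfile (D / ν) h → SOHQ.IsGCIProfile (D / ν) k → EqOn h k (Ioo (-1) 1)) ∧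
    (∀ h, SOHQ.IsGCIProfile (D / ν) h →
      IntervalIntegrable (SOHQ.weightTwo (D / ν) h) volume 0 Real.pi ∧
      (∫ θ in (0 : ℝ)..Real.pi, SOHQ.weightTwo (D / ν) h θ) ≠ 0) ∧
    ∀ (ε₀ : ℝ) (f : ℝ → ℝ → SOHQ.E3 → SOHQ.H1 → ℝ), 0 < ε₀ →
      SOHQ.IsKineticFamily ν D e₁ T ε₀ f →
      -- the limit is a local equilibrium
      (∀ F : ℝ → SOHQ.E3 → SOHQ.H1 → ℝ, SOHQ.FormalLimit T f F →
        ∃ (ρ : ℝ → SOHQ.E3 → ℝ) (qbar : ℝ → SOHQ.E3 → SOHQ.H1),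
          ∀ t ∈ Ioo 0 T, ∀ x, 0 ≤ ρ t x ∧
            ∀ᵐ q ∂SOHQ.dq, F t x q = ρ t x * SOHQ.vonMises (D / ν) (qbar t x) q) ∧
      -- the macroscopic system
      (∀ (ρ : ℝ → SOHQ.E3 → ℝ) (qbar : ℝ → SOHQ.E3 → SOHQ.H1),
        (∀ t ∈ Ioo 0 T, ∀ x, 0 ≤ ρ t x) →
        DifferentiableOn ℝ (fun z : ℝ × SOHQ.E3 => ρ z.1 z.2) (Ioo 0 T ×ˢ univ) →
        DifferentiableOn ℝ (fun z : ℝ × SOHQ.E3 => (qbar z.1 z.2 : SOHQ.Quat))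
          (Ioo 0 T ×ˢ univ) →
        SOHQ.StrongLimit T f (fun t x q => ρ t x * SOHQ.vonMises (D / ν) (qbar t x) q) →
        ∀ h, SOHQ.IsGCIProfile (D / ν) h → ∀ t ∈ Ioo 0 T, ∀ x,
          SOHQ.ContinuityEq (D / ν) e₁ ρ qbar t x ∧
          SOHQ.OrientationEq (D / ν) h e₁ ρ qbar t x) := by
  have hd : 0 < D / ν := div_pos hD hν
  obtain ⟨k, k', hk⟩ := SOHQ.exists_isRegularProfile hd
  have hkp := hk.isGCIProfile
  have heq : ∀ h, SOHQ.IsGCIProfile (D / ν) h → EqOn h k (Ioo (-1) 1) := fun h hh => hh.eqOn hd hkp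
  refine ⟨⟨k, hkp⟩, fun h₁ h₂ hh₁ hh₂ => hh₁.eqOn hd hh₂, fun h hh => ⟨?_, ?_⟩,
    fun ε₀ f hε₀ hf => ⟨fun F hF => ?_, fun ρ qbar hρ0 hρ hq hF h hh t ht x => ⟨?_, ?_⟩⟩⟩
  · have hi := (SOHQ.continuous_weightTwo (D / ν) hk.continuous).intervalIntegrable (μ := volume)
      0 Real.pi
    rw [intervalIntegrable_iff_integrableOn_Ioo_of_le Real.pi_pos.le] at hi ⊢
    exact hi.congr_fun (SOHQ.weightTwo_congr (D / ν) (heq h hh)).symm measurableSet_Ioo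
  · have hne := hk.integral_weightTwo_ne_zero hd
    rw [intervalIntegral.integral_of_le Real.pi_pos.le, integral_Ioc_eq_integral_Ioo] at hne ⊢
    rwa [setIntegral_congr_fun measurableSet_Ioo (SOHQ.weightTwo_congr (D / ν) (heq h hh))]
  · have H : ∀ t x, ∃ (r : ℝ) (p : SOHQ.H1), t ∈ Ioo 0 T → 0 ≤ r ∧
        ∀ᵐ q ∂SOHQ.dq, F t x q = r * SOHQ.vonMises (D / ν) p q := fun t x => by
      by_cases ht : t ∈ Ioo 0 T
      · obtain ⟨r, p, h⟩ := hf.exists_eq_vonMises hν hD hε₀ hF ht x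
        exact ⟨r, p, fun _ => h⟩
      · exact ⟨0, 1, fun h => absurd h ht⟩
    choose ρ qbar h using H
    exact ⟨ρ, qbar, fun t ht x => h t x ht⟩
  all_goals
    have hmem : Ioo 0 T ×ˢ (univ : Set SOHQ.E3) ∈ 𝓝 (t, x) :=
      (isOpen_Ioo.prod isOpen_univ).mem_nhds ⟨ht, mem_univ _⟩
  · exact hf.continuityEq hε₀ ht (hρ.differentiableAt hmem) (hq.differentiableAt hmem) hF
  · exact SOHQ.orientationEq_congr (heq h hh) (hf.orientationEq hν hD hε₀ hk ht (hρ0 t ht)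
      (hρ.differentiableAt hmem) (hq.differentiableAt hmem) hF)
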